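/- Let $T=\mathbf R^2/\mathbf Z^2$ with symplectic form $dx\,dy$ and complex coordinate $x+iy$, let $L_{(m)}\subset T$ be the image of the line of slope $-m$ through the origin, and let $\tau(x,y)=(x,y-x)$, so that $\tau^{k}L_{(m)}=L_{(m+k)}$. Let $C$ be a commutative ring with an automorphism $\sigma$. For a commutative ring $A$ let $\Lambda_A$ be the Novikov ring of series $\sum_i a_it^{\lambda_i}$ with $a_i\in A$, $\lambda_i\in\mathbf R$, $\lambda_i\to\infty$. Let $\Lambda$ be $C[\![t]\!]$ (relative case) or $\Lambda_C$ (absolute case), with the $t$-adic topology; $\sigma$ acts on the coefficients and fixes every power of $t$. Let $\underline\Lambda$ be the locally constant sheaf of rings on $T$ pulled back along $(x,y)\mapsto x\in\mathbf R/\mathbf Z$ from the sheaf with étalé space $(\mathbf R\times\Lambda)/\big((x,c)\sim(x+1,\sigma(c))\big)$, and let $\nabla\gamma$ denote parallel transport along a path $\gamma$. For integers $m\ne n$ put $\mathrm{CF}(L_{(m)},L_{(n)};\underline\Lambda)=\bigoplus_{x\in L_{(m)}\cap L_{(n)}}\underline\Lambda_x$, writing $x\cdot a$ for $a\in\underline\Lambda_x$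 in the summand at $x$. For $m_0<m_1<m_2$ the triangle product $\mathrm{CF}(L_{(m_1)},L_{(m_2)};\underline\Lambda)\times\mathrm{CF}(L_{(m_0)},L_{(m_1)};\underline\Lambda)\to\mathrm{CF}(L_{(m_0)},L_{(m_2)};\underline\Lambda)$ is the bi-additive map $$(x_2\cdot b,\;x_1\cdot a)\longmapsto\sum_{y\in L_{(m_0)}\cap L_{(m_2)}}y\cdot\sum_{u}\pm t^{\mathrm{a}(u)}\,\nabla\gamma_2\big(b\,\nabla\gamma_1(a\,\nabla\gamma_0(1))\big),$$ where $u$ runs over the holomorphic triangles in $T$ (constant ones included) with counterclockwise vertices $y,x_1,x_2$ and sides $\gamma_0:y\to x_1$ on $L_{(m_0)}$, $\gamma_1:x_1\to x_2$ on $L_{(m_1)}$, $\gamma_2:x_2\to y$ on $L_{(m_2)}$. The sign is $(-1)^{N}$, where $N$ is the number of boundary points of the triangle mapped to the points $(\varepsilon,-m_j\varepsilon)\in L_{(m_j)}$, $j=0,1,2$, for a fixed irrational $\varepsilon$. In the absolute case $\mathrm a(u)=\int u^*(dx\,dy)$; in the relative case $\mathrm a(u)$ is the limit of $\#u^{-1}(D)$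 as the point $D$ tends to $(0,0)$ in the open first quadrant. Identifying $\mathrm{CF}(L_{(0)},L_{(m_2)};\underline\Lambda)$ with $\mathrm{CF}(L_{(m_1)},L_{(m_1+m_2)};\underline\Lambda)$ by $\tau^{m_1}$, these products define a multiplication on $\bigoplus_{m\ge1}\mathrm{CF}(L_{(0)},L_{(m)};\underline\Lambda)$. For $m>k\ge0$ let $x_{m,k/m}=(k/m,0)\in L_{(0)}\cap L_{(m)}$; for $a\in\Lambda$ write $x_{m,k/m}\cdot a$ for the element given by the class of $(k/m,a)$ in the stalk, and put $$\theta_{m,k}[a]=\sum_{i\in\mathbf Z}t^{m\frac{i(i-1)}2+ki}z^{mi+k}\sigma^i(a),\qquad \theta^{\mathrm{abs}}_{m,k}[a]=\sum_{i\in\mathbf Z}t^{\frac{(mi+k)^2}{2m}}z^{mi+k}\sigma^i(a).$$ **Theorem.** In the relative and in the absolute case all the sums over triangles converge $t$-adically, and $\bigoplus_{m\ge1}\mathrm{CF}(L_{(0)},L_{(m)};\underline\Lambda)$ is an associative, commutative graded ring without unit. In the relative case let $S_m$ be the $t$-adically closed $\mathbf Z[\![t]\!]$-linear span of the series $\theta_{m,k}[a]$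 with $0\le k<m$ and $a\in C$; in the absolute case let $S_m$ be the $t$-adically closed $\Lambda_{\mathbf Z}$-linear span of the series $\theta^{\mathrm{abs}}_{m,k}[a]$ with $0\le k<m$ and $a\in C$ (closures being taken coefficientwise in $z$). Then formal products of series in $S=\sum_{m\ge1}S_m$ converge and lie in $S$, and there is an isomorphism of graded rings without unit, linear over $\mathbf Z[\![t]\!]$ (resp. over $\Lambda_{\mathbf Z}$), $$\bigoplus_{m\ge1}\mathrm{CF}(L_{(0)},L_{(m)};\underline\Lambda)\;\xrightarrow{\ \sim\ }\;S,$$ which maps $\mathrm{CF}(L_{(0)},L_{(m)};\underline\Lambda)$ onto $S_m$ and sends $x_{m,k/m}\cdot a$ to $\theta_{m,k}[a]$ (resp. to $\theta^{\mathrm{abs}}_{m,k}[a]$) for all $m>k\ge0$ and all $a\in\Lambda$. -/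

import Mathlib

open scoped PowerSeries ContDiff Topology DirectSum

noncomputable section

/-! ## The Novikov ring -/

/-- The Novikov ring `Λ_C`: formal sums `∑ a_λ t^λ` with real exponents `λ` and coefficients in
`C`, such that only finitely many exponents lie below any given bound. -/
def novikovSubring (C : Type*) [CommRing C] : Subring (HahnSeries ℝ C) where
  carrier := {f | ∀ N : ℝ, (f.support ∩ Set.Iic N).Finite}
  zero_mem' := fun N => by simp
  one_mem' := fun N =>
    (Set.finite_singleton (0 : ℝ)).subset fun x hx => HahnSeries.support_single_subset hx.1
  add_mem' := fun {f g} hf hg N =>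
    ((hf N).union (hg N)).subset fun x hx => by
      rcases HahnSeries.support_add_subset f g hx.1 with h | h
      · exact Or.inl ⟨h, hx.2⟩
      · exact Or.inr ⟨h, hx.2⟩
  neg_mem' := fun {f} hf N => by
    rw [HahnSeries.support_neg]
    exact hf N
  mul_mem' := fun {f g} hf hg N => by
    have bdd : ∀ h : HahnSeries ℝ C, ∃ b : ℝ, ∀ x ∈ h.support, b ≤ x := fun h => by
      by_cases hne : h.support.Nonempty
      · exact ⟨h.isWF_support.min hne, fun x hx => Set.IsWF.min_le _ _ hx⟩
      · exact ⟨0, fun x hx => absurd ⟨x, hx⟩ hne⟩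
    obtain ⟨a, ha⟩ := bdd f
    obtain ⟨b, hb⟩ := bdd g
    refine (Set.Finite.image2 (fun x y : ℝ => x + y) (hf (N - b)) (hg (N - a))).subset ?_
    rintro z ⟨hz, hzN⟩
    obtain ⟨x, hx, y, hy, rfl⟩ := HahnSeries.support_mul_subset hz
    have h1 := ha x hx
    have h2 := hb y hy
    have h3 : x + y ≤ N := hzN
    exact ⟨x, ⟨hx, by simp only [Set.mem_Iic]; linarith⟩, y,
      ⟨hy, by simp only [Set.mem_Iic]; linarith⟩, rfl⟩

abbrev Novikov (C : Type*) [CommRing C] : Type _ := ↥(novikovSubring C)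

/-- The map `∑ a_λ t^λ ↦ ∑ f(a_λ) t^λ` induced by a ring homomorphism `f : C → D`. -/
def novikovMap {C D : Type*} [CommRing C] [CommRing D] (f : C →+* D) :
    Novikov C →+* Novikov D where
  toFun x := ⟨x.1.map f, fun N => (x.2 N).subset fun l hl =>
    ⟨fun h => hl.1 (by simp [h]), hl.2⟩⟩
  map_zero' := by
    apply Subtype.ext
    ext l
    simp
  map_one' := by
    apply Subtype.ext
    ext l
    by_cases h : l = 0 <;> simp [HahnSeries.coeff_one, h]
  map_add' x y := by
    apply Subtype.ext
    ext l
    simp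
  map_mul' x y := by
    apply Subtype.ext
    exact HahnSeries.map_mul (f : C →ₙ+* D)

/-- `Λ_C` is an algebra over `Λ_ℤ`, through the ring homomorphism `ℤ → C`. -/
instance novikovAlgebra (C : Type*) [CommRing C] : Algebra (Novikov ℤ) (Novikov C) :=
  (novikovMap (Int.castRingHom C)).toAlgebra

/-- The monomial `t^r` in `Λ_C`. -/
def novikovMonomial (C : Type*) [CommRing C] (r : ℝ) : Novikov C :=
  ⟨HahnSeries.single r 1, fun _ =>
    (Set.finite_singleton r).subset fun _ hx => HahnSeries.support_single_subset hx.1⟩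

/-- The constant `a ∈ C`, as an element of `Λ_C`. -/
def novikovConst {C : Type*} [CommRing C] (a : C) : Novikov C :=
  ⟨HahnSeries.single 0 a, fun _ =>
    (Set.finite_singleton (0 : ℝ)).subset fun _ hx => HahnSeries.support_single_subset hx.1⟩

/-- The `t`-adic topology on `Λ_C`: two elements are close when their terms of exponent `< N`
agree, for a large `N`. -/
instance novikovTopology (C : Type*) [CommRing C] : TopologicalSpace (Novikov C) :=
  ⨅ N : ℝ, TopologicalSpace.induced
    (fun f : Novikov C => fun l : Set.Iio N => f.1.coeff l) ⊥

/-- The automorphism of `Λ_C` induced by an automorphism `σ` of `C`, fixing every `t^r`. -/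
def novikovAut {C : Type*} [CommRing C] (σ : C ≃+* C) : Novikov C ≃ₐ[Novikov ℤ] Novikov C :=
  AlgEquiv.ofRingEquiv
    (f := RingEquiv.ofRingHom (novikovMap σ.toRingHom) (novikovMap σ.symm.toRingHom)
      (by
        refine RingHom.ext fun x => Subtype.ext ?_
        ext l
        simp [novikovMap])
      (by
        refine RingHom.ext fun x => Subtype.ext ?_
        ext l
        simp [novikovMap]))
    (fun x => by
      apply Subtype.ext
      ext l
      simp [novikovMap, RingHom.algebraMap_toAlgebra])

/-! ## The ring `C⟦t⟧` -/

/-- The `t`-adic topology on `C⟦t⟧`: the product topology, each coefficient being discrete. -/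
instance powerSeriesTopology (C : Type*) [CommRing C] : TopologicalSpace C⟦X⟧ :=
  @PowerSeries.WithPiTopology.instTopologicalSpace C ⊥

/-- The automorphism of `C⟦t⟧` induced by an automorphism `σ` of `C`, fixing `t`. -/
def powerSeriesAut {C : Type*} [CommRing C] (σ : C ≃+* C) : C⟦X⟧ ≃ₐ[ℤ⟦X⟧] C⟦X⟧ :=
  AlgEquiv.ofRingEquiv
    (f := RingEquiv.ofRingHom (PowerSeries.map σ.toRingHom) (PowerSeries.map σ.symm.toRingHom)
      (by
        refine RingHom.ext fun x => ?_
        ext l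
        simp)
      (by
        refine RingHom.ext fun x => ?_
        ext l
        simp))
    (fun x => by
      ext l
      simp [RingHom.algebraMap_toAlgebra])

/-! ## The torus, its Lagrangians and its holomorphic triangles -/

/-- The torus `T = ℝ²/ℤ²`. -/
abbrev Torus : Type := UnitAddCircle × UnitAddCircle

/-- The universal covering `ℝ² → T`, the plane being written as `ℂ` with `x + iy = (x, y)`. -/
def toTorus (w : ℂ) : Torus := ((w.re : UnitAddCircle), (w.im : UnitAddCircle))

/-- The Lagrangian `L_(m) ⊆ T`: the image of the line of slope `-m` through the origin. -/
def lagr (m : ℤ) : Set Torus :=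
  Set.range fun r : ℝ => ((r : UnitAddCircle), ((-(m * r) : ℝ) : UnitAddCircle))

theorem mem_lagr {m : ℤ} {p : Torus} : p ∈ lagr m ↔ p.2 = -(m • p.1) := by
  obtain ⟨x, y⟩ := p
  constructor
  · rintro ⟨r, h⟩
    rw [Prod.mk.injEq] at h
    rw [← h.1, ← h.2, AddCircle.coe_neg, ← zsmul_eq_mul, AddCircle.coe_zsmul]
  · intro h
    induction x using QuotientAddGroup.induction_on with
    | H r =>
      refine ⟨r, Prod.ext rfl ?_⟩
      change ((-(m * r) : ℝ) : UnitAddCircle) = y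
      rw [AddCircle.coe_neg, ← zsmul_eq_mul, AddCircle.coe_zsmul]
      exact h.symm

/-- Two different Lagrangians `L_(m)`, `L_(n)` meet in finitely many points. -/
theorem finite_lagr_inter {m n : ℤ} (h : m ≠ n) : (lagr m ∩ lagr n).Finite := by
  have hk : 0 < (n - m).natAbs := Int.natAbs_pos.mpr (sub_ne_zero.mpr h.symm)
  refine Set.Finite.of_finite_image (f := Prod.fst)
    ((AddCircle.finite_torsion (1 : ℝ) hk).subset ?_) ?_
  · rintro _ ⟨p, ⟨h1, h2⟩, rfl⟩
    rw [mem_lagr] at h1 h2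
    have h3 : (n - m) • p.1 = 0 := by
      rw [sub_smul, sub_eq_zero]
      exact neg_injective (h2.symm.trans h1)
    change (n - m).natAbs • p.1 = 0
    rcases Int.natAbs_eq (n - m) with h4 | h4
    · rwa [h4, natCast_zsmul] at h3
    · rwa [h4, neg_smul, natCast_zsmul, neg_eq_zero] at h3
  · rintro p ⟨hp, -⟩ q ⟨hq, -⟩ hpq
    rw [mem_lagr] at hp hq
    have hpq' : p.1 = q.1 := hpq
    exact Prod.ext hpq' (by rw [hp, hq, hpq'])

/-- The closed unit disc. -/
abbrev Disc : Type := Metric.closedBall (0 : ℂ) 1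

/-- The counterclockwise parametrization `t ↦ exp(2πit/3)` of the boundary of the disc.  The
marked points are `bdry 0`, `bdry 1`, `bdry 2`. -/
def bdry (t : ℝ) : Disc :=
  ⟨Complex.exp (((2 * Real.pi * t / 3 : ℝ) : ℂ) * Complex.I), by
    rw [mem_closedBall_zero_iff, Complex.norm_exp_ofReal_mul_I]⟩

theorem bdry_three : bdry 3 = bdry 0 := by
  apply Subtype.ext
  simp only [bdry]
  have h : ((2 * Real.pi * 3 / 3 : ℝ) : ℂ) * Complex.I = 2 * Real.pi * Complex.I := by
    push_cast
    ring
  rw [h, Complex.exp_two_pi_mul_I]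
  simp

/-- The moduli space `M(y, x₁, x₂)` of holomorphic triangles with boundary on
`L_(m₀), L_(m₁), L_(m₂)`: continuous maps `u` from the closed disc, with three fixed marked boundary
points in counterclockwise order, to the torus, smooth away from the marked points and
holomorphic in the interior (for the complex structure of `T = ℂ/(ℤ + iℤ)`), which carry the marked
points to `y, x₁, x₂` and the boundary arcs that follow them to `L_(m₀), L_(m₁), L_(m₂)`.
Regularity is read off from a continuous lift of `u` to the universal cover, which exists because
the disc is simply connected and is unique up to a translation.  Fixing the marked points takes
the place of dividing by the reparametrizations.  For `m₀ < m₁ < m₂` all these triangles are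
rigid (the Maslov indices of all the corners are zero), the constant ones included. -/
structure HolTriangle (m₀ m₁ m₂ : ℤ) (y x₁ x₂ : Torus) where
  map : Disc → Torus
  hol : ∃ U : ℂ → ℂ, (∀ w : Disc, toTorus (U w) = map w) ∧
    ContinuousOn U (Metric.closedBall 0 1) ∧
    DifferentiableOn ℂ U (Metric.ball 0 1) ∧
    ContDiffOn ℝ ∞ U (Metric.closedBall 0 1 \ {(bdry 0 : ℂ), (bdry 1 : ℂ), (bdry 2 : ℂ)})
  corner₀ : map (bdry 0) = y
  corner₁ : map (bdry 1) = x₁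
  corner₂ : map (bdry 2) = x₂
  side₀ : ∀ t ∈ Set.Icc (0 : ℝ) 1, map (bdry t) ∈ lagr m₀
  side₁ : ∀ t ∈ Set.Icc (1 : ℝ) 2, map (bdry t) ∈ lagr m₁
  side₂ : ∀ t ∈ Set.Icc (2 : ℝ) 3, map (bdry t) ∈ lagr m₂

/-- The star `⋆_(m) = (ε, -mε)` on `L_(m)`. -/
def starPoint (ε : ℝ) (m : ℤ) : Torus := ((ε : UnitAddCircle), ((-(m * ε) : ℝ) : UnitAddCircle))

namespace HolTriangle

variable {m₀ m₁ m₂ : ℤ} {y x₁ x₂ : Torus}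

/-- A lift of the triangle to the universal cover (on the closed disc it is unique up to a
translation, on which nothing below depends). -/
def lift (u : HolTriangle m₀ m₁ m₂ y x₁ x₂) : ℂ → ℂ := Classical.choose u.hol

theorem toTorus_lift (u : HolTriangle m₀ m₁ m₂ y x₁ x₂) (w : Disc) :
    toTorus (u.lift w) = u.map w :=
  (Classical.choose_spec u.hol).1 w

/-- The area `∫_D u^*(dx dy)`. -/
def area (u : HolTriangle m₀ m₁ m₂ y x₁ x₂) : ℝ :=
  ∫ w in Metric.ball (0 : ℂ) 1, (fderiv ℝ u.lift w).det

/-- The discretized area: the limit of the number of points of `u⁻¹(D)`, as the base point `D`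
tends to the origin in the open first quadrant. -/
def areaZ (u : HolTriangle m₀ m₁ m₂ y x₁ x₂) : ℕ :=
  Filter.limUnder ((𝓝[>] (0 : ℝ)) ×ˢ (𝓝[>] (0 : ℝ)))
    fun d : ℝ × ℝ => Set.ncard {w : Disc | u.map w = toTorus ⟨d.1, d.2⟩}

/-- The sign of a triangle, `-1` to the number of stars on its boundary.  (When
`m₀ < m₁ < m₂`, all Maslov indices vanish, so the directions in which the sides are run through
do not affect the sign.) -/
def sign (ε : ℝ) (u : HolTriangle m₀ m₁ m₂ y x₁ x₂) : ℤ :=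
  (-1) ^ Set.ncard {w : Disc | ‖(w : ℂ)‖ = 1 ∧
    (u.map w = starPoint ε m₀ ∨ u.map w = starPoint ε m₁ ∨ u.map w = starPoint ε m₂)}

/-- The change of the lifted coordinate `x` along the side of the triangle from `bdry j` to
`bdry (j + 1)`. -/
def shift (u : HolTriangle m₀ m₁ m₂ y x₁ x₂) (j : ℝ) : ℝ :=
  (u.lift (bdry (j + 1))).re - (u.lift (bdry j)).re

theorem coe_shift (u : HolTriangle m₀ m₁ m₂ y x₁ x₂) (j : ℝ) :
    (u.map (bdry j)).1 + (u.shift j : UnitAddCircle) = (u.map (bdry (j + 1))).1 := by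
  rw [← u.toTorus_lift, ← u.toTorus_lift, shift, toTorus, toTorus, AddCircle.coe_sub,
    add_sub_cancel]

theorem coe_shift₀ (u : HolTriangle m₀ m₁ m₂ y x₁ x₂) :
    y.1 + (u.shift 0 : UnitAddCircle) = x₁.1 := by
  have h := u.coe_shift 0
  rwa [zero_add, u.corner₀, u.corner₁] at h

theorem coe_shift₁ (u : HolTriangle m₀ m₁ m₂ y x₁ x₂) :
    x₁.1 + (u.shift 1 : UnitAddCircle) = x₂.1 := by
  have h := u.coe_shift 1
  rwa [show (1 : ℝ) + 1 = 2 by norm_num, u.corner₁, u.corner₂] at h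

theorem coe_shift₂ (u : HolTriangle m₀ m₁ m₂ y x₁ x₂) :
    x₂.1 + (u.shift 2 : UnitAddCircle) = y.1 := by
  have h := u.coe_shift 2
  rwa [show (2 : ℝ) + 1 = 3 by norm_num, bdry_three, u.corner₂, u.corner₀] at h

end HolTriangle

/-! ## The F-field

In the following `R` is `ℤ⟦t⟧` or `Λ_ℤ`, `Λ` is `C⟦t⟧` or `Λ_C`, and `s` is the automorphism
induced by `σ`. -/

section FField

variable {R Λ : Type*} [CommRing R] [CommRing Λ] [Algebra R Λ]

/-- The stalk at `p ∈ S¹ = ℝ/ℤ` of the locally constant sheaf of rings whose étalé space is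
`(ℝ × Λ)/∼`, where `(r, c) ∼ (r + 1, s(c))`.  An element of the stalk is a class in the fibre over
`p`, written as the family `c` such that the class is that of `(r, c r)` for every lift `r` of
`p`. -/
def Stalk (s : Λ ≃ₐ[R] Λ) (p : UnitAddCircle) :
    Subalgebra R ({r : ℝ // (r : UnitAddCircle) = p} → Λ) where
  carrier := {c | ∀ r r' : {r : ℝ // (r : UnitAddCircle) = p}, (r' : ℝ) = r + 1 → c r' = s (c r)}
  mul_mem' := fun {a b} ha hb r r' h => by simp [ha r r' h, hb r r' h]
  add_mem' := fun {a b} ha hb r r' h => by simp [ha r r' h, hb r r' h]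
  algebraMap_mem' := fun a r r' _ => by simp

/-- The class of `(r₀, a)`. -/
def germ (s : Λ ≃ₐ[R] Λ) (r₀ : ℝ) (a : Λ) : Stalk s (r₀ : UnitAddCircle) :=
  ⟨fun r => (s ^ ⌊(r : ℝ) - r₀⌋) a, fun r r' h => by
    have h1 : (r' : ℝ) - r₀ = (r - r₀) + 1 := by rw [h]; ring
    change (s ^ ⌊(r' : ℝ) - r₀⌋) a = s ((s ^ ⌊(r : ℝ) - r₀⌋) a)
    rw [h1, Int.floor_add_one, add_comm, zpow_add, zpow_one]
    rfl⟩

/-- Parallel transport along a path in `S¹` from `p` to `q` whose lifts to `ℝ` run from `r` to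
`r + δ`: it carries the class of `(r, c)` to the class of `(r + δ, c)`. -/
def transport (s : Λ ≃ₐ[R] Λ) {p q : UnitAddCircle} (δ : ℝ)
    (h : p + (δ : UnitAddCircle) = q) : Stalk s p →ₐ[R] Stalk s q where
  toFun c := ⟨fun r => c.1 ⟨r - δ, by rw [AddCircle.coe_sub, r.2, ← h, add_sub_cancel_right]⟩,
    fun r r' hr => c.2 _ _ (by simp only [hr]; ring)⟩
  map_one' := rfl
  map_mul' _ _ := rfl
  map_zero' := rfl
  map_add' _ _ := rfl
  commutes' _ := rfl

/-- The factor `∇γ₂(b ∇γ₁(a ∇γ₀(1)))` of a triangle with sides `γ₀ : y → x₁`, `γ₁ : x₁ → x₂`,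
`γ₂ : x₂ → y`.  The sheaf of rings is pulled back along `T → S¹, (x, y) ↦ x`. -/
def HolTriangle.coupling (s : Λ ≃ₐ[R] Λ) {m₀ m₁ m₂ : ℤ} {y x₁ x₂ : Torus}
    (u : HolTriangle m₀ m₁ m₂ y x₁ x₂) (b : Stalk s x₂.1) (a : Stalk s x₁.1) : Stalk s y.1 :=
  transport s (u.shift 2) u.coe_shift₂
    (b * transport s (u.shift 1) u.coe_shift₁
      (a * transport s (u.shift 0) u.coe_shift₀ 1))

/-- `CF(L_(m), L_(n); Λ)` for `m ≠ n`: the direct sum of the stalks at the (finitely many)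
intersection points. -/
abbrev CF (s : Λ ≃ₐ[R] Λ) (m n : ℤ) : Type _ :=
  ∀ p : ↥(lagr m ∩ lagr n), Stalk s p.1.1

/-- The type of functions that attach to each triangle its weight `±t^area`. -/
abbrev TriangleWeight (R : Type*) : Type _ :=
  ∀ ⦃m₀ m₁ m₂ : ℤ⦄ ⦃y x₁ x₂ : Torus⦄, HolTriangle m₀ m₁ m₂ y x₁ x₂ → R

/-- The triangle product `CF(L_(m₁), L_(m₂)) × CF(L_(m₀), L_(m₁)) → CF(L_(m₀), L_(m₂))`. -/
def triangleProduct [TopologicalSpace Λ] (s : Λ ≃ₐ[R] Λ) (W : TriangleWeight R) {m₀ m₁ m₂ : ℤ}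
    (g : CF s m₁ m₂) (f : CF s m₀ m₁) : CF s m₀ m₂ :=
  fun y => ∑ᶠ (x₂ : ↥(lagr m₁ ∩ lagr m₂)) (x₁ : ↥(lagr m₀ ∩ lagr m₁)),
    ∑' u : HolTriangle m₀ m₁ m₂ y x₁ x₂, W u • u.coupling s (g x₂) (f x₁)

/-- The convergence of all the sums over triangles in the products
`CF(L_(m₁), L_(m₁ + m₂)) × CF(L_(0), L_(m₁)) → CF(L_(0), L_(m₁ + m₂))`. -/
def TriangleSumsConverge [TopologicalSpace Λ] (s : Λ ≃ₐ[R] Λ) (W : TriangleWeight R) : Prop :=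
  ∀ (m₁ m₂ : ℕ+) (y : ↥(lagr 0 ∩ lagr (m₁ + m₂))) (x₁ : ↥(lagr 0 ∩ lagr m₁))
    (x₂ : ↥(lagr m₁ ∩ lagr (m₁ + m₂))) (b : Stalk s x₂.1.1) (a : Stalk s x₁.1.1),
    Summable fun u : HolTriangle 0 m₁ (m₁ + m₂) y x₁ x₂ => W u • u.coupling s b a

/-- The `k`-th power `(x, y) ↦ (x, y - kx)` of the Dehn twist. -/
def dehn (k : ℤ) (p : Torus) : Torus := (p.1, p.2 - k • p.1)

theorem dehn_mem {k m m' : ℤ} (h : m' = m + k) {p : Torus} (hp : p ∈ lagr m') :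
    dehn (-k) p ∈ lagr m := by
  rw [mem_lagr] at hp ⊢
  simp only [dehn, hp, h, add_smul, neg_smul]
  abel

/-- The identification of `CF(L_(m), L_(n))` with `CF(L_(m + k), L_(n + k))` induced by the
`k`-th power of the Dehn twist, which preserves the coordinate `x` and so the stalks. -/
def dehnCF (s : Λ ≃ₐ[R] Λ) (k : ℤ) {m n m' n' : ℤ} (hm : m' = m + k) (hn : n' = n + k)
    (f : CF s m n) : CF s m' n' :=
  fun p => f ⟨dehn (-k) p.1, dehn_mem hm p.2.1, dehn_mem hn p.2.2⟩

/-- The graded module `⨁_{m ≥ 1} CF(L_(0), L_(m); Λ)`. -/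
abbrev FloerRing (s : Λ ≃ₐ[R] Λ) : Type _ := ⨁ m : ℕ+, CF s 0 m

open Classical in
/-- The product on `⨁_{m ≥ 1} CF(L_(0), L_(m); Λ)`: on `CF(L_(0), L_(m₂)) × CF(L_(0), L_(m₁))` it
is the triangle product, after `CF(L_(0), L_(m₂))` has been identified with
`CF(L_(m₁), L_(m₁ + m₂))`. -/
def floerMul [TopologicalSpace Λ] (s : Λ ≃ₐ[R] Λ) (W : TriangleWeight R)
    (v w : FloerRing s) : FloerRing s :=
  ∑ m₂ ∈ DFinsupp.support v, ∑ m₁ ∈ DFinsupp.support w,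
    DirectSum.of (fun m : ℕ+ => CF s 0 m) (m₁ + m₂)
      (triangleProduct s W
        (dehnCF s m₁ (m := 0) (n := m₂) (m' := m₁) (n' := ((m₁ + m₂ : ℕ+) : ℕ))
          (zero_add _).symm (by push_cast; ring) (v m₂))
        (w m₁))

theorem gen_mem (m : ℕ+) (k : ℕ) :
    ((((k : ℝ) / (m : ℕ) : ℝ) : UnitAddCircle), (0 : UnitAddCircle)) ∈ lagr 0 ∩ lagr m := by
  have hm : ((m : ℕ) : ℝ) ≠ 0 := by exact_mod_cast m.ne_zero
  constructor
  · rw [mem_lagr]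
    simp
  · refine ⟨(k : ℝ) / (m : ℕ), Prod.ext rfl ?_⟩
    change ((-(((m : ℕ) : ℤ) * ((k : ℝ) / (m : ℕ))) : ℝ) : UnitAddCircle) = 0
    have h : (-(((m : ℕ) : ℤ) * ((k : ℝ) / (m : ℕ))) : ℝ) = ((-(k : ℤ) : ℤ) : ℝ) := by
      push_cast
      field_simp
    rw [h, AddCircle.coe_eq_zero_iff]
    exact ⟨-(k : ℤ), by simp⟩

open Classical in
/-- The element `x_{m, k/m} · a`, where `x_{m, k/m} = (k/m, 0)` and `a` is placed in the stalk at
`k/m` as the class of `(k/m, a)`. -/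
def floerGen (s : Λ ≃ₐ[R] Λ) (m : ℕ+) (k : ℕ) (a : Λ) : FloerRing s :=
  DirectSum.of (fun m : ℕ+ => CF s 0 m) m
    (Pi.single (M := fun p : ↥(lagr 0 ∩ lagr m) => ↥(Stalk s p.1.1))
      ⟨_, gen_mem m k⟩ (germ s ((k : ℝ) / (m : ℕ)) a))

/-! ## Theta series

A formal series in `z^{±1}`, infinite in both directions, with coefficients in `Λ`, is given by
the function `ℤ → Λ` of its coefficients. -/

/-- The series `∑_i T(m, k, i) z^{mi + k} s^i(a)`, where `T(m, k, i)` is a power of `t`. -/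
def thetaSeries (s : Λ ≃ₐ[R] Λ) (T : ℕ+ → ℕ → ℤ → R) (m : ℕ+) (k : ℕ) (a : Λ) : ℤ → Λ :=
  fun e => ∑ᶠ (i : ℤ) (_ : m * i + k = e), T m k i • (s ^ i) a

/-- The closure, for the `t`-adic topology on the coefficients of the powers of `z`, of the
`R`-linear span of the series `θ_{m,k}[a]` of degree `m`, where `0 ≤ k < m` and `a` runs through
the image of `const : C → Λ`. -/
def thetaSpan [TopologicalSpace Λ] {C : Type*} (const : C → Λ) (s : Λ ≃ₐ[R] Λ)
    (T : ℕ+ → ℕ → ℤ → R) (m : ℕ+) : Set (ℤ → Λ) :=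
  closure (Submodule.span R {θ | ∃ k < (m : ℕ), ∃ a : C, θ = thetaSeries s T m k (const a)} :
    Set (ℤ → Λ))

/-- The sum, over all degrees `m ≥ 1`, of the closed spans of the theta series of degree `m`. -/
def thetaRing [TopologicalSpace Λ] {C : Type*} (const : C → Λ) (s : Λ ≃ₐ[R] Λ)
    (T : ℕ+ → ℕ → ℤ → R) : Submodule R (ℤ → Λ) :=
  Submodule.span R (⋃ m, thetaSpan const s T m)

/-- The formal product of two series in `z^{±1}`. -/
def seriesMul [TopologicalSpace Λ] (f g : ℤ → Λ) : ℤ → Λ := fun e => ∑' i : ℤ, f i * g (e - i)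

/-- The formal product of `f` and `g` makes sense: the sums for all its coefficients converge. -/
def SeriesMulConverges [TopologicalSpace Λ] (f g : ℤ → Λ) : Prop :=
  ∀ e : ℤ, Summable fun i : ℤ => f i * g (e - i)

end FField

/-- With its given addition and with the product `mul`, the group `A` is a commutative ring without
unit. -/
structure IsCommRng {A : Type*} [AddCommGroup A] (mul : A → A → A) : Prop where
  left_distrib : ∀ a b c, mul a (b + c) = mul a b + mul a c
  right_distrib : ∀ a b c, mul (a + b) c = mul a c + mul b c
  assoc : ∀ a b c, mul (mul a b) c = mul a (mul b c)
  comm : ∀ a b, mul a b = mul b a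

/-! ## The relative and the absolute powers of `t` -/

/-- The weight `±t^{area_ℤ(u)}` of a triangle, in the relative case. -/
def relWeight (ε : ℝ) : TriangleWeight ℤ⟦X⟧ :=
  fun _ _ _ _ _ _ u => u.sign ε • (PowerSeries.X : ℤ⟦X⟧) ^ u.areaZ

/-- The weight `±t^{area(u)}` of a triangle, in the absolute case. -/
def absWeight (ε : ℝ) : TriangleWeight (Novikov ℤ) :=
  fun _ _ _ _ _ _ u => u.sign ε • novikovMonomial ℤ u.area

/-- `t^{m i(i-1)/2 + ki}`; the exponent is a nonnegative integer when `0 ≤ k < m`. -/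
def relThetaPower (m : ℕ+) (k : ℕ) (i : ℤ) : ℤ⟦X⟧ :=
  (PowerSeries.X : ℤ⟦X⟧) ^ (m * (i * (i - 1) / 2) + k * i : ℤ).toNat

/-- `t^{(mi + k)²/(2m)}`. -/
def absThetaPower (m : ℕ+) (k : ℕ) (i : ℤ) : Novikov ℤ :=
  novikovMonomial ℤ (((m : ℕ) * i + k : ℝ) ^ 2 / (2 * (m : ℕ)))

end

/-!
The theorem holds because every holomorphic triangle in the torus is an explicit affine rescaling of
one model triangle, so that counting triangles amounts to multiplying theta series.

*Triangles.* A triangle with sides on `L_(0)`, `L_(q)`, `L_(q + p)` lifts to the plane, where each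
side runs along a line of known slope. A map `modelMap q p` from the disc onto a Euclidean triangle
with these slopes exists: its derivative is a constant times `∏ (1 - w / b_j) ^ (-β_j)`, where the
`b_j` are the marked points and the `β_j π` the exterior angles (`SCData`,
`IsTriangle.exists_scData`), since the integral of such a product maps the boundary arcs to segments
of the given directions, which determine the sides up to scale (`SCData.exists_map`). It is a
conformal map onto the triangle (`IsTriangleMap.injOn`, `IsTriangleMap.image_ball`). Conversely, if
the lift of any triangle is given, subtract its value at the corner `y` and a real multiple of the
model map. On each boundary arc the values of the difference are parallel to the side; multiplied by
a Schwarz-Christoffel product, it becomes a quadratic polynomial with three zeros, so that it vanishes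
(`SCData.eq_zero`, `HolTriangle.lift_eq`). Hence a triangle is determined by a lift `r` of its corner
`y` and by a real number, its `scale`, which is arbitrary subject to the condition that the other
corners are intersection points. In terms of the lifts `e₁ / q` and `e₂ / p` of the corners `x₁` and
`x₂`, one has `e₁ + e₂ = (q + p) r`, and `e₁` runs through all integers
(`AllTriangles.exists_equiv`).

*Weights.* The area is `e₁² / 2q + e₂² / 2p - (e₁ + e₂)² / 2(q + p)` (`HolTriangle.area_eq`), and the
discretized area is the analogous combination of the exponents `relExp` of the relative theta
series, by a count of lattice points in columns (`card_trianglePoints`). The signs are all `+1`,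
since the boundary of a triangle meets a vertical line that avoids the corners twice, or not at all
(`HolTriangle.sign_eq_one`). Thus the weight of a triangle turns a product of monomials of the theta
series into another such monomial; this is what `IsThetaSystem` records.

*Products.* The series of a cochain `v` of degree `m` has the coefficient `P m e · v(e/m)` at `z ^ e`,
where `v` is evaluated at the lift `e/m` of an intersection point. Parallel transport along the sides
compares the values of the two factors at the lifts `e₁ / q` and `e₂ / p`, and so the triangle
product becomes the formal product of series
(`IsThetaSystem.smul_stalkEval_triangleProduct`). Since the exponents of `t` grow like `e² / 2m`, all
sums converge, and a sum of series of different degrees vanishes only if each of them does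
(`IsThetaSystem.floerSeries_injective`). The axioms of a commutative ring are inherited from formal
multiplication, and the series of degree `m` are exactly the closed span of the theta series
(`IsThetaSystem.coe_range_cochainSeries`).
-/

noncomputable section

open Metric Set Complex

/-! ### Holomorphic functions on the disc with prescribed boundary behaviour -/

theorem re_nonneg_of_re_nonneg_on_sphere {f : ℂ → ℂ} (hc : ContinuousOn f (closedBall 0 1))
    (hd : DifferentiableOn ℂ f (ball 0 1)) (hs : ∀ w ∈ sphere (0 : ℂ) 1, 0 ≤ (f w).re) {w : ℂ}
    (hw : w ∈ closedBall (0 : ℂ) 1) : 0 ≤ (f w).re := by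
  -- the maximum principle for `exp (-f)`, whose norm is `exp (-re f)`
  have h1 : DiffContOnCl ℂ (fun z => exp (-f z)) (ball 0 1) := by
    refine ⟨hd.neg.cexp, ?_⟩
    rw [closure_ball (0 : ℂ) one_ne_zero]
    exact hc.neg.cexp
  have h2 : ‖exp (-f w)‖ ≤ 1 := by
    refine norm_le_of_forall_mem_frontier_norm_le (U := ball (0 : ℂ) 1) isBounded_ball h1 ?_ ?_
    · rw [frontier_ball (0 : ℂ) one_ne_zero]
      intro z hz
      rw [norm_exp]
      simpa using hs z hz
    · rwa [closure_ball (0 : ℂ) one_ne_zero]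
  rw [norm_exp] at h2
  simpa using h2

/-- The strong form of the minimum principle for the real part. -/
theorem eqOn_const_of_re_nonneg_on_sphere {f : ℂ → ℂ} (hc : ContinuousOn f (closedBall 0 1))
    (hd : DifferentiableOn ℂ f (ball 0 1)) (hs : ∀ w ∈ sphere (0 : ℂ) 1, 0 ≤ (f w).re) {w : ℂ}
    (hw : w ∈ ball (0 : ℂ) 1) (h0 : (f w).re = 0) :
    ∀ z ∈ closedBall (0 : ℂ) 1, (f z).re = 0 := by
  have h1 : DiffContOnCl ℂ (fun z => exp (-f z)) (ball 0 1) := by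
    refine ⟨hd.neg.cexp, ?_⟩
    rw [closure_ball (0 : ℂ) one_ne_zero]
    exact hc.neg.cexp
  have h2 := norm_eqOn_closure_of_isPreconnected_of_isMaxOn (U := ball (0 : ℂ) 1) (c := w)
    (convex_ball _ _).isPreconnected isOpen_ball h1 hw (by
      intro z hz
      have := re_nonneg_of_re_nonneg_on_sphere hc hd hs (ball_subset_closedBall hz)
      simp only [Function.comp, mem_ofPred_eq, norm_exp, neg_re, h0]
      simpa using this)
  rw [closure_ball (0 : ℂ) one_ne_zero] at h2
  intro z hz
  have h3 := h2 hz
  simp only [Function.comp, Function.const, norm_exp, neg_re, h0] at h3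
  simpa using h3

theorem re_pos_of_re_nonneg_on_sphere {f : ℂ → ℂ} (hc : ContinuousOn f (closedBall 0 1))
    (hd : DifferentiableOn ℂ f (ball 0 1)) (hs : ∀ w ∈ sphere (0 : ℂ) 1, 0 ≤ (f w).re)
    (hne : ∃ w ∈ sphere (0 : ℂ) 1, 0 < (f w).re) {w : ℂ}
    (hw : w ∈ ball (0 : ℂ) 1) : 0 < (f w).re := by
  refine lt_of_le_of_ne (re_nonneg_of_re_nonneg_on_sphere hc hd hs (ball_subset_closedBall hw))
    fun h => ?_
  obtain ⟨z, hz, hz'⟩ := hne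
  exact hz'.ne' (eqOn_const_of_re_nonneg_on_sphere hc hd hs hw h.symm z
    (sphere_subset_closedBall hz))

/-- A holomorphic function with real boundary values is constant. -/
theorem eq_const_of_im_eq_zero_on_sphere {f : ℂ → ℂ} (hc : ContinuousOn f (closedBall 0 1))
    (hd : DifferentiableOn ℂ f (ball 0 1)) (hs : ∀ w ∈ sphere (0 : ℂ) 1, (f w).im = 0) :
    ∃ c : ℝ, ∀ z ∈ closedBall (0 : ℂ) 1, f z = c := by
  have hI : ∀ z, (-I * f z).re = (f z).im := fun z => by simp
  have hI' : ∀ z, (I * f z).re = -(f z).im := fun z => by simp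
  have him : ∀ z ∈ closedBall (0 : ℂ) 1, (f z).im = 0 := by
    intro z hz
    refine le_antisymm ?_ ?_
    · have := re_nonneg_of_re_nonneg_on_sphere (f := fun z => I * f z) (continuousOn_const.mul hc)
        (hd.const_mul _) (fun w hw => by rw [hI', hs w hw]; simp) hz
      rw [hI'] at this
      linarith
    · have := re_nonneg_of_re_nonneg_on_sphere (f := fun z => -I * f z) (continuousOn_const.mul hc)
        (hd.const_mul _) (fun w hw => by rw [hI, hs w hw]) hz
      rwa [hI] at this
  -- the square of `f - f 0` is nonnegative and vanishes at the centre
  have h0 : (0 : ℂ) ∈ closedBall (0 : ℂ) 1 := by simp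
  have hsq : ∀ z ∈ closedBall (0 : ℂ) 1, ((f z - f 0) ^ 2).re = (f z - f 0).re ^ 2 := by
    intro z hz
    have h1 := him z hz
    have h2 := him 0 h0
    simp [sq, h1, h2]
  have key := eqOn_const_of_re_nonneg_on_sphere (f := fun z => (f z - f 0) ^ 2)
    ((hc.sub continuousOn_const).pow 2) ((hd.sub_const _).pow 2)
    (fun w hw => by rw [hsq w (sphere_subset_closedBall hw)]; positivity)
    (mem_ball_self one_pos) (by simp)
  refine ⟨(f 0).re, fun z hz => ?_⟩
  have h3 := key z hz
  rw [hsq z hz, sq_eq_zero_iff, sub_re] at h3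
  exact Complex.ext (by simpa using sub_eq_zero.mp h3) (by simpa using him z hz)

/-! ### The Schwarz-Christoffel factors -/

/-- The marked points on the boundary of the disc, as complex numbers: the cube roots of unity. -/
def marked (j : Fin 3) : ℂ := bdry (j : ℕ)

theorem coe_bdry (t : ℝ) : (bdry t : ℂ) = exp (((2 * Real.pi * t / 3 : ℝ) : ℂ) * I) := rfl

theorem norm_bdry (t : ℝ) : ‖(bdry t : ℂ)‖ = 1 := by
  rw [coe_bdry, norm_exp_ofReal_mul_I]

theorem bdry_ne_zero (t : ℝ) : (bdry t : ℂ) ≠ 0 := by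
  rw [coe_bdry]; exact exp_ne_zero _

theorem bdry_add (s t : ℝ) : (bdry (s + t) : ℂ) = bdry s * bdry t := by
  simp only [coe_bdry, ← exp_add]
  congr 1
  push_cast
  ring

theorem coe_bdry_zero : (bdry 0 : ℂ) = 1 := by simp [coe_bdry]

theorem coe_bdry_three : (bdry 3 : ℂ) = 1 := by rw [bdry_three, coe_bdry_zero]

theorem bdry_add_three (t : ℝ) : bdry (t + 3) = bdry t :=
  Subtype.ext (by rw [bdry_add, coe_bdry_three, mul_one])

theorem bdry_sub (s t : ℝ) : (bdry (s - t) : ℂ) = bdry s / bdry t := by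
  rw [eq_div_iff (bdry_ne_zero t), ← bdry_add, sub_add_cancel]

theorem bdry_div_marked (t : ℝ) (j : Fin 3) :
    (bdry t : ℂ) / marked j = bdry (t - (j : ℕ)) := (bdry_sub _ _).symm

theorem norm_marked (j : Fin 3) : ‖marked j‖ = 1 := norm_bdry _

theorem marked_ne_zero (j : Fin 3) : marked j ≠ 0 := bdry_ne_zero _

theorem continuous_bdry : Continuous bdry := by
  refine Continuous.subtype_mk ?_ _
  fun_prop

theorem exists_bdry_eq {w : ℂ} (hw : w ∈ sphere (0 : ℂ) 1) :
    ∃ t ∈ Ico (0 : ℝ) 3, (bdry t : ℂ) = w := by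
  have hw' : ‖w‖ = 1 := by simpa using hw
  have hpi := Real.pi_pos
  have h1 : (bdry (3 * arg w / (2 * Real.pi)) : ℂ) = w := by
    rw [coe_bdry]
    have h2 : 2 * Real.pi * (3 * arg w / (2 * Real.pi)) / 3 = arg w := by field_simp
    rw [h2]
    have := norm_mul_exp_arg_mul_I w
    rwa [hw', ofReal_one, one_mul] at this
  have ha := neg_pi_lt_arg w
  have hb := arg_le_pi w
  by_cases h : 0 ≤ arg w
  · refine ⟨_, ⟨by positivity, ?_⟩, h1⟩
    rw [div_lt_iff₀ (by positivity)]
    nlinarith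
  · push Not at h
    refine ⟨3 * arg w / (2 * Real.pi) + 3, ⟨?_, ?_⟩, by rw [bdry_add_three, h1]⟩
    · have : -(3 : ℝ) ≤ 3 * arg w / (2 * Real.pi) := by
        rw [le_div_iff₀ (by positivity)]
        nlinarith
      linarith
    · have : 3 * arg w / (2 * Real.pi) < 0 := by
        apply div_neg_of_neg_of_pos <;> linarith
      linarith

theorem sub_lt_three_of_bdry_eq {s t : ℝ} (h : bdry s = bdry t) (hs : |s - t| < 3) : s = t := by
  have h1 : (bdry (s - t) : ℂ) = 1 := by rw [bdry_sub, h, div_self (bdry_ne_zero t)]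
  rw [coe_bdry, exp_eq_one_iff] at h1
  obtain ⟨n, hn⟩ := h1
  have hpi := Real.pi_pos
  have h2 : ((2 * Real.pi * (s - t) / 3 : ℝ) : ℂ) = ((n * (2 * Real.pi) : ℝ) : ℂ) := by
    refine mul_right_cancel₀ I_ne_zero ?_
    rw [hn]; push_cast; ring
  have h3 : (s - t) = 3 * n := by
    have := ofReal_injective h2
    field_simp at this
    linarith
  rw [h3, abs_mul] at hs
  have h4 : |(n : ℝ)| < 1 := by
    have : |(3 : ℝ)| = 3 := by norm_num
    rw [this] at hs
    linarith
  have h5 : n = 0 := by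
    have : |n| < 1 := by exact_mod_cast h4
    exact Int.abs_lt_one_iff.mp this
  rw [h5] at h3
  simp at h3
  linarith

theorem one_sub_bdry (s : ℝ) :
    1 - (bdry s : ℂ) = (2 * Real.sin (Real.pi * s / 3) : ℝ) *
      exp ((Real.pi * s / 3 - Real.pi / 2 : ℝ) * I) := by
  have h1 : (bdry s : ℂ) = exp ((Real.pi * s / 3 : ℝ) * I) * exp ((Real.pi * s / 3 : ℝ) * I) := by
    rw [coe_bdry, ← exp_add]
    congr 1
    push_cast
    ring
  have h2 : exp ((Real.pi * s / 3 - Real.pi / 2 : ℝ) * I) =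
      exp ((Real.pi * s / 3 : ℝ) * I) * (-I) := by
    rw [ofReal_sub, sub_mul, exp_sub]
    have : exp (((Real.pi / 2 : ℝ) : ℂ) * I) = I := by
      push_cast
      exact exp_pi_div_two_mul_I
    rw [this, div_I, mul_neg]
  rw [h2, h1]
  generalize Real.pi * s / 3 = x
  rw [exp_mul_I, ← ofReal_cos, ← ofReal_sin]
  have := Real.sin_sq_add_cos_sq x
  apply Complex.ext
  · simp [-ofReal_cos, -ofReal_sin]
    nlinarith
  · simp [-ofReal_cos, -ofReal_sin]
    ring

theorem one_sub_bdry_cpow {s : ℝ} (hs : s ∈ Ioo (0 : ℝ) 3) (x : ℝ) :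
    (1 - (bdry s : ℂ)) ^ (x : ℂ) = ((2 * Real.sin (Real.pi * s / 3)) ^ x : ℝ) *
      exp ((x * (Real.pi * s / 3 - Real.pi / 2) : ℝ) * I) := by
  have hpi := Real.pi_pos
  have h0 : 0 < Real.sin (Real.pi * s / 3) := by
    apply Real.sin_pos_of_pos_of_lt_pi
    · have := hs.1; positivity
    · have := hs.2; nlinarith
  have h1 : (1 : ℂ) - bdry s ≠ 0 := by
    rw [one_sub_bdry]
    exact mul_ne_zero (by exact_mod_cast (by positivity)) (exp_ne_zero _)
  have h2 : log (1 - (bdry s : ℂ)) = Real.log (2 * Real.sin (Real.pi * s / 3)) +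
      (Real.pi * s / 3 - Real.pi / 2 : ℝ) * I := by
    rw [one_sub_bdry, log_ofReal_mul (by positivity) (exp_ne_zero _), log_exp]
    · simp only [mul_im, ofReal_re, I_im, ofReal_im, I_re, mul_one, mul_zero, add_zero]
      have := hs.1
      have : 0 < Real.pi * s := by positivity
      linarith
    · simp only [mul_im, ofReal_re, I_im, ofReal_im, I_re, mul_one, mul_zero, add_zero]
      have := hs.2
      nlinarith
  rw [cpow_def_of_ne_zero h1, h2, Real.rpow_def_of_pos (by positivity), ofReal_exp, ← exp_add]
  congr 1
  push_cast
  ring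

/-- The Schwarz-Christoffel product `∏ (1 - w / b_j) ^ β_j` over the marked points `b_j`. -/
def scProd (β : Fin 3 → ℝ) (w : ℂ) : ℂ := ∏ j, (1 - w / marked j) ^ (β j : ℂ)

/-- The argument of a Schwarz-Christoffel product along the arc from `bdry i` to `bdry (i + 1)`
changes linearly; this is its constant part. -/
def scPhase (β : Fin 3 → ℝ) (i : Fin 3) : ℝ :=
  Real.pi / 3 * ∑ j, β j * ((if i < j then 3 else 0) - (j : ℕ))

theorem scPhase_neg (β : Fin 3 → ℝ) (i : Fin 3) : scPhase (-β) i = -scPhase β i := by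
  simp [scPhase]

theorem exists_scProd_bdry (β : Fin 3 → ℝ) (i : Fin 3) {t : ℝ}
    (ht : t ∈ Ioo ((i : ℕ) : ℝ) ((i : ℕ) + 1)) :
    ∃ r : ℝ, 0 < r ∧ scProd β (bdry t) =
      r * exp (((∑ j, β j) * (Real.pi * t / 3 - Real.pi / 2) + scPhase β i : ℝ) * I) := by
  have hs : ∀ j : Fin 3, t - (j : ℕ) + (if i < j then 3 else 0) ∈ Ioo (0 : ℝ) 3 := by
    obtain ⟨h1, h2⟩ := ht
    intro j
    fin_cases i <;> fin_cases j <;> simp at h1 h2 ⊢ <;> constructor <;> linarith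
  have hb : ∀ j : Fin 3, (bdry t : ℂ) / marked j =
      bdry (t - (j : ℕ) + (if i < j then 3 else 0)) := by
    intro j
    rw [bdry_div_marked]
    split_ifs
    · rw [bdry_add_three]
    · rw [add_zero]
  refine ⟨∏ j : Fin 3,
    (2 * Real.sin (Real.pi * (t - (j : ℕ) + (if i < j then 3 else 0)) / 3)) ^ β j, ?_, ?_⟩
  · refine Finset.prod_pos fun j _ => Real.rpow_pos_of_pos ?_ _
    have hpi := Real.pi_pos
    obtain ⟨h1, h2⟩ := hs j
    refine mul_pos two_pos (Real.sin_pos_of_pos_of_lt_pi (by positivity) ?_)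
    nlinarith
  · rw [scProd]
    simp_rw [hb, fun j => one_sub_bdry_cpow (hs j) (β j)]
    rw [Finset.prod_mul_distrib, ← exp_sum, ← Finset.sum_mul, ← ofReal_prod, ← ofReal_sum]
    congr 5
    rw [scPhase, Finset.sum_mul, Finset.mul_sum, ← Finset.sum_add_distrib]
    refine Finset.sum_congr rfl fun j _ => ?_
    ring

/-- The factor by which the argument of a Schwarz-Christoffel product with exponents of sum two
varies along the circle. -/
theorem exp_bdry_aux (t : ℝ) :
    exp ((2 * (Real.pi * t / 3 - Real.pi / 2) : ℝ) * I) = -bdry t := by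
  rw [coe_bdry]
  have : ((2 * (Real.pi * t / 3 - Real.pi / 2) : ℝ) : ℂ) * I =
      ((2 * Real.pi * t / 3 : ℝ) : ℂ) * I - Real.pi * I := by
    push_cast; ring
  rw [this, exp_sub, exp_pi_mul_I, div_neg, div_one]

/-- Along a boundary arc, `∏ (1 - w / b_j) ^ β_j` with `∑ β_j = 2` is a positive multiple of
`w` times a constant. -/
theorem exists_scProd_bdry_of_sum_eq_two {β : Fin 3 → ℝ} (hβ : ∑ j, β j = 2) (i : Fin 3) {t : ℝ}
    (ht : t ∈ Ioo ((i : ℕ) : ℝ) ((i : ℕ) + 1)) :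
    ∃ r : ℝ, 0 < r ∧ scProd β (bdry t) = r * -bdry t * exp (scPhase β i * I) := by
  obtain ⟨r, hr, h⟩ := exists_scProd_bdry β i ht
  refine ⟨r, hr, ?_⟩
  rw [h, hβ, ofReal_add, add_mul, exp_add, exp_bdry_aux, mul_assoc]

theorem exists_scProd_neg_bdry_of_sum_eq_two {β : Fin 3 → ℝ} (hβ : ∑ j, β j = 2) (i : Fin 3)
    {t : ℝ} (ht : t ∈ Ioo ((i : ℕ) : ℝ) ((i : ℕ) + 1)) :
    ∃ r : ℝ, 0 < r ∧ bdry t * scProd (-β) (bdry t) = r * -exp (-scPhase β i * I) := by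
  obtain ⟨r, hr, h⟩ := exists_scProd_bdry (-β) i ht
  refine ⟨r, hr, ?_⟩
  have h2 : ∑ j, (-β) j = -2 := by simp [hβ]
  have h3 : ((-2 * (Real.pi * t / 3 - Real.pi / 2) + -scPhase β i : ℝ) : ℂ) * I =
      -(((2 * (Real.pi * t / 3 - Real.pi / 2) : ℝ) : ℂ) * I) + -scPhase β i * I := by
    push_cast; ring
  rw [h, h2, scPhase_neg, h3, exp_add, exp_neg, exp_bdry_aux]
  have := bdry_ne_zero t
  field_simp

theorem one_sub_div_marked_mem_slitPlane {w : ℂ} (hw : w ∈ closedBall (0 : ℂ) 1) {j : Fin 3}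
    (hj : w ≠ marked j) : 1 - w / marked j ∈ slitPlane := by
  have h1 : ‖w / marked j‖ ≤ 1 := by
    rw [norm_div, norm_marked, div_one]
    simpa using hw
  rw [mem_slitPlane_iff]
  by_cases h : (w / marked j).im = 0
  · left
    have h2 : (w / marked j).re ≤ 1 := (re_le_norm _).trans h1
    have h3 : (w / marked j).re ≠ 1 := fun h3 => by
      have h4 : w / marked j = 1 := Complex.ext h3 h
      exact hj ((div_eq_one_iff_eq (marked_ne_zero j)).mp h4)
    have := lt_of_le_of_ne h2 h3
    simpa using this
  · right
    simpa using h

theorem norm_ne_marked {w : ℂ} (hw : w ∈ ball (0 : ℂ) 1) (j : Fin 3) : w ≠ marked j := by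
  rintro rfl
  simp [norm_marked] at hw

/-- The plane, slit along the rays from the marked points to infinity. -/
def slitDomain : Set ℂ := {w | ∀ j, 1 - w / marked j ∈ slitPlane}

theorem isOpen_slitDomain : IsOpen slitDomain := by
  have h : slitDomain = ⋂ j, (fun w => 1 - w / marked j) ⁻¹' slitPlane := by
    ext; simp [slitDomain]
  rw [h]
  refine isOpen_iInter_of_finite fun j => isOpen_slitPlane.preimage ?_
  fun_prop

theorem mem_slitDomain {w : ℂ} (hw : w ∈ closedBall (0 : ℂ) 1) (hj : ∀ j, w ≠ marked j) :
    w ∈ slitDomain := fun j => one_sub_div_marked_mem_slitPlane hw (hj j)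

theorem ball_subset_slitDomain : ball (0 : ℂ) 1 ⊆ slitDomain := fun _ hw =>
  mem_slitDomain (ball_subset_closedBall hw) (norm_ne_marked hw)

theorem smul_mem_slitDomain {w : ℂ} (hw : w ∈ slitDomain) {s : ℝ} (h0 : 0 ≤ s) (h1 : s ≤ 1) :
    (s : ℂ) * w ∈ slitDomain := by
  intro j
  have h := starConvex_one_slitPlane (hw j) (sub_nonneg.mpr h1) h0 (by ring)
  convert h using 1
  simp only [real_smul, ofReal_sub, ofReal_one]
  ring

theorem scProd_ne_zero (β : Fin 3 → ℝ) {w : ℂ} (hw : w ∈ slitDomain) : scProd β w ≠ 0 :=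
  Finset.prod_ne_zero_iff.mpr fun j _ => by
    rw [cpow_ne_zero_iff]
    exact Or.inl (slitPlane_ne_zero (hw j))

theorem differentiableOn_scProd (β : Fin 3 → ℝ) : DifferentiableOn ℂ (scProd β) slitDomain := by
  unfold scProd
  refine DifferentiableOn.fun_finsetProd fun j _ => ?_
  refine DifferentiableOn.cpow_const ?_ fun w hw => hw j
  fun_prop

theorem continuousOn_scProd {β : Fin 3 → ℝ} (hβ : ∀ j, 0 < β j) :
    ContinuousOn (scProd β) (closedBall 0 1) := by
  unfold scProd
  refine continuousOn_finsetProd _ fun j _ w hw => ?_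
  refine ContinuousAt.continuousWithinAt ?_
  have h1 : ContinuousAt (fun w => 1 - w / marked j) w := by fun_prop
  by_cases h : w = marked j
  · have h2 : (1 - w / marked j) = 0 := by rw [h, div_self (marked_ne_zero j), sub_self]
    have h3 : ContinuousAt (fun z : ℂ => z ^ (β j : ℂ)) (1 - w / marked j) := by
      rw [h2]
      have h4 := continuousAt_cpow_zero_of_re_pos (z := (β j : ℂ)) (by simpa using hβ j)
      exact ContinuousAt.comp (f := fun z : ℂ => (z, (β j : ℂ))) h4 (by fun_prop)
    exact ContinuousAt.comp (f := fun w => 1 - w / marked j) h3 h1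
  · exact h1.cpow continuousAt_const (one_sub_div_marked_mem_slitPlane hw h)

theorem scProd_marked {β : Fin 3 → ℝ} (hβ : ∀ j, 0 < β j) (j : Fin 3) :
    scProd β (marked j) = 0 :=
  Finset.prod_eq_zero (Finset.mem_univ j) (by
    rw [div_self (marked_ne_zero j), sub_self, zero_cpow]
    exact_mod_cast (hβ j).ne')

theorem sphere_cases {w : ℂ} (hw : w ∈ sphere (0 : ℂ) 1) :
    (∃ j, w = marked j) ∨
      ∃ i : Fin 3, ∃ t ∈ Ioo ((i : ℕ) : ℝ) ((i : ℕ) + 1), w = bdry t := by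
  obtain ⟨t, ⟨h0, h3⟩, rfl⟩ := exists_bdry_eq hw
  rcases eq_or_ne t 0 with rfl | h0'
  · exact Or.inl ⟨0, by simp [marked]⟩
  have h0 := lt_of_le_of_ne h0 h0'.symm
  rcases lt_trichotomy t 1 with h | rfl | h
  · exact Or.inr ⟨0, t, ⟨by simpa using h0, by simpa using h⟩, rfl⟩
  · exact Or.inl ⟨1, by simp [marked]⟩
  rcases lt_trichotomy t 2 with h' | rfl | h'
  · exact Or.inr ⟨1, t, ⟨by simpa using h, by norm_num; linarith⟩, rfl⟩
  · exact Or.inl ⟨2, by simp [marked]⟩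
  · exact Or.inr ⟨2, t, ⟨by simpa using h', by norm_num; linarith⟩, rfl⟩

theorem marked_zero : marked 0 = 1 := by simp [marked, coe_bdry_zero]

theorem marked_one_sq : marked 1 ^ 2 = marked 2 := by
  rw [sq, marked, marked, ← bdry_add]
  norm_num

theorem marked_one_cube : marked 1 ^ 3 = 1 := by
  rw [pow_succ, marked_one_sq, marked, marked, ← bdry_add, ← coe_bdry_three]
  norm_num

theorem marked_one_ne : marked 1 ≠ 1 := by
  intro h
  have h1 : bdry 1 = bdry 0 := Subtype.ext (by rw [coe_bdry_zero]; simpa [marked] using h)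
  have := sub_lt_three_of_bdry_eq h1 (by norm_num)
  norm_num at this

/-- The direction data of a triangle: `β_j π` are its exterior angles, and its sides are positive
multiples of `e 0, e 1, e 2`, which are matched with the directions that a Schwarz-Christoffel
map gives to the three arcs. -/
structure SCData (β : Fin 3 → ℝ) (e : Fin 3 → ℂ) (κ : ℂ) : Prop where
  pos : ∀ j, 0 < β j
  lt_one : ∀ j, β j < 1
  sum : ∑ j, β j = 2
  ne_zero : κ ≠ 0
  dir : ∀ i, ∃ r : ℝ, 0 < r ∧ e i = r * (κ * -exp (-scPhase β i * I))

namespace SCData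

variable {β : Fin 3 → ℝ} {e : Fin 3 → ℂ} {κ : ℂ}

theorem exists_scProd (h : SCData β e κ) (i : Fin 3) {t : ℝ}
    (ht : t ∈ Ioo ((i : ℕ) : ℝ) ((i : ℕ) + 1)) :
    ∃ r : ℝ, 0 < r ∧ e i * scProd β (bdry t) = r * (κ * bdry t) := by
  obtain ⟨r, hr, h1⟩ := h.dir i
  obtain ⟨r', hr', h2⟩ := exists_scProd_bdry_of_sum_eq_two h.sum i ht
  refine ⟨r * r', by positivity, ?_⟩
  rw [h1, h2, neg_mul, exp_neg]
  have := exp_ne_zero (scPhase β i * I)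
  push_cast
  field_simp

/-- A function on the disc whose values on each boundary arc are parallel to the corresponding side
vanishes: after multiplication with a Schwarz-Christoffel product it becomes a quadratic polynomial
with three zeros. -/
theorem eq_zero (h : SCData β e κ) {V : ℂ → ℂ} (hc : ContinuousOn V (closedBall 0 1))
    (hd : DifferentiableOn ℂ V (ball 0 1))
    (hV : ∀ i : Fin 3, ∀ t ∈ Ioo ((i : ℕ) : ℝ) ((i : ℕ) + 1), ∃ ρ : ℝ, V (bdry t) = ρ * e i)
    {w : ℂ} (hw : w ∈ closedBall (0 : ℂ) 1) : V w = 0 := by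
  set H : ℂ → ℂ := fun w => V w * scProd β w / κ with hH
  have hHc : ContinuousOn H (closedBall 0 1) := (hc.mul (continuousOn_scProd h.pos)).div_const _
  have hHd : DifferentiableOn ℂ H (ball 0 1) :=
    (hd.mul ((differentiableOn_scProd β).mono ball_subset_slitDomain)).div_const _
  have hκ := h.ne_zero
  have hHm : ∀ j, H (marked j) = 0 := fun j => by simp [hH, scProd_marked h.pos j]
  have hHs : ∀ w ∈ sphere (0 : ℂ) 1, ∃ ρ : ℝ, H w = ρ * w := by
    intro w hw
    rcases sphere_cases hw with ⟨j, rfl⟩ | ⟨i, t, ht, rfl⟩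
    · exact ⟨0, by simp [hHm]⟩
    · obtain ⟨ρ, hρ⟩ := hV i t ht
      obtain ⟨r, -, hr⟩ := h.exists_scProd i ht
      refine ⟨ρ * r, ?_⟩
      simp only [hH]
      rw [hρ, mul_assoc, hr]
      push_cast
      field_simp
  have h0n : closedBall (0 : ℂ) 1 ∈ 𝓝 0 := closedBall_mem_nhds _ one_pos
  have h0n' : ball (0 : ℂ) 1 ∈ 𝓝 0 := ball_mem_nhds _ one_pos
  have hd0 : DifferentiableAt ℂ H 0 := hHd.differentiableAt h0n'
  set K := dslope H 0 with hK
  have hKc : ContinuousOn K (closedBall 0 1) := (continuousOn_dslope h0n).mpr ⟨hHc, hd0⟩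
  have hKd : DifferentiableOn ℂ K (ball 0 1) := (differentiableOn_dslope h0n').mpr hHd
  have hHK : ∀ z, H z = H 0 + z * K z := by
    intro z
    have := sub_smul_dslope H 0 z
    simp only [sub_zero, smul_eq_mul] at this
    rw [hK, this]
    ring
  -- `H z / z = K z + H 0 / z` is real on the circle, where `H 0 / z = H 0 * conj z`; subtracting the
  -- real number `H 0 * conj z + conj (H 0) * z` leaves a function that is holomorphic in the disc,
  -- has real boundary values, and hence is constant
  obtain ⟨c, hcst⟩ := eq_const_of_im_eq_zero_on_sphere
    (f := fun z => K z - (starRingEnd ℂ) (H 0) * z)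
    (hKc.sub (by fun_prop)) (hKd.sub (by fun_prop)) (by
      intro z hz
      obtain ⟨ρ, hρ⟩ := hHs z hz
      have hz1 : z * (starRingEnd ℂ) z = 1 := by
        have : ‖z‖ = 1 := by simpa using hz
        rw [mul_conj, normSq_eq_norm_sq, this]; simp
      have hz0 : z ≠ 0 := fun h => by simp [h] at hz1
      have hKz : K z = ρ - H 0 * (starRingEnd ℂ) z := by
        refine mul_left_cancel₀ hz0 ?_
        linear_combination -hHK z + hρ + H 0 * hz1
      simp only [hKz]
      simp only [sub_im, ofReal_im, mul_im, conj_re, conj_im]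
      ring)
  -- thus `H` is a quadratic polynomial; it vanishes at the three cube roots of unity
  have hpoly : ∀ z ∈ closedBall (0 : ℂ) 1,
      H z = H 0 + c * z + (starRingEnd ℂ) (H 0) * z ^ 2 := by
    intro z hz
    have := hcst z hz
    rw [hHK z, sub_eq_iff_eq_add.mp this]
    ring
  have hm : ∀ j, marked j ∈ closedBall (0 : ℂ) 1 := fun j => by simp [norm_marked]
  have e0 := hpoly _ (hm 0)
  have e1 := hpoly _ (hm 1)
  have e2 := hpoly _ (hm 2)
  rw [hHm, marked_zero] at e0
  rw [hHm] at e1 e2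
  rw [← marked_one_sq] at e2
  have hcube := marked_one_cube
  have hne := marked_one_ne
  have hsum : 1 + marked 1 + marked 1 ^ 2 = 0 := by
    refine mul_left_cancel₀ (sub_ne_zero.mpr hne) ?_
    linear_combination hcube
  have hH0 : H 0 = 0 := by
    have h3 : (marked 1 ^ 2) ^ 2 = marked 1 := by linear_combination marked 1 * hcube
    rw [h3] at e2
    linear_combination (-1 / 3 : ℂ) * (e0 + e1 + e2) -
      (1 / 3 : ℂ) * (c + (starRingEnd ℂ) (H 0)) * hsum
  rw [hH0, map_zero] at hpoly e0
  have hc0 : (c : ℂ) = 0 := by simpa using e0.symm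
  have hball : EqOn V 0 (ball 0 1) := by
    intro z hz
    have h1 := hpoly z (ball_subset_closedBall hz)
    rw [hc0] at h1
    have h2 := scProd_ne_zero β (ball_subset_slitDomain hz)
    simpa [hH, h2, hκ] using h1
  have hcl := hball.of_subset_closure (t := closedBall 0 1) hc continuousOn_const
    ball_subset_closedBall (by rw [closure_ball (0 : ℂ) one_ne_zero])
  exact hcl hw

/-- A function that maps the three boundary arcs to the lines bounding an open triangle takes every
value in that triangle at most once. -/
theorem injective_value (h : SCData β e κ) {F : ℂ → ℂ} (hc : ContinuousOn F (closedBall 0 1))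
    (hd : DifferentiableOn ℂ F (ball 0 1)) {p : ℂ}
    (hp : ∀ i : Fin 3, ∀ t ∈ Ioo ((i : ℕ) : ℝ) ((i : ℕ) + 1),
      0 < ((F (bdry t) - p) / e i * I).re)
    {w₁ w₂ : ℂ} (hw₁ : w₁ ∈ ball (0 : ℂ) 1) (hw₂ : w₂ ∈ ball (0 : ℂ) 1) (h₁ : F w₁ = p)
    (h₂ : F w₂ = p) : w₁ = w₂ := by
  by_contra hne
  have hκ := h.ne_zero
  set H : ℂ → ℂ := fun w => (F w - p) * scProd β w / κ * I with hH
  have hHc : ContinuousOn H (closedBall 0 1) :=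
    (((hc.sub continuousOn_const).mul (continuousOn_scProd h.pos)).div_const _).mul
      continuousOn_const
  have hHd : DifferentiableOn ℂ H (ball 0 1) :=
    (((hd.sub_const _).mul
      ((differentiableOn_scProd β).mono ball_subset_slitDomain)).div_const _).mul_const _
  -- a second preimage of `p` would be a zero of `K z = H z / (z - w₁)`, but `K z / (1 - conj w₁ z)` has
  -- positive real part on the boundary arcs, hence in the disc
  have h0n : closedBall (0 : ℂ) 1 ∈ 𝓝 w₁ :=
    Filter.mem_of_superset (isOpen_ball.mem_nhds hw₁) ball_subset_closedBall
  have h0n' : ball (0 : ℂ) 1 ∈ 𝓝 w₁ := isOpen_ball.mem_nhds hw₁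
  set K := dslope H w₁ with hK
  have hKc : ContinuousOn K (closedBall 0 1) :=
    (continuousOn_dslope h0n).mpr ⟨hHc, hHd.differentiableAt h0n'⟩
  have hKd : DifferentiableOn ℂ K (ball 0 1) := (differentiableOn_dslope h0n').mpr hHd
  have hHK : ∀ z, H z = (z - w₁) * K z := by
    intro z
    have := sub_smul_dslope H w₁ z
    simp only [smul_eq_mul] at this
    rw [hK, this]
    simp [hH, h₁]
  have hn1 : ‖w₁‖ < 1 := by simpa using hw₁
  have hden : ∀ z ∈ closedBall (0 : ℂ) 1, 1 - (starRingEnd ℂ) w₁ * z ≠ 0 := by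
    intro z hz h0
    have hz1 : ‖z‖ ≤ 1 := by simpa using hz
    have h1 : ‖(starRingEnd ℂ) w₁ * z‖ = 1 := by
      rw [← sub_eq_zero.mp h0, norm_one]
    rw [norm_mul, RCLike.norm_conj] at h1
    nlinarith [norm_nonneg w₁, norm_nonneg z]
  -- on the circle, `(z - w₁) (1 - conj w₁ z) = z |z - w₁|²`
  have hsph : ∀ z ∈ sphere (0 : ℂ) 1, K z / (1 - (starRingEnd ℂ) w₁ * z) =
      ((‖z - w₁‖ ^ 2 : ℝ) : ℂ)⁻¹ * (H z / z) ∧ z ≠ 0 ∧ 0 < ‖z - w₁‖ := by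
    intro z hz
    have hzn : ‖z‖ = 1 := by simpa using hz
    have hz1 : z * (starRingEnd ℂ) z = 1 := by
      rw [mul_conj, normSq_eq_norm_sq, hzn]; simp
    have hz0 : z ≠ 0 := fun h => by simp [h] at hz1
    have hzw : z - w₁ ≠ 0 := fun h => by
      rw [← sub_eq_zero.mp h] at hn1
      linarith
    refine ⟨?_, hz0, by simpa using hzw⟩
    have hn : ((‖z - w₁‖ ^ 2 : ℝ) : ℂ) = (z - w₁) * (starRingEnd ℂ) (z - w₁) := by
      rw [mul_conj, normSq_eq_norm_sq]
    have hnc : (starRingEnd ℂ) (z - w₁) ≠ 0 :=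
      (map_ne_zero _).mpr hzw
    have hd := hden z (sphere_subset_closedBall hz)
    have hrel : 1 - (starRingEnd ℂ) w₁ * z = z * (starRingEnd ℂ) (z - w₁) := by
      rw [map_sub]
      linear_combination -hz1
    rw [hn, hHK z, hrel]
    field_simp
  have hre : ∀ i : Fin 3, ∀ t ∈ Ioo ((i : ℕ) : ℝ) ((i : ℕ) + 1),
      0 < (K (bdry t) / (1 - (starRingEnd ℂ) w₁ * bdry t)).re := by
    intro i t ht
    obtain ⟨hq, hz0, hzw⟩ := hsph (bdry t) (by simp [norm_bdry])
    obtain ⟨r, hr, hrr⟩ := h.exists_scProd i ht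
    have hp' := hp i t ht
    have he : e i ≠ 0 := fun h0 => by simp [h0] at hp'
    have hHz : H (bdry t) / bdry t = r * ((F (bdry t) - p) / e i * I) := by
      have hs : scProd β (bdry t) = r * (κ * bdry t) / e i := by
        rw [← hrr]; field_simp
      simp only [hH]
      rw [hs]
      field_simp
    rw [hq, hHz, ← ofReal_inv, re_ofReal_mul, re_ofReal_mul]
    positivity
  have hpos := re_pos_of_re_nonneg_on_sphere (f := fun z => K z / (1 - (starRingEnd ℂ) w₁ * z))
    (hKc.div (by fun_prop) hden)
    (hKd.div (by fun_prop) fun z hz => hden z (ball_subset_closedBall hz)) (by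
      intro z hz
      rcases sphere_cases hz with ⟨j, rfl⟩ | ⟨i, t, ht, rfl⟩
      · have : H (marked j) = 0 := by simp [hH, scProd_marked h.pos j]
        simp [(hsph _ hz).1, this]
      · exact (hre i t ht).le)
    ⟨bdry (1 / 2), by simp [norm_bdry], hre 0 _ (by constructor <;> norm_num)⟩ hw₂
  have hK2 : K w₂ = 0 := by
    have := hHK w₂
    simp only [hH, h₂, sub_self, zero_mul, zero_div] at this
    rcases mul_eq_zero.mp this.symm with h | h
    · exact absurd (sub_eq_zero.mp h).symm hne
    · exact h
  simp [hK2] at hpos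

end SCData

/-! ### Schwarz-Christoffel maps -/

/-- The primitive of `G` vanishing at the origin, by integration along rays. -/
def rayIntegral (G : ℂ → ℂ) (w : ℂ) : ℂ := ∫ s in (0 : ℝ)..1, w * G (s * w)

theorem hasDerivAt_rayIntegral {G : ℂ → ℂ} {U : Set ℂ} (hU : IsOpen U)
    (hs : ∀ w ∈ U, ∀ s : ℝ, 0 ≤ s → s ≤ 1 → (s : ℂ) * w ∈ U) (hG : DifferentiableOn ℂ G U)
    {w : ℂ} (hw : w ∈ U) : HasDerivAt (rayIntegral G) (G w) w := by
  obtain ⟨r, hr, hball⟩ := nhds_basis_closedBall.mem_iff.mp (hU.mem_nhds hw)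
  have hG' : ContinuousOn (deriv G) U := (hG.deriv hU).continuousOn
  have hmem : ∀ x ∈ closedBall w r, ∀ s ∈ Icc (0 : ℝ) 1, (s : ℂ) * x ∈ U := fun x hx s h =>
    hs x (hball hx) s h.1 h.2
  have hc' : ContinuousOn (fun q : ℂ × ℝ => G (q.2 * q.1) + q.1 * (q.2 * deriv G (q.2 * q.1)))
      (closedBall w r ×ˢ Icc (0 : ℝ) 1) := by
    have hm : ContinuousOn (fun q : ℂ × ℝ => (q.2 : ℂ) * q.1) (closedBall w r ×ˢ Icc (0 : ℝ) 1) := by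
      fun_prop
    have hmt : MapsTo (fun q : ℂ × ℝ => (q.2 : ℂ) * q.1) (closedBall w r ×ˢ Icc (0 : ℝ) 1) U :=
      fun q hq => hmem q.1 hq.1 q.2 hq.2
    refine (hG.continuousOn.comp hm hmt).add (ContinuousOn.mul (by fun_prop)
      (ContinuousOn.mul (by fun_prop) (hG'.comp hm hmt)))
  obtain ⟨M, hM⟩ := ((isCompact_closedBall w r).prod isCompact_Icc).exists_bound_of_continuousOn hc'
  have hcx : ∀ x ∈ closedBall w r, ContinuousOn (fun s : ℝ => x * G (s * x)) (Icc (0 : ℝ) 1) := by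
    intro x hx
    refine ContinuousOn.mul (by fun_prop) (hG.continuousOn.comp (by fun_prop) fun s h => hmem x hx s h)
  have hI : uIoc (0 : ℝ) 1 ⊆ Icc 0 1 := by
    rw [uIoc_of_le zero_le_one]; exact Ioc_subset_Icc_self
  have hwm : w ∈ closedBall w r := mem_closedBall_self hr.le
  have hcw : ContinuousOn (fun s : ℝ => G (s * w) + w * (s * deriv G (s * w))) (Icc (0 : ℝ) 1) :=
    hc'.comp (f := fun s : ℝ => (w, s)) (by fun_prop) fun s h => ⟨hwm, h⟩
  have key := intervalIntegral.hasDerivAt_integral_of_dominated_loc_of_deriv_le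
    (μ := MeasureTheory.volume) (a := (0 : ℝ)) (b := 1)
    (F := fun x s => x * G (s * x)) (F' := fun x s => G (s * x) + x * (s * deriv G (s * x)))
    (x₀ := w) (s := closedBall w r) (bound := fun _ => M) (closedBall_mem_nhds w hr)
    (by
      filter_upwards [closedBall_mem_nhds w hr] with x hx
      exact ((hcx x hx).mono hI).aestronglyMeasurable measurableSet_uIoc)
    ((hcx w hwm).intervalIntegrable_of_Icc zero_le_one)
    ((hcw.mono hI).aestronglyMeasurable measurableSet_uIoc)
    (Filter.Eventually.of_forall fun s h x hx => hM (x, s) ⟨hx, hI h⟩)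
    intervalIntegrable_const
    (Filter.Eventually.of_forall fun s h x hx => by
      have h1 : HasDerivAt G (deriv G (s * x)) (s * x) :=
        (hG.differentiableAt (hU.mem_nhds (hmem x hx s (hI h)))).hasDerivAt
      have h2 : HasDerivAt (fun x : ℂ => (s : ℂ) * x) s x := by
        simpa using (hasDerivAt_id x).const_mul (s : ℂ)
      refine ((hasDerivAt_id x).mul (h1.comp x h2)).congr_deriv ?_
      simp [mul_comm])
  -- the integrand is the derivative of `s ↦ s G (s w)`
  have hint : ∫ s in (0 : ℝ)..1, (G (s * w) + w * (s * deriv G (s * w))) = G w := by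
    have h3 : ∀ s ∈ uIcc (0 : ℝ) 1, HasDerivAt (fun s : ℝ => (s : ℂ) * G (s * w))
        (G (s * w) + w * (s * deriv G (s * w))) s := by
      intro s h
      rw [uIcc_of_le zero_le_one] at h
      have h1 : HasDerivAt G (deriv G (s * w)) (s * w) :=
        (hG.differentiableAt (hU.mem_nhds (hmem w hwm s h))).hasDerivAt
      have h2 : HasDerivAt (fun s : ℝ => (s : ℂ) * w) w s := by
        simpa using (ofRealCLM.hasDerivAt (x := s)).mul_const w
      have h4 : HasDerivAt (fun s : ℝ => (s : ℂ)) 1 s := ofRealCLM.hasDerivAt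
      refine (h4.mul (h1.comp s h2)).congr_deriv ?_
      simp only [Function.comp]
      ring
    rw [intervalIntegral.integral_eq_sub_of_hasDerivAt h3 (hcw.intervalIntegrable_of_Icc zero_le_one)]
    simp
  rw [hint] at key
  exact key.2

/-- Near a marked point, the integrand of `rayIntegral (scProd (-β))` is dominated by an integrable
function of the parameter of the ray. -/
theorem scProd_ray_bound {β : Fin 3 → ℝ} (h0 : ∀ j, 0 < β j) (h1 : ∀ j, β j < 1) (i : Fin 3) :
    ∀ᶠ w in 𝓝[closedBall 0 1] marked i, ∀ s ∈ Ioo (0 : ℝ) 1,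
      ‖w * scProd (-β) (s * w)‖ ≤ 4 * (1 - s) ^ (-β i) := by
  have hre : ∀ j, j ≠ i → ∀ᶠ w in 𝓝[closedBall 0 1] marked i, (w / marked j).re < 1 / 2 := by
    intro j hj
    have hc : ContinuousAt (fun w : ℂ => (w / marked j).re) (marked i) := by fun_prop
    refine (hc.eventually_lt continuousAt_const ?_).filter_mono nhdsWithin_le_nhds
    -- the quotient is a primitive cube root of unity
    set z := marked i / marked j with hz
    have hz3 : z ^ 3 = 1 := by
      have h3 : ∀ k, marked k ^ 3 = 1 := by
        intro k
        have : marked k ^ 3 = bdry (3 * (k : ℕ)) := by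
          rw [marked, pow_succ, sq, ← bdry_add, ← bdry_add]; congr 2; ring
        rw [this, coe_bdry, exp_eq_one_iff]
        exact ⟨k, by push_cast; ring⟩
      rw [hz, div_pow, h3, h3, div_one]
    have hz1 : z ≠ 1 := by
      intro h
      have h2 := (div_eq_one_iff_eq (marked_ne_zero j)).mp h
      have h3 := sub_lt_three_of_bdry_eq (Subtype.ext h2) (by
        fin_cases i <;> fin_cases j <;> norm_num)
      exact hj (Fin.ext (by exact_mod_cast h3.symm))
    have hsum : 1 + z + z ^ 2 = 0 := by
      refine mul_left_cancel₀ (sub_ne_zero.mpr hz1) ?_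
      linear_combination hz3
    have e1 := congrArg re hsum
    have e2 := congrArg im hsum
    simp [sq] at e1 e2
    nlinarith [sq_nonneg z.im]
  have hall : ∀ᶠ w in 𝓝[closedBall 0 1] marked i, ∀ j, j ≠ i → (w / marked j).re < 1 / 2 :=
    Filter.eventually_all.mpr fun j => by
      by_cases h : j = i
      · simp [h]
      · simpa [h] using hre j h
  filter_upwards [hall, self_mem_nhdsWithin] with w hw hwb s hs
  have hn : ‖w‖ ≤ 1 := by simpa using hwb
  have hf : ∀ j, ‖(1 - s * w / marked j) ^ ((-β) j : ℂ)‖ ≤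
      if j = i then (1 - s) ^ (-β i) else 2 := by
    intro j
    have hpos : 0 < 1 - s := by linarith [hs.2]
    rw [show ((-β) j : ℂ) = ((-β j : ℝ) : ℂ) by simp, norm_cpow_real]
    split_ifs with h
    · subst h
      refine Real.rpow_le_rpow_of_nonpos hpos ?_ (by linarith [h0 j])
      have h2 : ‖(s : ℂ) * w / marked j‖ ≤ s := by
        rw [norm_div, norm_marked, div_one, norm_mul, norm_real, Real.norm_of_nonneg hs.1.le]
        nlinarith [hs.1]
      have h3 := norm_sub_norm_le 1 ((s : ℂ) * w / marked j)
      rw [norm_one] at h3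
      linarith
    · have h2 : (1 / 2 : ℝ) ≤ ‖1 - s * w / marked j‖ := by
        refine le_trans ?_ (re_le_norm _)
        rw [mul_div_assoc, sub_re, one_re, re_ofReal_mul]
        nlinarith [hw j h, hs.1, hs.2]
      calc ‖1 - s * w / marked j‖ ^ (-β j) ≤ (1 / 2 : ℝ) ^ (-β j) :=
            Real.rpow_le_rpow_of_nonpos (by norm_num) h2 (by linarith [h0 j])
        _ ≤ (1 / 2 : ℝ) ^ (-1 : ℝ) :=
            Real.rpow_le_rpow_of_exponent_ge (by norm_num) (by norm_num) (by linarith [h1 j])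
        _ = 2 := by rw [Real.rpow_neg_one]; norm_num
  have hx : 0 ≤ (1 - s) ^ (-β i) := Real.rpow_nonneg (by linarith [hs.2]) _
  calc ‖w * scProd (-β) (s * w)‖ ≤ 1 * ‖scProd (-β) (s * w)‖ := by
        rw [norm_mul]
        exact mul_le_mul_of_nonneg_right hn (norm_nonneg _)
    _ ≤ ∏ j, if j = i then (1 - s) ^ (-β i) else 2 := by
        rw [one_mul, scProd, norm_prod]
        exact Finset.prod_le_prod (fun _ _ => norm_nonneg _) fun j _ => hf j
    _ = 4 * (1 - s) ^ (-β i) := by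
        rw [← Finset.mul_prod_erase _ _ (Finset.mem_univ i), if_pos rfl, Finset.prod_congr rfl
          (fun j hj => if_neg (Finset.ne_of_mem_erase hj)), Finset.prod_const,
          Finset.card_erase_of_mem (Finset.mem_univ i)]
        simp only [Finset.card_univ, Fintype.card_fin]
        ring

/-- The Schwarz-Christoffel integral extends continuously to the marked points, by dominated
convergence, since the exponents `-β j` of the singularities exceed `-1`. -/
theorem continuousOn_rayIntegral_scProd {β : Fin 3 → ℝ} (h0 : ∀ j, 0 < β j)
    (h1 : ∀ j, β j < 1) : ContinuousOn (rayIntegral (scProd (-β))) (closedBall 0 1) := by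
  intro w hw
  by_cases hm : ∃ i, w = marked i
  · obtain ⟨i, rfl⟩ := hm
    have hsm : ∀ x ∈ closedBall (0 : ℂ) 1, ∀ s ∈ Ioo (0 : ℝ) 1, (s : ℂ) * x ∈ slitDomain := by
      intro x hx s hs
      have hx1 : ‖x‖ ≤ 1 := by simpa using hx
      refine ball_subset_slitDomain ?_
      rw [mem_ball_zero_iff, norm_mul, norm_real, Real.norm_of_nonneg hs.1.le]
      nlinarith [hs.1, hs.2, norm_nonneg x]
    have hI : ∀ᵐ s : ℝ ∂MeasureTheory.volume, s ∈ uIoc (0 : ℝ) 1 → s ∈ Ioo (0 : ℝ) 1 := by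
      have : ∀ᵐ s : ℝ ∂MeasureTheory.volume, s ≠ 1 := by
        simp [MeasureTheory.ae_iff]
      filter_upwards [this] with s hs h
      rw [uIoc_of_le zero_le_one] at h
      exact ⟨h.1, lt_of_le_of_ne h.2 hs⟩
    refine intervalIntegral.continuousWithinAt_of_dominated_interval
      (bound := fun s => 4 * (1 - s) ^ (-β i)) ?_ ?_ ?_ ?_
    · filter_upwards [self_mem_nhdsWithin] with x hx
      rw [uIoc_of_le zero_le_one, ← MeasureTheory.restrict_Ioo_eq_restrict_Ioc]
      refine ContinuousOn.aestronglyMeasurable ?_ measurableSet_Ioo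
      exact ContinuousOn.mul (by fun_prop) ((differentiableOn_scProd (-β)).continuousOn.comp
        (by fun_prop) fun s hs => hsm x hx s hs)
    · filter_upwards [scProd_ray_bound h0 h1 i] with x hx
      filter_upwards [hI] with s hs h
      exact hx s (hs h)
    · refine IntervalIntegrable.const_mul ?_ _
      have h2 : IntervalIntegrable (fun x : ℝ => x ^ (-β i)) MeasureTheory.volume 0 1 :=
        intervalIntegral.intervalIntegrable_rpow' (by linarith [h1 i])
      simpa using (h2.comp_sub_left 1).symm
    · filter_upwards [hI] with s hs h
      have h3 := hsm _ hw s (hs h)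
      have h4 : ContinuousAt (fun x => (s : ℂ) * x) (marked i) := by fun_prop
      have h5 := ((differentiableOn_scProd (-β)).differentiableAt
        (isOpen_slitDomain.mem_nhds h3)).continuousAt
      exact (continuousAt_id.mul
        (ContinuousAt.comp (f := fun x => (s : ℂ) * x) h5 h4)).continuousWithinAt
  · push Not at hm
    exact (hasDerivAt_rayIntegral isOpen_slitDomain
      (fun w hw s hs0 hs1 => smul_mem_slitDomain hw hs0 hs1)
      (differentiableOn_scProd (-β)) (mem_slitDomain hw hm)).continuousAt.continuousWithinAt

theorem mapsTo_bdry_slitDomain (i : Fin 3) {t : ℝ}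
    (ht : t ∈ Ioo ((i : ℕ) : ℝ) ((i : ℕ) + 1)) : (bdry t : ℂ) ∈ slitDomain := by
  refine mem_slitDomain (bdry t).2 fun j hj => ?_
  have h := sub_lt_three_of_bdry_eq (Subtype.ext hj) (by
    obtain ⟨h1, h2⟩ := ht
    rw [abs_lt]
    fin_cases i <;> fin_cases j <;> norm_num at h1 h2 ⊢ <;> constructor <;> linarith)
  rw [h] at ht
  obtain ⟨h1, h2⟩ := ht
  have h1' : (i : ℕ) < (j : ℕ) := by exact_mod_cast h1
  have h2' : (j : ℕ) < (i : ℕ) + 1 := by exact_mod_cast h2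
  omega

/-- A path whose velocity is at each time a positive multiple of `e` runs monotonically along a line
in the direction of `e`. -/
theorem exists_strictMonoOn_of_deriv_parallel {f : ℝ → ℂ} {a b : ℝ} {e : ℂ}
    (he : e ≠ 0) (hc : ContinuousOn f (Icc a b))
    (hf : ∀ t ∈ Ioo a b, ∃ r : ℝ, 0 < r ∧ HasDerivAt f (r * e) t) :
    ∃ g : ℝ → ℝ, StrictMonoOn g (Icc a b) ∧ g a = 0 ∧ ∀ t ∈ Icc a b, f t = f a + g t * e := by
  set h : ℝ → ℂ := fun t => (f t - f a) / e with hh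
  have hhc : ContinuousOn h (Icc a b) := (hc.sub continuousOn_const).div_const _
  have hhd : ∀ t ∈ Ioo a b, ∃ r : ℝ, 0 < r ∧ HasDerivAt h r t := by
    intro t ht
    obtain ⟨r, hr, hd⟩ := hf t ht
    refine ⟨r, hr, ?_⟩
    have := (hd.sub_const (f a)).div_const e
    rwa [mul_div_assoc, div_self he, mul_one] at this
  have hre : ∀ t ∈ Ioo a b, 0 < deriv (fun t => (h t).re) t := by
    intro t ht
    obtain ⟨r, hr, hd⟩ := hhd t ht
    have h1 : HasDerivAt (fun t => (h t).re) (reCLM (r : ℂ)) t :=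
      reCLM.hasFDerivAt.comp_hasDerivAt t hd
    rw [h1.deriv]
    simpa using hr
  have him : ∀ t ∈ Ioo a b, HasDerivAt (fun t => (h t).im) 0 t := by
    intro t ht
    obtain ⟨r, hr, hd⟩ := hhd t ht
    have h1 : HasDerivAt (fun t => (h t).im) (imCLM (r : ℂ)) t :=
      imCLM.hasFDerivAt.comp_hasDerivAt t hd
    simpa using h1
  have him0 : ∀ t ∈ Icc a b, (h t).im = 0 := by
    intro t ht
    have h0 : (h a).im = 0 := by simp [hh]
    rcases eq_or_lt_of_le ht.1 with rfl | hlt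
    · exact h0
    · obtain ⟨c, hc1, hc2⟩ := exists_hasDerivAt_eq_slope (fun t => (h t).im) (fun _ => 0) hlt
        (continuous_im.comp_continuousOn (hhc.mono (Icc_subset_Icc_right ht.2)))
        (fun x hx => him x ⟨hx.1, hx.2.trans_le ht.2⟩)
      rw [eq_div_iff (by linarith), h0] at hc2
      linarith
  refine ⟨fun t => (h t).re, strictMonoOn_of_deriv_pos (convex_Icc a b)
    (continuous_re.comp_continuousOn hhc) (by rwa [interior_Icc]), by simp [hh], fun t ht => ?_⟩
  have h1 : (((h t).re : ℝ) : ℂ) = h t := Complex.ext (by simp) (by simp [him0 t ht])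
  rw [h1, hh]
  field_simp
  ring

theorem hasDerivAt_bdry (t : ℝ) :
    HasDerivAt (fun t => (bdry t : ℂ)) (2 * Real.pi / 3 * I * bdry t) t := by
  have h2 : HasDerivAt (fun t : ℝ => ((2 * Real.pi * t / 3 : ℝ) : ℂ) * I) (2 * Real.pi / 3 * I) t := by
    have h3 : HasDerivAt (fun t : ℝ => 2 * Real.pi * t / 3) (2 * Real.pi / 3) t := by
      simpa using ((hasDerivAt_id t).const_mul (2 * Real.pi)).div_const 3
    refine ((h3.ofReal_comp).mul_const I).congr_deriv ?_
    push_cast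
    rfl
  refine h2.cexp.congr_deriv ?_
  rw [← coe_bdry]
  ring

/-- The Schwarz-Christoffel map onto the triangle with sides `e 0, e 1, e 2`. The integral of the
Schwarz-Christoffel product yields a triangle with sides in the given directions, and up to a scale
there is only one such triangle. -/
theorem SCData.exists_map {β : Fin 3 → ℝ} {e : Fin 3 → ℂ} {κ : ℂ} (h : SCData β e κ)
    (he : e 0 + e 1 + e 2 = 0) (hind : ∀ a b : ℝ, a * e 0 + b * e 1 = 0 → a = 0 ∧ b = 0) :
    ∃ F : ℂ → ℂ, ContinuousOn F (closedBall 0 1) ∧ DifferentiableOn ℂ F slitDomain ∧ F 1 = 0 ∧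
      ∀ i : Fin 3, ∃ g : ℝ → ℝ, StrictMonoOn g (Icc ((i : ℕ) : ℝ) ((i : ℕ) + 1)) ∧
        g (i : ℕ) = 0 ∧ g ((i : ℕ) + 1) = 1 ∧ ∀ t ∈ Icc ((i : ℕ) : ℝ) ((i : ℕ) + 1),
          F (bdry t) = F (marked i) + g t * e i := by
  set E : ℂ → ℂ := fun w => -κ * I * rayIntegral (scProd (-β)) w with hE
  have hEc : ContinuousOn E (closedBall 0 1) :=
    continuousOn_const.mul (continuousOn_rayIntegral_scProd h.pos h.lt_one)
  have hEd : ∀ w ∈ slitDomain, HasDerivAt E (-κ * I * scProd (-β) w) w := fun w hw =>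
    (hasDerivAt_rayIntegral isOpen_slitDomain
      (fun w hw s hs0 hs1 => smul_mem_slitDomain hw hs0 hs1)
      (differentiableOn_scProd (-β)) hw).const_mul _
  have he0 : ∀ i, e i ≠ 0 := by
    intro i
    obtain ⟨r, hr, hi⟩ := h.dir i
    rw [hi]
    exact mul_ne_zero (by exact_mod_cast hr.ne') (mul_ne_zero h.ne_zero (neg_ne_zero.mpr (exp_ne_zero _)))
  have harc : ∀ i : Fin 3, ∃ g : ℝ → ℝ, StrictMonoOn g (Icc ((i : ℕ) : ℝ) ((i : ℕ) + 1)) ∧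
      g (i : ℕ) = 0 ∧ ∀ t ∈ Icc ((i : ℕ) : ℝ) ((i : ℕ) + 1),
        E (bdry t) = E (marked i) + g t * e i := by
    intro i
    refine exists_strictMonoOn_of_deriv_parallel (f := fun t => E (bdry t)) (he0 i)
      (hEc.comp (continuous_subtype_val.comp continuous_bdry).continuousOn fun t _ => (bdry t).2) ?_
    intro t ht
    obtain ⟨r, hr, hi⟩ := h.dir i
    obtain ⟨r', hr', hG⟩ := exists_scProd_neg_bdry_of_sum_eq_two h.sum i ht
    refine ⟨2 * Real.pi / 3 * r' / r, by positivity, ?_⟩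
    refine ((hEd _ (mapsTo_bdry_slitDomain i ht)).comp t (hasDerivAt_bdry t)).congr_deriv ?_
    rw [hi]
    have hr0 : (r : ℂ) ≠ 0 := by exact_mod_cast hr.ne'
    have h3 : ((2 * Real.pi / 3 * r' / r : ℝ) : ℂ) * (r * (κ * -exp (-scPhase β i * I))) =
        2 * Real.pi / 3 * κ * (r' * -exp (-scPhase β i * I)) := by
      push_cast
      field_simp
    rw [h3, ← hG]
    linear_combination (-(2 * Real.pi / 3) * κ * bdry t * scProd (-β) (bdry t)) * I_sq
  choose g hg hg0 hgE using harc
  have hend : ∀ i : Fin 3, g i ((i : ℕ) + 1) * e i = E (bdry ((i : ℕ) + 1)) - E (marked i) := by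
    intro i
    rw [hgE i _ ⟨by linarith, le_rfl⟩]
    ring
  have hpos : ∀ i : Fin 3, 0 < g i ((i : ℕ) + 1) := by
    intro i
    rw [← hg0 i]
    exact hg i ⟨le_rfl, by linarith⟩ ⟨by linarith, le_rfl⟩ (by linarith)
  have hsum : (g 0 1 : ℂ) * e 0 + g 1 2 * e 1 + g 2 3 * e 2 = 0 := by
    have k0 := hend 0
    have k1 := hend 1
    have k2 := hend 2
    simp only [Fin.val_zero, Fin.val_one, Fin.val_two, Nat.cast_zero, Nat.cast_one, Nat.cast_ofNat,
      zero_add, marked] at k0 k1 k2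
    norm_num at k1 k2
    rw [bdry_three] at k2
    rw [k0, k1, k2]
    ring
  -- two triangles with sides in the same directions are similar
  have heq := hind (g 0 1 - g 2 3) (g 1 2 - g 2 3) (by
    push_cast
    linear_combination hsum - g 2 3 * he)
  have hr : ∀ i : Fin 3, g i ((i : ℕ) + 1) = g 0 1 := by
    intro i
    have k0 := heq.1
    have k1 := heq.2
    have k2 : g 2 3 = g 0 1 := by linarith
    have k3 : g 1 2 = g 0 1 := by linarith
    fin_cases i
    · norm_num
    · norm_num
      exact k3
    · norm_num
      exact k2
  set ρ := g 0 1 with hρ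
  have hρ0 : 0 < ρ := by simpa [hr] using hpos 0
  have hρ0' : (ρ : ℂ) ≠ 0 := by exact_mod_cast hρ0.ne'
  refine ⟨fun w => (E w - E 1) / ρ, (hEc.sub continuousOn_const).div_const _,
    fun w hw => (((hEd w hw).sub_const _).div_const _).differentiableAt.differentiableWithinAt,
    by simp, fun i => ⟨fun t => g i t / ρ, ?_, ?_, ?_, ?_⟩⟩
  · intro x hx y hy hxy
    exact div_lt_div_of_pos_right (hg i hx hy hxy) hρ0
  · simp [hg0]
  · simp only [hr]
    exact div_self hρ0.ne'
  · intro t ht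
    simp only
    rw [hgE i t ht]
    push_cast
    field_simp
    ring

/-! ### The conformal map onto a triangle -/

theorem arg_mem_Ioo_of_im_pos {z : ℂ} (hz : 0 < z.im) : arg z ∈ Ioo 0 Real.pi := by
  refine ⟨lt_of_le_of_ne (arg_nonneg_iff.mpr hz.le) fun h => ?_, arg_lt_pi_iff.mpr (Or.inr hz.ne')⟩
  exact hz.ne' (arg_eq_zero_iff.mp h.symm).2

theorem im_div_eq (z w : ℂ) : (z / w).im = ((starRingEnd ℂ) w * z).im / normSq w := by
  rw [div_eq_mul_inv, inv_def]
  simp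
  ring

/-- The vectors `e 0, e 1, e 2` are the consecutive sides of a nondegenerate triangle that is run
through counterclockwise. -/
structure IsTriangle (e : Fin 3 → ℂ) : Prop where
  sum : e 0 + e 1 + e 2 = 0
  pos : 0 < ((starRingEnd ℂ) (e 0) * e 1).im

namespace IsTriangle

variable {e : Fin 3 → ℂ}

theorem e_two (h : IsTriangle e) : e 2 = -(e 0 + e 1) := by linear_combination h.sum

theorem ne_zero (h : IsTriangle e) (i : Fin 3) : e i ≠ 0 := by
  have hp := h.pos
  fin_cases i
  · intro h0
    simp only [Fin.zero_eta] at h0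
    simp [h0] at hp
  · intro h0
    simp only [Fin.mk_one] at h0
    simp [h0] at hp
  · intro h0
    simp only [Fin.reduceFinMk] at h0
    have h1 : e 1 = -e 0 := by linear_combination h.sum - h0
    rw [h1] at hp
    simp at hp
    linarith

theorem im_div_pos (h : IsTriangle e) (i : Fin 3) : 0 < (e (i + 1) / e i).im := by
  have hp := h.pos
  rw [im_div_eq]
  refine div_pos ?_ (normSq_pos.mpr (h.ne_zero i))
  fin_cases i
  · exact hp
  · change 0 < ((starRingEnd ℂ) (e 1) * e 2).im
    rw [h.e_two]
    simp at hp ⊢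
    linarith
  · change 0 < ((starRingEnd ℂ) (e 2) * e 0).im
    rw [h.e_two]
    simp at hp ⊢
    linarith

/-- The exterior angles of a triangle add up to a full turn, and with exponents given by them the
directions of the arcs under the Schwarz-Christoffel map turn by the same angles as the sides. -/
theorem exists_scData (h : IsTriangle e) : ∃ β κ, SCData β e κ := by
  have hpi := Real.pi_pos
  set a : Fin 3 → ℝ := fun i => arg (e (i + 1) / e i) with ha
  have ha1 : ∀ i, a i ∈ Ioo 0 Real.pi := fun i => arg_mem_Ioo_of_im_pos (h.im_div_pos i)
  obtain ⟨N, hN⟩ : ∃ N : Fin 3 → ℝ, ∀ i, N i = ‖e (i + 1) / e i‖ := ⟨_, fun _ => rfl⟩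
  have hexp : ∀ i, e (i + 1) = N i * exp (a i * I) * e i := by
    intro i
    rw [ha, hN, norm_mul_exp_arg_mul_I, div_mul_cancel₀ _ (h.ne_zero i)]
  have hn : ∀ i, 0 < N i := fun i => by
    rw [hN]
    exact norm_pos_iff.mpr (div_ne_zero (h.ne_zero _) (h.ne_zero _))
  -- the three exterior angles add up to a full turn
  have hsum : a 0 + a 1 + a 2 = 2 * Real.pi := by
    have h1 : exp ((a 0 + a 1 + a 2 : ℝ) * I) = 1 := by
      have k : (N 0 * N 1 * N 2 : ℝ) = 1 := by
        rw [hN, hN, hN, ← norm_mul, ← norm_mul]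
        simp only [Fin.isValue, zero_add, Fin.reduceAdd]
        have h0 := h.ne_zero 0
        have h1 := h.ne_zero 1
        have h2 := h.ne_zero 2
        rw [show e 1 / e 0 * (e 2 / e 1) * (e 0 / e 2) = 1 by field_simp, norm_one]
      have k0 := hexp 0
      have k1 := hexp 1
      have k2 := hexp 2
      simp only [Fin.isValue, zero_add, Fin.reduceAdd] at k0 k1 k2
      have k3 : e 0 = ((N 0 * N 1 * N 2 : ℝ) : ℂ) *
          exp ((a 0 + a 1 + a 2 : ℝ) * I) * e 0 := by
        have : exp ((a 0 + a 1 + a 2 : ℝ) * I) =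
            exp (a 0 * I) * exp (a 1 * I) * exp (a 2 * I) := by
          rw [← exp_add, ← exp_add]; congr 1; push_cast; ring
        rw [this]
        conv_lhs => rw [k2, k1, k0]
        push_cast
        ring
      rw [k, ofReal_one, one_mul] at k3
      exact mul_right_cancel₀ (h.ne_zero 0) (by rw [← k3, one_mul])
    rw [exp_eq_one_iff] at h1
    obtain ⟨n, hn⟩ := h1
    have h2 : ((a 0 + a 1 + a 2 : ℝ) : ℂ) = ((n * (2 * Real.pi) : ℝ) : ℂ) := by
      refine mul_right_cancel₀ I_ne_zero ?_
      rw [hn]; push_cast; ring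
    have h3 := ofReal_injective h2
    have b0 := ha1 0
    have b1 := ha1 1
    have b2 := ha1 2
    have h4 : 0 < (n : ℝ) := by
      by_contra hneg
      push Not at hneg
      nlinarith [b0.1, b1.1, b2.1]
    have h5 : (n : ℝ) < 2 := by
      by_contra hneg
      push Not at hneg
      nlinarith [b0.2, b1.2, b2.2]
    have h6 : n = 1 := by
      have : 0 < n := by exact_mod_cast h4
      have : n < 2 := by exact_mod_cast h5
      omega
    rw [h3, h6]
    simp
  set β : Fin 3 → ℝ := ![a 2 / Real.pi, a 0 / Real.pi, a 1 / Real.pi] with hβ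
  have hph1 : scPhase β 0 - scPhase β 1 = a 0 := by
    simp [scPhase, hβ, Fin.sum_univ_three]
    field_simp
    ring
  have hph2 : scPhase β 1 - scPhase β 2 = a 1 := by
    simp [scPhase, hβ, Fin.sum_univ_three]
    field_simp
    ring
  have hstep : ∀ (i : Fin 3) (j : Fin 3), scPhase β i - scPhase β j = a i →
      e j = e (i + 1) → ∀ κ : ℂ, (∃ r : ℝ, 0 < r ∧ e i = r * (κ * -exp (-scPhase β i * I))) →
      ∃ r : ℝ, 0 < r ∧ e j = r * (κ * -exp (-scPhase β j * I)) := by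
    rintro i j hp hj κ ⟨r, hr, hi⟩
    refine ⟨N i * r, mul_pos (hn i) hr, ?_⟩
    have h1 : exp (-scPhase β j * I) = exp (a i * I) * exp (-scPhase β i * I) := by
      rw [← exp_add, ← hp]; congr 1; push_cast; ring
    rw [hj, hexp i, h1]
    rw [hi]
    push_cast
    ring
  have hd0 : ∃ r : ℝ, 0 < r ∧ e 0 = r * ((-e 0 * exp (scPhase β 0 * I)) *
      -exp (-scPhase β 0 * I)) := by
    refine ⟨1, one_pos, ?_⟩
    have : exp (scPhase β 0 * I) * exp (-scPhase β 0 * I) = 1 := by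
      rw [← exp_add]; simp
    push_cast
    linear_combination -e 0 * this
  have hd1 := hstep 0 1 hph1 rfl _ hd0
  have hd2 := hstep 1 2 hph2 rfl _ hd1
  refine ⟨β, -e 0 * exp (scPhase β 0 * I), ⟨?_, ?_, ?_, ?_, ?_⟩⟩
  · intro j
    fin_cases j <;> simp [hβ] <;> exact div_pos (ha1 _).1 hpi
  · intro j
    fin_cases j <;> simp [hβ] <;> rw [div_lt_one hpi] <;> exact (ha1 _).2
  · simp [hβ, Fin.sum_univ_three]
    field_simp
    linarith
  · exact mul_ne_zero (neg_ne_zero.mpr (h.ne_zero 0)) (exp_ne_zero _)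
  · intro i
    fin_cases i
    · exact hd0
    · exact hd1
    · exact hd2

theorem independent (h : IsTriangle e) {a b : ℝ} (hab : a * e 0 + b * e 1 = 0) :
    a = 0 ∧ b = 0 := by
  have hp := h.pos
  have h1 : b * ((starRingEnd ℂ) (e 0) * e 1).im = 0 := by
    have := congrArg (fun z => ((starRingEnd ℂ) (e 0) * z).im) hab
    simp at this
    rw [mul_im, conj_re, conj_im]
    linarith
  have hb : b = 0 := (mul_eq_zero.mp h1).resolve_right hp.ne'
  refine ⟨?_, hb⟩
  rw [hb, ofReal_zero, zero_mul, add_zero] at hab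
  simpa [h.ne_zero 0] using hab

end IsTriangle

/-- The vertices of the triangle with sides `e 0, e 1, e 2` and first vertex `0`. -/
def triVertex (e : Fin 3 → ℂ) : Fin 3 → ℂ := ![0, e 0, e 0 + e 1]

/-- The open triangle with sides `e 0, e 1, e 2` and first vertex `0`: the points to the left of
all the sides. -/
def openTriangle (e : Fin 3 → ℂ) : Set ℂ := {p | ∀ i, 0 < ((p - triVertex e i) / e i).im}

theorem convex_openTriangle (e : Fin 3 → ℂ) : Convex ℝ (openTriangle e) := by
  intro p hp q hq a b ha hb hab i
  have h : ((a • p + b • q - triVertex e i) / e i).im =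
      a * ((p - triVertex e i) / e i).im + b * ((q - triVertex e i) / e i).im := by
    have h1 : (a • p + b • q - triVertex e i) / e i =
        a * ((p - triVertex e i) / e i) + b * ((q - triVertex e i) / e i) := by
      have : (a : ℂ) + b = 1 := by exact_mod_cast hab
      simp only [real_smul]
      linear_combination (triVertex e i / e i) * this
    rw [h1, add_im, im_ofReal_mul, im_ofReal_mul]
  rw [h]
  have hp := hp i
  have hq := hq i
  rcases ha.eq_or_lt with rfl | ha
  · have : b = 1 := by linarith
    simpa [this] using hq
  · have := mul_nonneg hb hq.le
    have := mul_pos ha hp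
    linarith

/-- `F` maps the disc to the triangle with sides `e 0, e 1, e 2` and first vertex `0`, holomorphically
in the interior and, with strictly monotone parametrization, each boundary arc onto a side. -/
structure IsTriangleMap (e : Fin 3 → ℂ) (F : ℂ → ℂ) : Prop where
  cont : ContinuousOn F (closedBall 0 1)
  diff : DifferentiableOn ℂ F slitDomain
  vertex : ∀ i, F (marked i) = triVertex e i
  arc : ∀ i : Fin 3, ∃ g : ℝ → ℝ, StrictMonoOn g (Icc ((i : ℕ) : ℝ) ((i : ℕ) + 1)) ∧
    g (i : ℕ) = 0 ∧ g ((i : ℕ) + 1) = 1 ∧ ∀ t ∈ Icc ((i : ℕ) : ℝ) ((i : ℕ) + 1),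
      F (bdry t) = triVertex e i + g t * e i

theorem IsTriangle.exists_map {e : Fin 3 → ℂ} (h : IsTriangle e) : ∃ F, IsTriangleMap e F := by
  obtain ⟨β, κ, hd⟩ := h.exists_scData
  obtain ⟨F, hc, hd, h1, harc⟩ := hd.exists_map h.sum fun a b => h.independent
  have hv : ∀ i, F (marked i) = triVertex e i := by
    have h0 : F (marked 0) = 0 := by rw [marked_zero, h1]
    have hstep : ∀ i : Fin 3, F (bdry ((i : ℕ) + 1)) = F (marked i) + e i := by
      intro i
      obtain ⟨g, -, -, hg1, hg⟩ := harc i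
      rw [hg _ ⟨by linarith, le_rfl⟩, hg1, ofReal_one, one_mul]
    have e1 : F (marked 1) = e 0 := by
      have := hstep 0
      rw [h0, zero_add] at this
      rw [← this, marked]
      norm_num
    have e2 : F (marked 2) = e 0 + e 1 := by
      have := hstep 1
      rw [e1] at this
      rw [← this, marked]
      norm_num
    intro i
    fin_cases i
    · simpa [triVertex] using h0
    · simpa [triVertex] using e1
    · simpa [triVertex] using e2
  refine ⟨F, hc, hd, hv, fun i => ?_⟩
  simpa only [hv] using harc i

namespace IsTriangleMap

variable {e : Fin 3 → ℂ} {F : ℂ → ℂ}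

theorem contDiffOn (hF : IsTriangleMap e F) : ContDiffOn ℝ ∞ F slitDomain :=
  (hF.diff.contDiffOn isOpen_slitDomain).restrict_scalars ℝ

/-- The boundary values lie in the closed half-plane to the left of each side. -/
theorem im_nonneg_of_bdry (h : IsTriangle e) (hF : IsTriangleMap e F) (i : Fin 3) {w : ℂ}
    (hw : w ∈ sphere (0 : ℂ) 1) : 0 ≤ ((F w - triVertex e i) / e i).im := by
  -- the other vertices lie to the left of the side `i`
  have hv : ∀ k, 0 ≤ ((triVertex e k - triVertex e i) / e i).im ∧
      0 ≤ ((triVertex e k + e k - triVertex e i) / e i).im := by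
    have key : ∀ k : Fin 3, 0 ≤ ((triVertex e k - triVertex e i) / e i).im := by
      have hp := h.im_div_pos i
      have hi := h.ne_zero i
      have hz : (0 - e 0 - e 1 : ℂ) = e 2 := by linear_combination -h.sum
      intro k
      have c1 : triVertex e (i + 1) - triVertex e i = e i := by
        fin_cases i <;> simp [triVertex]
        rw [← hz]; ring
      have c2 : triVertex e (i + 2) - triVertex e i = e i + e (i + 1) := by
        fin_cases i
        · simp [triVertex]
        · simp [triVertex]
          linear_combination -h.sum
        · simp [triVertex]
          linear_combination -h.sum
      have hk : k = i ∨ k = i + 1 ∨ k = i + 2 := by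
        fin_cases i <;> fin_cases k <;> simp
      rcases hk with rfl | rfl | rfl
      · simp
      · rw [c1, div_self hi]; simp
      · rw [c2, add_div, div_self hi]
        simpa using hp.le
    intro k
    refine ⟨key k, ?_⟩
    have : triVertex e k + e k = triVertex e (k + 1) := by
      fin_cases k <;> simp [triVertex]
      exact h.sum
    rw [this]
    exact key _
  obtain ⟨k, t, ht, rfl⟩ : ∃ k : Fin 3, ∃ t ∈ Icc ((k : ℕ) : ℝ) ((k : ℕ) + 1), w = bdry t := by
    rcases sphere_cases hw with ⟨j, rfl⟩ | ⟨i, t, ht, rfl⟩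
    · exact ⟨j, (j : ℕ), ⟨le_rfl, by linarith⟩, rfl⟩
    · exact ⟨i, t, Ioo_subset_Icc_self ht, rfl⟩
  obtain ⟨g, hg, hg0, hg1, hgF⟩ := hF.arc k
  have h0 : 0 ≤ g t := by
    rw [← hg0]; exact hg.monotoneOn ⟨le_rfl, by linarith⟩ ht ht.1
  have h1 : g t ≤ 1 := by
    rw [← hg1]; exact hg.monotoneOn ht ⟨by linarith, le_rfl⟩ ht.2
  have h2 : (F (bdry t) - triVertex e i) / e i =
      ((1 - g t : ℝ) : ℂ) * ((triVertex e k - triVertex e i) / e i) +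
        (g t : ℂ) * ((triVertex e k + e k - triVertex e i) / e i) := by
    rw [hgF t ht]
    push_cast
    ring
  rw [h2, add_im, im_ofReal_mul, im_ofReal_mul]
  have := mul_nonneg (sub_nonneg.mpr h1) (hv k).1
  have := mul_nonneg h0 (hv k).2
  linarith

theorem im_eq_zero (h : IsTriangle e) (hF : IsTriangleMap e F) (i : Fin 3) {t : ℝ}
    (ht : t ∈ Icc ((i : ℕ) : ℝ) ((i : ℕ) + 1)) : ((F (bdry t) - triVertex e i) / e i).im = 0 := by
  obtain ⟨g, -, -, -, hgF⟩ := hF.arc i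
  rw [hgF t ht, add_sub_cancel_left, mul_div_assoc, div_self (h.ne_zero i)]
  simp

theorem mapsTo (h : IsTriangle e) (hF : IsTriangleMap e F) :
    MapsTo F (ball 0 1) (openTriangle e) := by
  intro w hw i
  have hre : ∀ z : ℂ, (-I * ((F z - triVertex e i) / e i)).re =
      ((F z - triVertex e i) / e i).im := fun z => by
    simp only [neg_mul, neg_re, mul_re, I_re, I_im]; ring
  rw [← hre]
  refine re_pos_of_re_nonneg_on_sphere (f := fun z => -I * ((F z - triVertex e i) / e i))
    (continuousOn_const.mul ((hF.cont.sub continuousOn_const).div_const _))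
    (DifferentiableOn.const_mul
      (((hF.diff.mono ball_subset_slitDomain).sub_const _).div_const _) _) ?_ ?_ hw
  · intro z hz
    rw [hre]
    exact hF.im_nonneg_of_bdry h i hz
  · refine ⟨marked (i + 2), by simp [norm_marked], ?_⟩
    rw [hre, hF.vertex]
    have c2 : triVertex e (i + 2) - triVertex e i = e i + e (i + 1) := by
      fin_cases i
      · simp [triVertex]
      · simp [triVertex]
        linear_combination -h.sum
      · simp [triVertex]
        linear_combination -h.sum
    rw [c2, add_div, div_self (h.ne_zero i)]
    simpa using h.im_div_pos i

theorem injOn (h : IsTriangle e) (hF : IsTriangleMap e F) : InjOn F (ball 0 1) := by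
  obtain ⟨β, κ, hd⟩ := h.exists_scData
  intro w₁ hw₁ w₂ hw₂ heq
  refine hd.injective_value hF.cont (hF.diff.mono ball_subset_slitDomain) (p := F w₂) ?_ hw₁ hw₂
    heq rfl
  intro i t ht
  have h1 := hF.im_eq_zero h i (Ioo_subset_Icc_self ht)
  have h2 := hF.mapsTo h hw₂ i
  have h3 : (F (bdry t) - F w₂) / e i * I = ((F (bdry t) - triVertex e i) / e i) * I -
      ((F w₂ - triVertex e i) / e i) * I := by ring
  rw [h3, sub_re, mul_I_re, mul_I_re, h1]
  linarith

theorem notMem_of_bdry (h : IsTriangle e) (hF : IsTriangleMap e F) {w : ℂ}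
    (hw : w ∈ sphere (0 : ℂ) 1) : F w ∉ openTriangle e := by
  intro hmem
  rcases sphere_cases hw with ⟨j, rfl⟩ | ⟨i, t, ht, rfl⟩
  · have := hmem j
    rw [hF.vertex, sub_self, zero_div, zero_im] at this
    exact lt_irrefl _ this
  · have := hmem i
    rw [hF.im_eq_zero h i (Ioo_subset_Icc_self ht)] at this
    exact lt_irrefl _ this

/-- The image of the open disc is open and, the boundary being mapped to the sides, relatively closed
in the open triangle, which is connected. -/
theorem image_ball (h : IsTriangle e) (hF : IsTriangleMap e F) :
    F '' ball 0 1 = openTriangle e := by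
  refine (hF.mapsTo h).image_subset.antisymm ?_
  have hd := hF.diff.mono ball_subset_slitDomain
  have hopen : IsOpen (F '' ball 0 1) := by
    rcases (hd.analyticOnNhd isOpen_ball).is_constant_or_isOpen
      (convex_ball _ _).isPreconnected with ⟨c, hc⟩ | ho
    · exfalso
      have hh : (1 / 2 : ℂ) ∈ ball (0 : ℂ) 1 := by norm_num
      have := hF.injOn h (mem_ball_self one_pos) hh
        (by rw [hc _ (mem_ball_self one_pos), hc _ hh])
      norm_num at this
    · exact ho _ Subset.rfl isOpen_ball
  refine (convex_openTriangle e).isPreconnected.subset_of_closure_inter_subset hopen ?_ ?_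
  · exact ⟨F 0, hF.mapsTo h (mem_ball_self one_pos), mem_image_of_mem _ (mem_ball_self one_pos)⟩
  · rintro p ⟨hp, hpt⟩
    have hcl : IsClosed (F '' closedBall 0 1) :=
      ((isCompact_closedBall (0 : ℂ) 1).image_of_continuousOn hF.cont).isClosed
    obtain ⟨w, hw, rfl⟩ := closure_minimal (image_mono ball_subset_closedBall) hcl hp
    rw [← ball_union_sphere] at hw
    rcases hw with hw | hw
    · exact mem_image_of_mem _ hw
    · exact absurd hpt (hF.notMem_of_bdry h hw)

end IsTriangleMap

theorem mem_openTriangle_iff {e : Fin 3 → ℂ} (h : IsTriangle e) (a b : ℝ) :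
    a * e 0 + b * e 1 ∈ openTriangle e ↔ 0 < b ∧ b < a ∧ a < 1 := by
  have hp := h.pos
  have hn : ∀ i, 0 < normSq (e i) := fun i => normSq_pos.mpr (h.ne_zero i)
  set J := ((starRingEnd ℂ) (e 0) * e 1).im with hJ
  have c0 : ((starRingEnd ℂ) (e 0) * (a * e 0 + b * e 1 - triVertex e 0)).im = b * J := by
    rw [hJ]; simp [triVertex]; ring
  have c1 : ((starRingEnd ℂ) (e 1) * (a * e 0 + b * e 1 - triVertex e 1)).im = (1 - a) * J := by
    rw [hJ]; simp [triVertex]; ring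
  have c2 : ((starRingEnd ℂ) (e 2) * (a * e 0 + b * e 1 - triVertex e 2)).im = (a - b) * J := by
    rw [hJ, h.e_two]; simp [triVertex]; ring
  simp only [openTriangle, mem_ofPred_eq, Fin.forall_fin_succ, im_div_eq]
  simp only [Fin.isValue, Fin.succ_zero_eq_one, Fin.succ_one_eq_two, IsEmpty.forall_iff, and_true,
    div_pos_iff_of_pos_right (hn _), c0, c1, c2, mul_pos_iff_of_pos_right hp, sub_pos]
  tauto

theorem volume_standard_triangle :
    MeasureTheory.volume {z : ℂ | 0 < z.im ∧ z.im < z.re ∧ z.re < 1} = ENNReal.ofReal (1 / 2) := by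
  have h1 : {z : ℂ | 0 < z.im ∧ z.im < z.re ∧ z.re < 1} =
      measurableEquivRealProd ⁻¹' regionBetween (fun _ => 0) (fun x => x) (Ioo 0 1) := by
    ext z
    simp only [regionBetween, mem_ofPred_eq, mem_preimage, measurableEquivRealProd_apply, mem_Ioo]
    constructor
    · rintro ⟨h1, h2, h3⟩
      exact ⟨⟨by linarith, h3⟩, h1, h2⟩
    · rintro ⟨⟨-, h3⟩, h1, h2⟩
      exact ⟨h1, h2, h3⟩
  have hm : MeasurableSet (regionBetween (fun _ => (0 : ℝ)) (fun x => x) (Ioo 0 1)) :=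
    measurableSet_regionBetween measurable_const measurable_id measurableSet_Ioo
  rw [h1, volume_preserving_equiv_real_prod.measure_preimage hm.nullMeasurableSet,
    MeasureTheory.Measure.volume_eq_prod, volume_regionBetween_eq_integral
      (by simp) ?_ measurableSet_Ioo (fun x hx => hx.1.le)]
  · congr 1
    rw [← MeasureTheory.integral_Ioc_eq_integral_Ioo, ← intervalIntegral.integral_of_le zero_le_one]
    simp
  · exact (continuous_id.integrableOn_Icc (a := (0 : ℝ)) (b := 1)).mono_set Ioo_subset_Icc_self

theorem volume_openTriangle {e : Fin 3 → ℂ} (h : IsTriangle e) :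
    MeasureTheory.volume.real (openTriangle e) = ((starRingEnd ℂ) (e 0) * e 1).im / 2 := by
  set M : ℂ →ₗ[ℝ] ℂ := reLm.smulRight (e 0) + imLm.smulRight (e 1) with hM
  have hMa : ∀ z, M z = z.re * e 0 + z.im * e 1 := fun z => by simp [hM]
  have hdet : LinearMap.det M = ((starRingEnd ℂ) (e 0) * e 1).im := by
    rw [← LinearMap.det_toMatrix basisOneI, Matrix.det_fin_two]
    simp [LinearMap.toMatrix_apply, hMa]
    ring
  have hsurj : ∀ p : ℂ, ∃ z, M z = p := by
    have : IsUnit (LinearMap.det M) := by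
      rw [hdet]; exact h.pos.ne'.isUnit
    exact fun p => ((LinearEquiv.ofIsUnitDet (f := M) (v := basisOneI) (v' := basisOneI)
      (by rwa [LinearMap.det_toMatrix])).surjective p)
  have himg : openTriangle e = M '' {z : ℂ | 0 < z.im ∧ z.im < z.re ∧ z.re < 1} := by
    ext p
    obtain ⟨z, rfl⟩ := hsurj p
    constructor
    · intro hp
      rw [hMa, mem_openTriangle_iff h] at hp
      exact mem_image_of_mem _ hp
    · rintro ⟨z', hz', hzz⟩
      rw [← hzz, hMa, mem_openTriangle_iff h]
      exact hz'
  rw [MeasureTheory.measureReal_def, himg, MeasureTheory.Measure.addHaar_image_linearMap,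
    volume_standard_triangle, hdet, ENNReal.toReal_mul, ENNReal.toReal_ofReal (abs_nonneg _),
    ENNReal.toReal_ofReal (by norm_num), abs_of_pos h.pos]
  ring

/-- The Jacobian of an injective holomorphic map integrates to the area of the image. -/
theorem IsTriangleMap.integral_det {e : Fin 3 → ℂ} {F : ℂ → ℂ} (h : IsTriangle e)
    (hF : IsTriangleMap e F) :
    ∫ w in ball (0 : ℂ) 1, (fderiv ℝ F w).det = ((starRingEnd ℂ) (e 0) * e 1).im / 2 := by
  have hd := hF.diff.mono ball_subset_slitDomain
  have hda : ∀ w ∈ ball (0 : ℂ) 1, DifferentiableAt ℂ F w := fun w hw =>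
    hd.differentiableAt (isOpen_ball.mem_nhds hw)
  have hdet : ∀ w ∈ ball (0 : ℂ) 1, |(fderiv ℝ F w).det| = (fderiv ℝ F w).det := by
    intro w hw
    refine abs_of_nonneg ?_
    rw [(hda w hw).fderiv_restrictScalars ℝ]
    have : ((fderiv ℂ F w).restrictScalars ℝ).det =
        LinearMap.det (((fderiv ℂ F w : ℂ →L[ℂ] ℂ) : ℂ →ₗ[ℂ] ℂ).restrictScalars ℝ) := rfl
    rw [this, LinearMap.det_restrictScalars, Algebra.norm_complex_eq]
    exact normSq_nonneg _
  have key := MeasureTheory.integral_image_eq_integral_abs_det_fderiv_smul MeasureTheory.volume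
    (measurableSet_ball (x := (0 : ℂ)) (ε := 1)) (f := F) (f' := fun w => fderiv ℝ F w)
    (fun w hw => ((hda w hw).restrictScalars ℝ).hasFDerivAt.hasFDerivWithinAt) (hF.injOn h)
    (fun _ => (1 : ℝ))
  rw [hF.image_ball h] at key
  simp only [MeasureTheory.integral_const, smul_eq_mul, mul_one,
    MeasureTheory.measureReal_restrict_apply_univ] at key
  rw [volume_openTriangle h] at key
  rw [key]
  exact MeasureTheory.setIntegral_congr_fun measurableSet_ball fun w hw => (hdet w hw).symm

/-! ### Classification of the holomorphic triangles -/

/-- The sides of the model triangle, on lines of slopes `0, -q, -(q + p)`. -/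
def modelSides (q p : ℤ) : Fin 3 → ℂ := ![p, -(q + p) * (1 - q * I), q * (1 - (q + p) * I)]

theorem isTriangle_modelSides {q p : ℤ} (hq : 0 < q) (hp : 0 < p) :
    IsTriangle (modelSides q p) := by
  have hq' : (0 : ℝ) < q := by exact_mod_cast hq
  have hp' : (0 : ℝ) < p := by exact_mod_cast hp
  refine ⟨?_, ?_⟩
  · simp [modelSides]
    ring
  · have : ((starRingEnd ℂ) (modelSides q p 0) * modelSides q p 1).im = p * (q + p) * q := by
      simp [modelSides]
      ring
    rw [this]
    positivity

theorem exists_modelMap (q p : ℤ) :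
    ∃ F : ℂ → ℂ, 0 < q → 0 < p → IsTriangleMap (modelSides q p) F := by
  by_cases h : 0 < q ∧ 0 < p
  · obtain ⟨F, hF⟩ := (isTriangle_modelSides h.1 h.2).exists_map
    exact ⟨F, fun _ _ => hF⟩
  · exact ⟨0, fun h1 h2 => absurd ⟨h1, h2⟩ h⟩

/-- The conformal map from the disc to the model triangle; it is of interest only for `0 < q` and
`0 < p`. -/
def modelMap (q p : ℤ) : ℂ → ℂ := Classical.choose (exists_modelMap q p)

theorem isTriangleMap_modelMap {q p : ℤ} (hq : 0 < q) (hp : 0 < p) :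
    IsTriangleMap (modelSides q p) (modelMap q p) :=
  Classical.choose_spec (exists_modelMap q p) hq hp

theorem coe_eq_zero_iff_exists_int {r : ℝ} : (r : UnitAddCircle) = 0 ↔ ∃ n : ℤ, r = n := by
  rw [AddCircle.coe_eq_zero_iff]
  simp [eq_comm]

theorem coe_eq_coe_iff_exists_int {r r' : ℝ} :
    (r : UnitAddCircle) = r' ↔ ∃ n : ℤ, r = r' + n := by
  rw [← sub_eq_zero, ← AddCircle.coe_sub, coe_eq_zero_iff_exists_int]
  simp [sub_eq_iff_eq_add']

theorem toTorus_mem_lagr {k : ℤ} {z : ℂ} : toTorus z ∈ lagr k ↔ ∃ n : ℤ, z.im + k * z.re = n := by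
  rw [mem_lagr, toTorus, ← coe_eq_zero_iff_exists_int, AddCircle.coe_add, ← zsmul_eq_mul,
    AddCircle.coe_zsmul, eq_neg_iff_add_eq_zero]

theorem toTorus_eq_iff {z w : ℂ} : toTorus z = toTorus w ↔ ∃ j l : ℤ, z = w + j + l * I := by
  rw [toTorus, toTorus, Prod.mk.injEq, coe_eq_coe_iff_exists_int, coe_eq_coe_iff_exists_int]
  constructor
  · rintro ⟨⟨j, hj⟩, l, hl⟩
    exact ⟨j, l, Complex.ext (by simpa using hj) (by simpa using hl)⟩
  · rintro ⟨j, l, rfl⟩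
    exact ⟨⟨j, by simp⟩, l, by simp⟩

theorem toTorus_add (z w : ℂ) : toTorus (z + w) = toTorus z + toTorus w := rfl

theorem eqOn_const_of_int_valued {X : Type*} [TopologicalSpace X] {S : Set X}
    (hS : IsPreconnected S) {f : X → ℝ} (hf : ContinuousOn f S) (hint : ∀ t ∈ S, ∃ n : ℤ, f t = n)
    {x y : X} (hx : x ∈ S) (hy : y ∈ S) : f x = f y := by
  have hd : DiscreteTopology (range ((↑) : ℤ → ℝ)) :=
    Int.isClosedEmbedding_coe_real.isEmbedding.toHomeomorph.symm.isEmbedding.discreteTopology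
  exact hS.constant_of_mapsTo (T := range ((↑) : ℤ → ℝ)) ⟨hd⟩ hf
    (fun t ht => by obtain ⟨n, hn⟩ := hint t ht; exact ⟨n, hn.symm⟩) hx hy

/-- On `L_(0)`, a lift of the first coordinate of a point, as a real number, is a lift of the point. -/
theorem fst_eq_of_mem {p : Torus} (h : p ∈ lagr 0) {r : ℝ} (hr : (r : UnitAddCircle) = p.1) :
    toTorus r = p := by
  rw [mem_lagr, zero_smul, neg_zero] at h
  exact Prod.ext (by simpa [toTorus] using hr) (by simp [toTorus, h])

namespace HolTriangle

variable {q p m : ℤ} {y x₁ x₂ : Torus}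

theorem continuousOn_lift (u : HolTriangle 0 q m y x₁ x₂) :
    ContinuousOn u.lift (closedBall 0 1) := (Classical.choose_spec u.hol).2.1

theorem differentiableOn_lift (u : HolTriangle 0 q m y x₁ x₂) :
    DifferentiableOn ℂ u.lift (ball 0 1) := (Classical.choose_spec u.hol).2.2.1

/-- The lift of a side runs along a line, since the linear function that defines the Lagrangian takes
integer values on it. -/
theorem lift_side (u : HolTriangle 0 q m y x₁ x₂) {k : ℤ} {i : ℝ}
    (h : ∀ t ∈ Icc i (i + 1), u.map (bdry t) ∈ lagr k) {t : ℝ} (ht : t ∈ Icc i (i + 1)) :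
    (u.lift (bdry t)).im + k * (u.lift (bdry t)).re =
      (u.lift (bdry i)).im + k * (u.lift (bdry i)).re := by
  have hc : ContinuousOn (fun t => u.lift (bdry t)) (Icc i (i + 1)) :=
    u.continuousOn_lift.comp (continuous_subtype_val.comp continuous_bdry).continuousOn
      fun t _ => (bdry t).2
  refine eqOn_const_of_int_valued
    (f := fun t => (u.lift (bdry t)).im + k * (u.lift (bdry t)).re) (isPreconnected_Icc) ?_ ?_ ht
    ⟨le_rfl, by linarith⟩
  · exact (continuous_im.comp_continuousOn hc).add
      (continuousOn_const.mul (continuous_re.comp_continuousOn hc))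
  · intro t ht
    rw [← toTorus_mem_lagr, u.toTorus_lift]
    exact h t ht

/-- The scale of a triangle relative to the model triangle, read off from the side on `L_(0)`; it is
zero for the constant triangles, and negative for those turned by half a turn. -/
def scale (p : ℤ) (u : HolTriangle 0 q m y x₁ x₂) : ℝ := u.shift 0 / p

/-- Every holomorphic triangle lifts to a rescaled and translated copy of the model triangle. -/
theorem lift_eq (hq : 0 < q) (hp : 0 < p) (hm : m = q + p) (u : HolTriangle 0 q m y x₁ x₂) {w : ℂ}
    (hw : w ∈ closedBall (0 : ℂ) 1) :
    u.lift w = u.lift 1 + u.scale p * modelMap q p w := by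
  have hq' : (0 : ℝ) < q := by exact_mod_cast hq
  have hp' : (0 : ℝ) < p := by exact_mod_cast hp
  have hm' : (m : ℝ) = q + p := by exact_mod_cast hm
  have hT := isTriangle_modelSides hq hp
  have hF := isTriangleMap_modelMap hq hp
  obtain ⟨β, κ, hd⟩ := hT.exists_scData
  set L := u.scale p with hL
  have s0 := fun t ht => u.lift_side (k := 0) (i := 0) (by simpa using u.side₀) (t := t) ht
  have s1 := fun t ht => u.lift_side (k := q) (i := 1)
    (by norm_num; exact fun t h1 h2 => u.side₁ t ⟨h1, h2⟩) (t := t) ht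
  have s2 := fun t ht => u.lift_side (k := m) (i := 2)
    (by norm_num; exact fun t h1 h2 => u.side₂ t ⟨h1, h2⟩) (t := t) ht
  norm_num at s0 s1 s2
  have b0 : (bdry 0 : ℂ) = 1 := coe_bdry_zero
  have b3 : (bdry 3 : ℂ) = 1 := coe_bdry_three
  have hL0 : (u.lift (bdry 1)).re - (u.lift 1).re = L * p := by
    rw [hL, scale, shift, zero_add, b0]
    field_simp
  have e0 := s0 1 (by norm_num) (by norm_num)
  have e1 := s1 2 (by norm_num) (by norm_num)
  have e2 := s2 3 (by norm_num) (by norm_num)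
  rw [b0] at e0
  rw [b3] at e2
  rw [hm'] at e2
  have hr2 : (u.lift (bdry 2)).re = (u.lift 1).re - L * q := by
    have : p * (u.lift (bdry 2)).re = p * ((u.lift 1).re - L * q) := by
      linear_combination -e1 - e2 - e0 - q * hL0
    exact mul_left_cancel₀ hp'.ne' this
  have hv1 : u.lift (bdry 1) = u.lift 1 + L * triVertex (modelSides q p) 1 := by
    apply Complex.ext
    · simp [triVertex, modelSides]
      linarith
    · simp [triVertex, modelSides]
      linarith
  have hv2 : u.lift (bdry 2) = u.lift 1 + L * triVertex (modelSides q p) 2 := by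
    apply Complex.ext
    · simp [triVertex, modelSides]
      linarith
    · simp [triVertex, modelSides]
      rw [hr2] at e1 e2
      linear_combination -e2
  have hv0 : u.lift (bdry 0) = u.lift 1 + L * triVertex (modelSides q p) 0 := by
    simp [triVertex, b0]
  have key := hd.eq_zero (V := fun w => u.lift w - (u.lift 1 + L * modelMap q p w))
    (u.continuousOn_lift.sub (continuousOn_const.add (continuousOn_const.mul hF.cont)))
    (u.differentiableOn_lift.sub
      ((((hF.diff.mono ball_subset_slitDomain)).const_mul _).const_add _)) (by
    have aux : ∀ i : Fin 3, u.lift (marked i) = u.lift 1 + L * triVertex (modelSides q p) i := by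
      intro i
      fin_cases i
      · simpa [marked] using hv0
      · simpa [marked] using hv1
      · simpa [marked] using hv2
    have aux2 : ∀ i : Fin 3, ∀ t ∈ Ioo ((i : ℕ) : ℝ) ((i : ℕ) + 1), ∃ ρ : ℝ,
        u.lift (bdry t) - u.lift (marked i) = ρ * modelSides q p i := by
      intro i t ht
      fin_cases i
      · simp at ht
        refine ⟨((u.lift (bdry t)).re - (u.lift 1).re) / p, ?_⟩
        have := s0 t ht.1.le ht.2.le
        rw [b0] at this
        apply Complex.ext
        · simp [marked, modelSides, b0]
          field_simp
        · simp [marked, modelSides, b0, this]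
      · norm_num at ht
        obtain ⟨ρ, hρ⟩ : ∃ ρ : ℝ, ρ * (q + p) =
            -((u.lift (bdry t)).re - (u.lift (bdry 1)).re) :=
          ⟨_, div_mul_cancel₀ _ (by positivity)⟩
        refine ⟨ρ, ?_⟩
        have := s1 t ht.1.le ht.2.le
        apply Complex.ext
        · simp [marked, modelSides]
          linear_combination hρ
        · simp [marked, modelSides]
          linear_combination this - q * hρ
      · norm_num at ht
        refine ⟨((u.lift (bdry t)).re - (u.lift (bdry 2)).re) / q, ?_⟩
        have := s2 t ht.1.le ht.2.le
        rw [hm'] at this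
        apply Complex.ext
        · simp [marked, modelSides]
          field_simp
        · simp [marked, modelSides]
          field_simp
          linear_combination this
    intro i t ht
    obtain ⟨ρ, hρ⟩ := aux2 i t ht
    obtain ⟨g, -, -, -, hg⟩ := hF.arc i
    refine ⟨ρ - L * g t, ?_⟩
    rw [hg t (Ioo_subset_Icc_self ht)]
    push_cast
    linear_combination hρ + aux i) hw
  exact sub_eq_zero.mp key

/-- The displacements of the first coordinate along the sides. -/
theorem shift_eq (hq : 0 < q) (hp : 0 < p) (hm : m = q + p) (u : HolTriangle 0 q m y x₁ x₂) :
    u.shift 0 = u.scale p * p ∧ u.shift 1 = -(u.scale p * m) ∧ u.shift 2 = u.scale p * q := by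
  have hF := isTriangleMap_modelMap hq hp
  have v0 := hF.vertex 0
  have v1 := hF.vertex 1
  have v2 := hF.vertex 2
  simp [marked, triVertex, modelSides] at v0 v1 v2
  have hm' : (m : ℝ) = q + p := by exact_mod_cast hm
  have l0 := congrArg re (u.lift_eq hq hp hm (bdry 0).2)
  have l1 := congrArg re (u.lift_eq hq hp hm (bdry 1).2)
  have l2 := congrArg re (u.lift_eq hq hp hm (bdry 2).2)
  rw [v0] at l0
  rw [v1] at l1
  rw [v2] at l2
  simp at l0 l1 l2
  have h3 : bdry (2 + 1) = bdry 0 := by norm_num; exact bdry_three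
  have h2 : bdry (1 + 1) = bdry 2 := by norm_num
  refine ⟨?_, ?_, ?_⟩
  · rw [shift, zero_add, l0, l1]; ring
  · rw [shift, h2, l1, l2, hm']; ring
  · rw [shift, h3, l0, l2]; ring

/-- The triangle is determined by a lift `r` of its corner `y` and by its scale. -/
theorem map_eq (hq : 0 < q) (hp : 0 < p) (hm : m = q + p) (u : HolTriangle 0 q m y x₁ x₂) {r : ℝ}
    (hy : toTorus r = y) (w : Disc) :
    u.map w = toTorus (r + u.scale p * modelMap q p w) := by
  have h1 : toTorus (u.lift 1) = y := by
    have h := u.toTorus_lift (bdry 0)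
    rw [coe_bdry_zero] at h
    exact h.trans u.corner₀
  rw [← u.toTorus_lift, u.lift_eq hq hp hm w.2, toTorus_add, toTorus_add, h1, hy]

theorem eq_of_map_eq {u v : HolTriangle 0 q m y x₁ x₂} (h : u.map = v.map) : u = v := by
  cases u; cases v; simp only at h; subst h; rfl

/-- The triangle with given corners, a given lift `r` of its corner `y` and given scale. -/
theorem exists_of_scale (hq : 0 < q) (hp : 0 < p) (hm : m = q + p) (hy : y ∈ lagr 0 ∩ lagr m)
    (h₁ : x₁ ∈ lagr 0 ∩ lagr q) (h₂ : x₂ ∈ lagr q ∩ lagr m) {r L : ℝ}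
    (hyr : (r : UnitAddCircle) = y.1) (h₁r : ((r + L * p : ℝ) : UnitAddCircle) = x₁.1)
    (h₂r : ((r - L * q : ℝ) : UnitAddCircle) = x₂.1) :
    ∃ u : HolTriangle 0 q m y x₁ x₂, u.scale p = L := by
  have hq' : (0 : ℝ) < q := by exact_mod_cast hq
  have hp' : (0 : ℝ) < p := by exact_mod_cast hp
  have hm' : (m : ℝ) = q + p := by exact_mod_cast hm
  have hF := isTriangleMap_modelMap hq hp
  set U : ℂ → ℂ := fun w => r + L * modelMap q p w with hU
  have v0 := hF.vertex 0
  have v1 := hF.vertex 1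
  have v2 := hF.vertex 2
  simp [marked, triVertex, modelSides] at v0 v1 v2
  have hyT := fst_eq_of_mem hy.1 hyr
  have h₁T := fst_eq_of_mem h₁.1 h₁r
  obtain ⟨n₁, hn₁⟩ : ∃ n : ℤ, q * (r + L * p) = n := by
    have := h₁.2
    rw [← h₁T, toTorus_mem_lagr] at this
    simpa using this
  obtain ⟨n₂, hn₂⟩ : ∃ n : ℤ, m * r = n := by
    have := hy.2
    rw [← hyT, toTorus_mem_lagr] at this
    simpa using this
  have side : ∀ (i : Fin 3) (k n : ℤ) (_ : (U (marked i)).im + k * (U (marked i)).re = n)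
      (_ : (modelSides q p i).im + k * (modelSides q p i).re = 0),
      ∀ t ∈ Icc ((i : ℕ) : ℝ) ((i : ℕ) + 1), toTorus (U (bdry t)) ∈ lagr k := by
    intro i k n h1 h2 t ht
    obtain ⟨g, -, -, -, hg⟩ := hF.arc i
    rw [toTorus_mem_lagr]
    refine ⟨n, ?_⟩
    simp only [hU] at h1 ⊢
    rw [hF.vertex] at h1
    rw [hg t ht, ← h1]
    simp
    linear_combination L * g t * h2
  let u : HolTriangle 0 q m y x₁ x₂ :=
    { map := fun w => toTorus (U w)
      hol := ⟨U, fun w => rfl, continuousOn_const.add (continuousOn_const.mul hF.cont),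
        ((hF.diff.mono ball_subset_slitDomain).const_mul _).const_add _, by
          refine contDiffOn_const.add (contDiffOn_const.mul (hF.contDiffOn.mono ?_))
          rintro w ⟨hw, hw'⟩
          refine mem_slitDomain hw fun j hj => hw' ?_
          rw [hj]
          fin_cases j <;> simp [marked]⟩
      corner₀ := by
        simp only [hU, v0, mul_zero, add_zero]
        exact hyT
      corner₁ := by
        simp only [hU, v1]
        rw [← h₁T]
        push_cast
        rfl
      corner₂ := by
        have h3 := h₂.1
        rw [mem_lagr] at h3
        simp only [hU, v2]
        refine Prod.ext ?_ ?_
        · rw [← h₂r]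
          simp only [toTorus]
          congr 1
          simp
          ring
        · rw [h3, ← h₂r, ← AddCircle.coe_zsmul, ← AddCircle.coe_neg]
          simp only [toTorus]
          rw [coe_eq_coe_iff_exists_int]
          refine ⟨n₁, ?_⟩
          rw [← hn₁]
          simp
          ring
      side₀ := by
        have := side 0 0 0 (by simp [marked, hU, v0]) (by simp [modelSides])
        simpa using this
      side₁ := by
        have := side 1 q n₁ (by simp [marked, hU, v1]; linarith) (by simp [modelSides]; ring)
        norm_num at this
        simpa using this
      side₂ := by
        have := side 2 m n₂ (by simp [marked, hU, v2, ← hn₂, hm']; ring)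
          (by simp [modelSides, hm']; ring)
        norm_num at this
        simpa using this }
  refine ⟨u, ?_⟩
  -- two lifts of the same map differ by a constant
  have hconst : ∀ w ∈ closedBall (0 : ℂ) 1, (u.lift w).re - (U w).re = (u.lift 1).re - (U 1).re := by
    intro w hw
    refine eqOn_const_of_int_valued (f := fun w => (u.lift w).re - (U w).re)
      (convex_closedBall (0 : ℂ) 1).isPreconnected ?_ ?_ hw (by simp)
    · exact (continuous_re.comp_continuousOn u.continuousOn_lift).sub
        (continuous_re.comp_continuousOn (continuousOn_const.add (continuousOn_const.mul hF.cont)))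
    · intro w hw
      have h1 := u.toTorus_lift ⟨w, hw⟩
      have h2 : toTorus (u.lift w) = toTorus (U w) := h1
      obtain ⟨j, l, h3⟩ := toTorus_eq_iff.mp h2
      exact ⟨j, by rw [h3]; simp⟩
  have h1 := hconst _ (bdry 1).2
  have b0 : (bdry 0 : ℂ) = 1 := coe_bdry_zero
  rw [scale, shift, zero_add, b0, div_eq_iff hp'.ne']
  rw [b0] at v0
  simp only [hU] at h1
  rw [v0, v1] at h1
  simp at h1
  linarith

end HolTriangle

/-! ### Areas and signs of the triangles -/

namespace HolTriangle

variable {q p m : ℤ} {y x₁ x₂ : Torus}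

theorem area_eq (hq : 0 < q) (hp : 0 < p) (hm : m = q + p) (u : HolTriangle 0 q m y x₁ x₂) :
    u.area = u.scale p ^ 2 * (q * p * m) / 2 := by
  have hT := isTriangle_modelSides hq hp
  have hF := isTriangleMap_modelMap hq hp
  have hm' : (m : ℝ) = q + p := by exact_mod_cast hm
  have hJ : ((starRingEnd ℂ) (modelSides q p 0) * modelSides q p 1).im = p * (q + p) * q := by
    simp [modelSides]
    ring
  have hd := (hF.diff.mono ball_subset_slitDomain)
  have hf : ∀ w ∈ ball (0 : ℂ) 1,
      (fderiv ℝ u.lift w).det = u.scale p ^ 2 * (fderiv ℝ (modelMap q p) w).det := by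
    intro w hw
    have h1 : u.lift =ᶠ[𝓝 w] fun z => u.lift 1 + u.scale p • modelMap q p z := by
      filter_upwards [isOpen_ball.mem_nhds hw] with z hz
      rw [u.lift_eq hq hp hm (ball_subset_closedBall hz), real_smul]
    have h2 : DifferentiableAt ℝ (modelMap q p) w :=
      (hd.differentiableAt (isOpen_ball.mem_nhds hw)).restrictScalars ℝ
    rw [h1.fderiv_eq, fderiv_const_add, fderiv_fun_const_smul h2]
    have : (u.scale p • fderiv ℝ (modelMap q p) w).det =
        LinearMap.det (u.scale p • ((fderiv ℝ (modelMap q p) w : ℂ →L[ℝ] ℂ) : ℂ →ₗ[ℝ] ℂ)) := rfl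
    rw [this, LinearMap.det_smul, finrank_real_complex]
  rw [area, MeasureTheory.setIntegral_congr_fun measurableSet_ball hf,
    MeasureTheory.integral_const_mul, hF.integral_det hT, hJ, hm']
  ring

/-- The boundary of the model triangle consists of two arcs that project bijectively to the same
interval of the real axis. -/
theorem injOn_re_modelMap (hq : 0 < q) (hp : 0 < p) :
    InjOn (fun t => (modelMap q p (bdry t)).re) (Icc 2 4) ∧
    (fun t => (modelMap q p (bdry t)).re) '' Icc 2 4 = Icc (-q : ℝ) p ∧
    InjOn (fun t => (modelMap q p (bdry t)).re) (Icc 1 2) ∧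
    (fun t => (modelMap q p (bdry t)).re) '' Icc 1 2 = Icc (-q : ℝ) p := by
  have hq' : (0 : ℝ) < q := by exact_mod_cast hq
  have hp' : (0 : ℝ) < p := by exact_mod_cast hp
  have hF := isTriangleMap_modelMap hq hp
  set f : ℝ → ℝ := fun t => (modelMap q p (bdry t)).re with hf
  have hfc : Continuous f := by
    refine continuous_re.comp ?_
    exact hF.cont.comp_continuous (continuous_subtype_val.comp continuous_bdry) fun t => (bdry t).2
  have hper : ∀ t, f (t + 3) = f t := fun t => by simp only [hf, bdry_add_three]
  have v0 := congrArg re (hF.vertex 0)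
  have v1 := congrArg re (hF.vertex 1)
  have v2 := congrArg re (hF.vertex 2)
  simp [marked, triVertex, modelSides] at v0 v1 v2
  have f0 : f 0 = 0 := v0
  have f1 : f 1 = p := v1
  have f2 : f 2 = -q := by rw [hf]; simp only; rw [v2]
  have f4 : f 4 = p := by rw [← f1, ← hper 1]; norm_num
  obtain ⟨g0, m0, -, -, h0⟩ := hF.arc 0
  obtain ⟨g1, m1, -, -, h1⟩ := hF.arc 1
  obtain ⟨g2, m2, -, -, h2⟩ := hF.arc 2
  norm_num at m0 m1 m2 h0 h1 h2
  have k0 : StrictMonoOn f (Icc 0 1) := by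
    intro a ha b hb hab
    have := m0 ha hb hab
    simp only [hf]
    rw [h0 a ha.1 ha.2, h0 b hb.1 hb.2]
    simp [modelSides]
    nlinarith
  have k1 : StrictAntiOn f (Icc 1 2) := by
    intro a ha b hb hab
    have := m1 ha hb hab
    simp only [hf]
    rw [h1 a ha.1 ha.2, h1 b hb.1 hb.2]
    simp [modelSides]
    nlinarith
  have k2 : StrictMonoOn f (Icc 2 3) := by
    intro a ha b hb hab
    have := m2 ha hb hab
    simp only [hf]
    rw [h2 a ha.1 ha.2, h2 b hb.1 hb.2]
    simp [modelSides]
    nlinarith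
  have k3 : StrictMonoOn f (Icc 3 4) := by
    intro a ha b hb hab
    have e : ∀ t, f t = f (t - 3) := fun t => by rw [← hper (t - 3), sub_add_cancel]
    rw [e a, e b]
    exact k0 ⟨by linarith [ha.1], by linarith [ha.2]⟩ ⟨by linarith [hb.1], by linarith [hb.2]⟩
      (by linarith)
  have k : StrictMonoOn f (Icc 2 4) := by
    have := k2.union k3 (c := 3) (isGreatest_Icc (by norm_num)) (isLeast_Icc (by norm_num))
    rwa [Icc_union_Icc_eq_Icc (by norm_num) (by norm_num)] at this
  refine ⟨k.injOn, ?_, k1.injOn, ?_⟩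
  · apply Subset.antisymm
    · rintro _ ⟨t, ht, rfl⟩
      have a1 := k.monotoneOn ⟨le_rfl, by norm_num⟩ ht ht.1
      have a2 := k.monotoneOn ht ⟨by norm_num, le_rfl⟩ ht.2
      rw [f2] at a1
      rw [f4] at a2
      exact ⟨a1, a2⟩
    · have := intermediate_value_Icc (a := 2) (b := 4) (by norm_num) hfc.continuousOn
      rwa [f2, f4] at this
  · apply Subset.antisymm
    · rintro _ ⟨t, ht, rfl⟩
      have a1 := k1.antitoneOn ht ⟨by norm_num, le_rfl⟩ ht.2
      have a2 := k1.antitoneOn ⟨le_rfl, by norm_num⟩ ht ht.1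
      rw [f2] at a1
      rw [f1] at a2
      exact ⟨a1, a2⟩
    · have := intermediate_value_Icc' (a := 1) (b := 2) (by norm_num) hfc.continuousOn
      rwa [f2, f1] at this

theorem injOn_bdry_of_length_lt {a b : ℝ} (h : b - a < 3) : InjOn bdry (Icc a b) := by
  intro s hs t ht hst
  refine sub_lt_three_of_bdry_eq hst ?_
  rw [abs_lt]
  constructor <;> linarith [hs.1, hs.2, ht.1, ht.2]

theorem not_torsion_of_irrational {ε : ℝ} (hε : Irrational ε) {k : ℤ} (hk : k ≠ 0)
    (h : k • (ε : UnitAddCircle) = 0) : False := by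
  rw [← AddCircle.coe_zsmul, coe_eq_zero_iff_exists_int] at h
  obtain ⟨n, hn⟩ := h
  rw [zsmul_eq_mul] at hn
  exact (hε.intCast_mul hk).ne_int n hn

theorem zsmul_fst_eq_zero {k l : ℤ} {x : Torus} (h : x ∈ lagr k ∩ lagr l) :
    (l - k) • x.1 = 0 := by
  have h1 := mem_lagr.mp h.1
  have h2 := mem_lagr.mp h.2
  rw [h1, neg_inj] at h2
  rw [sub_smul, h2, sub_self]

/-- The number of stars on the boundary of a triangle is even, since the stars are the boundary
points over `ε` and the boundary crosses each vertical line twice. -/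
theorem sign_eq_one {ε : ℝ} (hε : Irrational ε) (hq : 0 < q) (hp : 0 < p) (hm : m = q + p)
    (u : HolTriangle 0 q m y x₁ x₂) : u.sign ε = 1 := by
  have hF := isTriangleMap_modelMap hq hp
  obtain ⟨inj₁, im₁, inj₂, im₂⟩ := injOn_re_modelMap hq hp
  set S : Set Disc := {w : Disc | ‖(w : ℂ)‖ = 1 ∧
    (u.map w = starPoint ε 0 ∨ u.map w = starPoint ε q ∨ u.map w = starPoint ε m)} with hS
  set A : Set ℝ := {c | (((u.lift 1).re + u.scale p * c : ℝ) : UnitAddCircle) = ε} with hA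
  have hmapc : ∀ w, u.map w = toTorus (u.lift 1 + u.scale p * modelMap q p w) := fun w => by
    rw [← u.toTorus_lift, u.lift_eq hq hp hm w.2]
  have hfst : ∀ w, (u.map w).1 = (ε : UnitAddCircle) ↔ (modelMap q p w).re ∈ A := by
    intro w
    rw [hmapc]
    simp [toTorus, hA]
  have star_of : ∀ {k : ℤ} {x : Torus}, x ∈ lagr k → x.1 = (ε : UnitAddCircle) →
      x = starPoint ε k := by
    intro k x hx h
    rw [mem_lagr, h] at hx
    refine Prod.ext h ?_
    rw [hx, starPoint, AddCircle.coe_neg, ← zsmul_eq_mul, AddCircle.coe_zsmul]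
  -- no corner lies over `ε`, as the corners have rational coordinates
  have hc₁ : bdry 1 ∈ {w | (u.map w).1 = (ε : UnitAddCircle)} → False := by
    intro h
    have h1 := zsmul_fst_eq_zero ⟨u.side₀ 1 (by norm_num), u.side₁ 1 (by norm_num)⟩
    rw [h, sub_zero] at h1
    exact not_torsion_of_irrational hε hq.ne' h1
  have hc₂ : bdry 2 ∈ {w | (u.map w).1 = (ε : UnitAddCircle)} → False := by
    intro h
    have h1 := zsmul_fst_eq_zero ⟨u.side₁ 2 (by norm_num), u.side₂ 2 (by norm_num)⟩
    rw [h] at h1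
    exact not_torsion_of_irrational hε (by omega) h1
  -- the stars over the two arcs
  set T : Set ℝ → Set Disc := fun J =>
    bdry '' (J ∩ (fun t => (modelMap q p (bdry t)).re) ⁻¹' A) with hT
  have hcard : ∀ J : Set ℝ, InjOn bdry J → InjOn (fun t => (modelMap q p (bdry t)).re) J →
      (fun t => (modelMap q p (bdry t)).re) '' J = Icc (-q : ℝ) p →
      (T J).ncard = (Icc (-q : ℝ) p ∩ A).ncard := by
    intro J h1 h2 h3
    rw [hT, (h1.mono inter_subset_left).ncard_image,
      ← (h2.mono inter_subset_left).ncard_image, image_inter_preimage, h3]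
  have n₁ := hcard _ (injOn_bdry_of_length_lt (by norm_num)) inj₁ im₁
  have n₂ := hcard _ (injOn_bdry_of_length_lt (by norm_num)) inj₂ im₂
  have hunion : S = T (Icc 2 4) ∪ T (Icc 1 2) := by
    ext w
    constructor
    · rintro ⟨hw, hstar⟩
      have h1 : (modelMap q p w).re ∈ A := by
        rw [← hfst]
        rcases hstar with h | h | h <;> rw [h] <;> rfl
      obtain ⟨t, ht, htw⟩ := exists_bdry_eq (w := w) (by simpa using hw)
      have htw : bdry t = w := Subtype.ext htw
      subst htw
      rcases le_or_gt t 1 with h | h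
      · refine Or.inl ⟨t + 3, ⟨⟨by linarith [ht.1], by linarith⟩, ?_⟩, bdry_add_three t⟩
        simpa only [mem_preimage, bdry_add_three] using h1
      rcases le_or_gt t 2 with h' | h'
      · exact Or.inr ⟨t, ⟨⟨h.le, h'⟩, h1⟩, rfl⟩
      · exact Or.inl ⟨t, ⟨⟨h'.le, by linarith [ht.2]⟩, h1⟩, rfl⟩
    · rintro (⟨t, ⟨ht, hA⟩, rfl⟩ | ⟨t, ⟨ht, hA⟩, rfl⟩)
      · refine ⟨norm_bdry t, ?_⟩
        have h1 := (hfst (bdry t)).mpr hA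
        rcases le_or_gt t 3 with h | h
        · exact Or.inr (Or.inr (star_of (u.side₂ t ⟨ht.1, h⟩) h1))
        · have h2 := u.side₀ (t - 3) ⟨by linarith, by linarith [ht.2]⟩
          rw [← bdry_add_three, sub_add_cancel] at h2
          exact Or.inl (star_of h2 h1)
      · exact ⟨norm_bdry t, Or.inr (Or.inl (star_of (u.side₁ t ht) ((hfst (bdry t)).mpr hA)))⟩
  have hdisj : Disjoint (T (Icc 2 4)) (T (Icc 1 2)) := by
    rw [Set.disjoint_left]
    rintro _ ⟨t, ⟨ht, hA⟩, rfl⟩ ⟨s, ⟨hs, -⟩, hst⟩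
    have h1 : (u.map (bdry t)).1 = (ε : UnitAddCircle) := (hfst _).mpr hA
    have hst' : s = t ∨ t = 4 := by
      by_cases h : t - s < 3
      · left
        refine sub_lt_three_of_bdry_eq hst ?_
        rw [abs_lt]
        constructor <;> linarith [hs.1, hs.2, ht.1, ht.2]
      · right
        linarith [hs.1, ht.2]
    rcases hst' with rfl | rfl
    · have h2 : s = 2 := le_antisymm hs.2 ht.1
      subst h2
      exact hc₂ h1
    · have : bdry 4 = bdry 1 := by rw [← bdry_add_three 1]; norm_num
      rw [this] at h1
      exact hc₁ h1
  have heven : Even S.ncard := by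
    by_cases hfin : S.Finite
    · rw [hunion] at hfin ⊢
      rw [ncard_union_eq hdisj (hfin.subset subset_union_left) (hfin.subset subset_union_right),
        n₁, n₂]
      exact ⟨_, rfl⟩
    -- the set of stars is in fact finite, but that need not be shown: `ncard` of an infinite set is `0`
    · rw [Set.Infinite.ncard hfin]
      exact Even.zero
  exact heven.neg_one_pow

end HolTriangle

/-! ### Counting lattice points in triangles -/

/-- The contribution of the column over `j` to the exponent of `t` in a theta series. -/
def thetaColumn (m e j : ℤ) : ℤ := if 1 ≤ j then max (e - m * j) 0 else max (m * j - e) 0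

/-- The exponent of `t` that accompanies `z ^ e` in the relative theta series of degree `m`: the
number of lattice points between the axes and the line of slope `-m` through `(0, e)`. -/
def relExp (m e : ℤ) : ℤ := ∑ᶠ j, thetaColumn m e j

theorem thetaColumn_nonneg (m e j : ℤ) : 0 ≤ thetaColumn m e j := by
  rw [thetaColumn]; split_ifs <;> exact le_max_right _ _

theorem support_thetaColumn {m e B : ℤ} (hm : 0 < m) (hB : |e| ≤ B) :
    (Function.support fun j => thetaColumn m e j) ⊆ Finset.Icc (-B) B := by
  intro j hj
  rw [Finset.coe_Icc, mem_Icc]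
  rw [abs_le] at hB
  by_contra hn
  refine hj ?_
  simp only [thetaColumn]
  by_cases h : 1 ≤ j
  · rw [if_pos h]
    have : B < j := by
      by_contra h'
      exact hn ⟨by omega, by omega⟩
    refine max_eq_right ?_
    nlinarith
  · rw [if_neg h]
    have : j < -B := by
      by_contra h'
      exact hn ⟨by omega, by omega⟩
    refine max_eq_right ?_
    nlinarith

theorem relExp_eq_sum {m e B : ℤ} (hm : 0 < m) (hB : |e| ≤ B) :
    relExp m e = ∑ j ∈ Finset.Icc (-B) B, thetaColumn m e j :=
  finsum_eq_sum_of_support_subset _ (support_thetaColumn hm hB)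

theorem relExp_nonneg (m e : ℤ) : 0 ≤ relExp m e := finsum_nonneg fun _ => thetaColumn_nonneg _ _ _

theorem relExp_add {m : ℤ} (hm : 0 < m) (e : ℤ) : relExp m (e + m) = relExp m e + e := by
  have h1 : ∀ j, thetaColumn m (e + m) (j + 1) = thetaColumn m e j + if j = 0 then e else 0 := by
    intro j
    simp only [thetaColumn]
    rcases lt_trichotomy j 0 with h | rfl | h
    · rw [if_neg (by omega), if_neg (by omega), if_neg (by omega), add_zero]
      congr 1; ring
    · simp
      omega
    · rw [if_pos (by omega), if_pos (by omega), if_neg (by omega), add_zero]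
      congr 1; ring
  rw [relExp, ← finsum_comp_equiv (Equiv.addRight (1 : ℤ))]
  simp only [Equiv.coe_addRight, h1]
  rw [finsum_add_distrib ((Finset.finite_toSet _).subset (support_thetaColumn hm le_rfl))
    ((finite_singleton (0 : ℤ)).subset fun j hj => by
      by_contra h
      exact hj (if_neg h)), finsum_eq_single _ 0 (fun j hj => if_neg hj), if_pos rfl]
  rfl

theorem two_mul_relExp {m : ℤ} (k i : ℤ) (h0 : 0 ≤ k) (hk : k < m) :
    2 * relExp m (m * i + k) = m * (i * (i - 1)) + 2 * (k * i) := by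
  have hm : 0 < m := by omega
  induction i using Int.induction_on with
  | zero =>
    have : relExp m k = 0 := by
      rw [relExp, ← finsum_zero (α := ℤ)]
      refine finsum_congr fun j => ?_
      simp only [thetaColumn]
      split_ifs with h <;> refine max_eq_right ?_ <;> nlinarith
    simp [this]
  | succ n ih =>
    have := relExp_add hm (m * n + k)
    rw [show m * ((n : ℤ) + 1) + k = m * n + k + m by ring, this]
    linear_combination ih
  | pred n ih =>
    have := relExp_add hm (m * (-(n : ℤ) - 1) + k)
    rw [show m * (-(n : ℤ) - 1) + k + m = m * (-n) + k by ring] at this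
    linear_combination ih - 2 * this

theorem relExp_eq {m : ℤ} (k i : ℤ) (h0 : 0 ≤ k) (hk : k < m) :
    relExp m (m * i + k) = m * (i * (i - 1) / 2) + k * i := by
  have h := two_mul_relExp k i h0 hk
  have h2 : 2 * (i * (i - 1) / 2) = i * (i - 1) :=
    Int.mul_ediv_cancel' (Int.even_mul_pred_self i).two_dvd
  nlinarith

/-- The lattice points whose small translates into the first quadrant lie in the triangle bounded by
the lines of slopes `0, -q, -(q + p)`, of which the latter two pass through `(0, e₁)` and
`(0, e₁ + e₂)`. -/
def trianglePoints (q p e₁ e₂ : ℤ) : Finset (Σ _ : ℤ, ℤ) :=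
  (Finset.Icc (-(|e₁| + |e₂|)) (|e₁| + |e₂|)).sigma fun j =>
    Finset.Ico (max 0 ((e₁ - q * j) + (e₂ - p * j))) (e₁ - q * j) ∪
      Finset.Ico (e₁ - q * j) (min 0 ((e₁ - q * j) + (e₂ - p * j)))

theorem mem_trianglePoints {q p e₁ e₂ : ℤ} (hq : 0 < q) (hp : 0 < p) {j l : ℤ} :
    (⟨j, l⟩ : Σ _ : ℤ, ℤ) ∈ trianglePoints q p e₁ e₂ ↔
      (0 ≤ l ∧ e₁ + e₂ ≤ l + (q + p) * j ∧ l + q * j < e₁) ∨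
      (l < 0 ∧ l + (q + p) * j < e₁ + e₂ ∧ e₁ ≤ l + q * j) := by
  simp only [trianglePoints, Finset.mem_sigma, Finset.mem_Icc, Finset.mem_union, Finset.mem_Ico,
    max_le_iff, lt_min_iff]
  constructor
  · rintro ⟨-, ⟨⟨h1, h2⟩, h3⟩ | ⟨h1, h2, h3⟩⟩
    · exact Or.inl ⟨h1, by linarith, by linarith⟩
    · exact Or.inr ⟨h2, by linarith, by linarith⟩
  · intro h
    have hb : ∀ {x y z : ℤ}, 0 < x → x * z < y → z ≤ |y| := by
      intro x y z hx h
      by_contra hz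
      have := le_abs_self y
      have := abs_nonneg y
      nlinarith
    have hb' : ∀ {x y z : ℤ}, 0 < x → y < x * z → -|y| ≤ z := by
      intro x y z hx h
      by_contra hz
      have := neg_abs_le y
      have := abs_nonneg y
      nlinarith
    have a1 := abs_nonneg e₁
    have a2 := abs_nonneg e₂
    rcases h with ⟨h1, h2, h3⟩ | ⟨h1, h2, h3⟩
    · have c1 : q * j < e₁ := by linarith
      have c2 : e₂ < p * j := by linarith
      have := hb hq c1
      have := hb' hp c2
      exact ⟨⟨by linarith, by linarith⟩, Or.inl ⟨⟨h1, by linarith⟩, by linarith⟩⟩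
    · have c1 : e₁ < q * j := by linarith
      have c2 : p * j < e₂ := by linarith
      have := hb' hq c1
      have := hb hp c2
      exact ⟨⟨by linarith, by linarith⟩, Or.inr ⟨by linarith, h1, by linarith⟩⟩

/-- The number of lattice points in a triangle is the defect of additivity of the exponents of the
theta series. -/
theorem card_trianglePoints {q p : ℤ} (hq : 0 < q) (hp : 0 < p) (e₁ e₂ : ℤ) :
    ((trianglePoints q p e₁ e₂).card : ℤ) + relExp (q + p) (e₁ + e₂) =
      relExp q e₁ + relExp p e₂ := by
  have a1 := abs_nonneg e₁
  have a2 := abs_nonneg e₂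
  have a3 := abs_add_le e₁ e₂
  rw [relExp_eq_sum (B := |e₁| + |e₂|) hq (by linarith),
    relExp_eq_sum (B := |e₁| + |e₂|) hp (by linarith),
    relExp_eq_sum (B := |e₁| + |e₂|) (add_pos hq hp) a3, trianglePoints, Finset.card_sigma]
  push_cast
  rw [← Finset.sum_add_distrib, ← Finset.sum_add_distrib]
  refine Finset.sum_congr rfl fun j _ => ?_
  have hc : e₁ + e₂ - (q + p) * j = (e₁ - q * j) + (e₂ - p * j) := by ring
  have hc' : (q + p) * j - (e₁ + e₂) = -((e₁ - q * j) + (e₂ - p * j)) := by ring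
  have hq' : q * j - e₁ = -(e₁ - q * j) := by ring
  have hp' : p * j - e₂ = -(e₂ - p * j) := by ring
  simp only [thetaColumn, hc, hc', hq', hp']
  generalize e₁ - q * j = a
  generalize e₂ - p * j = b
  rw [Finset.card_union_of_disjoint, Int.card_Ico, Int.card_Ico]
  · split_ifs <;> push_cast <;> omega
  · rw [Finset.disjoint_left]
    intro x hx hx'
    rw [Finset.mem_Ico] at hx hx'
    omega

theorem mem_openTriangle_modelSides {q p : ℤ} (hq : 0 < q) (hp : 0 < p) {P : ℂ} :
    P ∈ openTriangle (modelSides q p) ↔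
      0 < P.im ∧ P.im + q * P.re < q * p ∧ 0 < P.im + (q + p) * P.re := by
  have hT := isTriangle_modelSides hq hp
  have hn : ∀ i, 0 < normSq (modelSides q p i) := fun i => normSq_pos.mpr (hT.ne_zero i)
  have hq' : (0 : ℝ) < q := by exact_mod_cast hq
  have hp' : (0 : ℝ) < p := by exact_mod_cast hp
  have c0 : ((starRingEnd ℂ) (modelSides q p 0) * (P - triVertex (modelSides q p) 0)).im =
      p * P.im := by
    simp [triVertex, modelSides]
  have c1 : ((starRingEnd ℂ) (modelSides q p 1) * (P - triVertex (modelSides q p) 1)).im =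
      (q + p) * (q * p - (P.im + q * P.re)) := by
    simp [triVertex, modelSides]; ring
  have c2 : ((starRingEnd ℂ) (modelSides q p 2) * (P - triVertex (modelSides q p) 2)).im =
      q * (P.im + (q + p) * P.re) := by
    simp [triVertex, modelSides]; ring
  simp only [openTriangle, mem_ofPred_eq, Fin.forall_fin_succ, im_div_eq]
  simp only [Fin.isValue, Fin.succ_zero_eq_one, Fin.succ_one_eq_two, IsEmpty.forall_iff, and_true,
    div_pos_iff_of_pos_right (hn _), c0, c1, c2, mul_pos_iff_of_pos_left hq',
    mul_pos_iff_of_pos_left hp', mul_pos_iff_of_pos_left (add_pos hq' hp'), sub_pos]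

theorem int_add_pos_iff {n : ℤ} {δ : ℝ} (h0 : 0 < δ) (h1 : δ < 1) : 0 < (n : ℝ) + δ ↔ 0 ≤ n := by
  constructor
  · intro h
    have : (-1 : ℝ) < n := by linarith
    have : -1 < n := by exact_mod_cast this
    omega
  · intro h
    have : (0 : ℝ) ≤ n := by exact_mod_cast h
    linarith

theorem int_add_neg_iff {n : ℤ} {δ : ℝ} (h0 : 0 < δ) (h1 : δ < 1) : (n : ℝ) + δ < 0 ↔ n < 0 := by
  constructor
  · intro h
    have : (n : ℝ) < 0 := by linarith
    exact_mod_cast this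
  · intro h
    have : n ≤ -1 := by omega
    have : (n : ℝ) ≤ -1 := by exact_mod_cast this
    linarith

/-- The lattice translates of a point `(d₁, d₂)` close to the origin in the first quadrant that lie in
the rescaled model triangle are those by the points of `trianglePoints`. For negative scale the
triangle is turned by half a turn, which exchanges the two parts of `trianglePoints`. -/
theorem exists_mem_openTriangle_iff {q p : ℤ} (hq : 0 < q) (hp : 0 < p) {r L : ℝ} {e₁ e₂ : ℤ}
    (h₁ : q * (r + L * p) = e₁) (h₂ : p * (r - L * q) = e₂) {d₁ d₂ : ℝ} (hd₁ : 0 < d₁)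
    (hd₂ : 0 < d₂) (hd : d₂ + (q + p) * d₁ < 1) (j l : ℤ) :
    (∃ P ∈ openTriangle (modelSides q p), (r + L * P : ℂ) = ⟨d₁, d₂⟩ + j + l * I) ↔
      (⟨j, l⟩ : Σ _ : ℤ, ℤ) ∈ trianglePoints q p e₁ e₂ := by
  have hq' : (0 : ℝ) < q := by exact_mod_cast hq
  have hp' : (0 : ℝ) < p := by exact_mod_cast hp
  rw [mem_trianglePoints hq hp]
  have hdq : d₂ + q * d₁ < 1 := by nlinarith
  have hdq0 : 0 < d₂ + q * d₁ := by positivity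
  have hdm0 : 0 < d₂ + (q + p) * d₁ := by positivity
  have hd₂' : d₂ < 1 := by nlinarith
  have hdiff : (p * e₁ - q * e₂ : ℝ) = p * q * (q + p) * L := by
    rw [← h₁, ← h₂]; ring
  -- the three linear functionals at the translated lattice point
  have i0 : ∀ P : ℂ, (r + L * P : ℂ) = ⟨d₁, d₂⟩ + j + l * I → L * P.im = l + d₂ := by
    intro P h
    have := congrArg im h
    simp at this
    linarith
  have i0' : ∀ P : ℂ, (r + L * P : ℂ) = ⟨d₁, d₂⟩ + j + l * I → r + L * P.re = j + d₁ := by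
    intro P h
    have := congrArg re h
    simp at this
    linarith
  have i1 : ∀ P : ℂ, (r + L * P : ℂ) = ⟨d₁, d₂⟩ + j + l * I →
      L * (P.im + q * P.re - q * p) = ((l + q * j - e₁ : ℤ) : ℝ) + (d₂ + q * d₁) := by
    intro P h
    push_cast
    linear_combination i0 P h + q * i0' P h - h₁
  have i2 : ∀ P : ℂ, (r + L * P : ℂ) = ⟨d₁, d₂⟩ + j + l * I →
      L * (P.im + (q + p) * P.re) =
        ((l + (q + p) * j - (e₁ + e₂) : ℤ) : ℝ) + (d₂ + (q + p) * d₁) := by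
    intro P h
    push_cast
    linear_combination i0 P h + (q + p) * i0' P h - h₁ - h₂
  rcases lt_trichotomy L 0 with hL | rfl | hL
  · have hno : ¬(0 ≤ l ∧ e₁ + e₂ ≤ l + (q + p) * j ∧ l + q * j < e₁) := by
      rintro ⟨h1, h2, h3⟩
      have k1 : 0 < e₁ - q * j := by linarith
      have k2 : e₂ - p * j < 0 := by linarith
      have k3 : (p * e₁ - q * e₂ : ℝ) < 0 := by
        rw [hdiff]
        exact mul_neg_of_pos_of_neg (by positivity) hL
      have k4 : p * e₁ - q * e₂ < 0 := by exact_mod_cast k3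
      nlinarith
    rw [or_iff_right hno]
    constructor
    · rintro ⟨P, hP, h⟩
      rw [mem_openTriangle_modelSides hq hp] at hP
      obtain ⟨p0, p1, p2⟩ := hP
      refine ⟨?_, ?_, ?_⟩
      · rw [← int_add_neg_iff hd₂ hd₂', ← i0 P h]
        exact mul_neg_of_neg_of_pos hL p0
      · have : l + (q + p) * j - (e₁ + e₂) < 0 := by
          rw [← int_add_neg_iff hdm0 hd, ← i2 P h]
          exact mul_neg_of_neg_of_pos hL p2
        omega
      · have : 0 ≤ l + q * j - e₁ := by
          rw [← int_add_pos_iff hdq0 hdq, ← i1 P h]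
          exact mul_pos_of_neg_of_neg hL (by linarith)
        omega
    · rintro ⟨h1, h2, h3⟩
      have hL0 : (L : ℂ) ≠ 0 := by exact_mod_cast hL.ne
      have h : (r + L * ((⟨d₁, d₂⟩ + j + l * I - r) / L) : ℂ) = ⟨d₁, d₂⟩ + j + l * I := by
        field_simp
        ring
      refine ⟨_, ?_, h⟩
      rw [mem_openTriangle_modelSides hq hp]
      refine ⟨?_, ?_, ?_⟩
      · refine pos_of_mul_neg_right (a := L) ?_ hL.le
        rw [i0 _ h, int_add_neg_iff hd₂ hd₂']
        exact h1
      · rw [← sub_neg]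
        refine neg_of_mul_pos_right (a := L) ?_ hL.le
        rw [i1 _ h, int_add_pos_iff hdq0 hdq]
        omega
      · refine pos_of_mul_neg_right (a := L) ?_ hL.le
        rw [i2 _ h, int_add_neg_iff hdm0 hd]
        omega
  · have hz : p * e₁ - q * e₂ = 0 := by
      have : (p * e₁ - q * e₂ : ℝ) = 0 := by rw [hdiff]; ring
      exact_mod_cast this
    constructor
    · rintro ⟨P, hP, h⟩
      have := i0 P h
      rw [zero_mul] at this
      have h1 := (int_add_pos_iff (n := l) hd₂ hd₂').not
      have h2 := (int_add_neg_iff (n := l) hd₂ hd₂').not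
      rw [← this] at h1 h2
      simp at h1 h2
      omega
    · rintro (⟨h1, h2, h3⟩ | ⟨h1, h2, h3⟩)
      · have k1 : 0 < e₁ - q * j := by linarith
        have k2 : e₂ - p * j < 0 := by linarith
        nlinarith
      · have k1 : e₁ - q * j < 0 := by linarith
        have k2 : 0 < e₂ - p * j := by linarith
        nlinarith
  · have hno : ¬(l < 0 ∧ l + (q + p) * j < e₁ + e₂ ∧ e₁ ≤ l + q * j) := by
      rintro ⟨h1, h2, h3⟩
      have k1 : e₁ - q * j < 0 := by linarith
      have k2 : 0 < e₂ - p * j := by linarith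
      have k3 : 0 < (p * e₁ - q * e₂ : ℝ) := by
        rw [hdiff]
        positivity
      have k4 : 0 < p * e₁ - q * e₂ := by exact_mod_cast k3
      nlinarith
    rw [or_iff_left hno]
    constructor
    · rintro ⟨P, hP, h⟩
      rw [mem_openTriangle_modelSides hq hp] at hP
      obtain ⟨p0, p1, p2⟩ := hP
      refine ⟨?_, ?_, ?_⟩
      · rw [← int_add_pos_iff hd₂ hd₂', ← i0 P h]
        exact mul_pos hL p0
      · have : 0 ≤ l + (q + p) * j - (e₁ + e₂) := by
          rw [← int_add_pos_iff hdm0 hd, ← i2 P h]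
          exact mul_pos hL p2
        omega
      · have : l + q * j - e₁ < 0 := by
          rw [← int_add_neg_iff hdq0 hdq, ← i1 P h]
          exact mul_neg_of_pos_of_neg hL (by linarith)
        omega
    · rintro ⟨h1, h2, h3⟩
      have hL0 : (L : ℂ) ≠ 0 := by exact_mod_cast hL.ne'
      have h : (r + L * ((⟨d₁, d₂⟩ + j + l * I - r) / L) : ℂ) = ⟨d₁, d₂⟩ + j + l * I := by
        field_simp
        ring
      refine ⟨_, ?_, h⟩
      rw [mem_openTriangle_modelSides hq hp]
      refine ⟨?_, ?_, ?_⟩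
      · refine pos_of_mul_pos_right (a := L) ?_ hL.le
        rw [i0 _ h, int_add_pos_iff hd₂ hd₂']
        exact h1
      · rw [← sub_neg]
        refine neg_of_mul_neg_right (a := L) ?_ hL.le
        rw [i1 _ h, int_add_neg_iff hdq0 hdq]
        omega
      · refine pos_of_mul_pos_right (a := L) ?_ hL.le
        rw [i2 _ h, int_add_pos_iff hdm0 hd]
        omega

namespace HolTriangle

variable {q p m : ℤ} {y x₁ x₂ : Torus}

/-- The number of preimages of `D` is the number of lattice points, once `D` is close enough to the
origin. -/
theorem areaZ_eq_card (hq : 0 < q) (hp : 0 < p) (hm : m = q + p) (u : HolTriangle 0 q m y x₁ x₂)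
    {r : ℝ} (hy : toTorus r = y) {e₁ e₂ : ℤ} (h₁ : q * (r + u.scale p * p) = e₁)
    (h₂ : p * (r - u.scale p * q) = e₂) : u.areaZ = (trianglePoints q p e₁ e₂).card := by
  have hq' : (0 : ℝ) < q := by exact_mod_cast hq
  have hp' : (0 : ℝ) < p := by exact_mod_cast hp
  have hm' : (m : ℝ) = q + p := by exact_mod_cast hm
  have hT := isTriangle_modelSides hq hp
  have hF := isTriangleMap_modelMap hq hp
  have hmap := u.map_eq hq hp hm hy
  set L := u.scale p with hL
  have key : ∀ d : ℝ × ℝ, 0 < d.1 → 0 < d.2 → d.2 + (q + p) * d.1 < 1 →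
      Set.ncard {w : Disc | u.map w = toTorus ⟨d.1, d.2⟩} =
        (trianglePoints q p e₁ e₂).card := by
    rintro ⟨d₁, d₂⟩ hd₁ hd₂ hd
    simp only at hd₁ hd₂ hd ⊢
    have hiff := fun j l => exists_mem_openTriangle_iff hq hp h₁ h₂ hd₁ hd₂ hd j l
    have hball : ∀ w : Disc, u.map w = toTorus ⟨d₁, d₂⟩ → (w : ℂ) ∈ ball (0 : ℂ) 1 := by
      intro w hw
      have hw' : (w : ℂ) ∈ ball (0 : ℂ) 1 ∪ sphere 0 1 := by
        rw [ball_union_sphere]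
        exact w.2
      refine hw'.resolve_right fun hs => ?_
      -- the Lagrangians on the boundary do not contain points of the first quadrant near the origin
      have no : ∀ k : ℤ, 0 ≤ k → k ≤ q + p → u.map w ∉ lagr k := by
        intro k hk0 hk hmem
        rw [hw, toTorus_mem_lagr] at hmem
        obtain ⟨n, hn⟩ := hmem
        simp only at hn
        have c0 : (0 : ℝ) ≤ k := by exact_mod_cast hk0
        have c1 : (k : ℝ) ≤ q + p := by exact_mod_cast hk
        have g0 : (0 : ℝ) < n := by rw [← hn]; positivity
        have g1 : (n : ℝ) < 1 := by rw [← hn]; nlinarith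
        have g0' : 0 < n := by exact_mod_cast g0
        have g1' : n < 1 := by exact_mod_cast g1
        omega
      obtain ⟨t, ht, htw⟩ := exists_bdry_eq hs
      have htw : bdry t = w := Subtype.ext htw
      subst htw
      rcases le_or_gt t 1 with h | h
      · exact no 0 le_rfl (by omega) (u.side₀ t ⟨ht.1, h⟩)
      rcases le_or_gt t 2 with h' | h'
      · exact no q (by omega) (by omega) (u.side₁ t ⟨h.le, h'⟩)
      · exact no m (by omega) (by omega) (u.side₂ t ⟨h'.le, ht.2.le⟩)
    have hex : ∀ a ∈ trianglePoints q p e₁ e₂, ∃ w : Disc, (w : ℂ) ∈ ball (0 : ℂ) 1 ∧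
        (r + L * modelMap q p w : ℂ) = ⟨d₁, d₂⟩ + a.1 + a.2 * I := by
      rintro ⟨j, l⟩ ha
      obtain ⟨P, hP, h⟩ := (hiff j l).mpr ha
      rw [← hF.image_ball hT] at hP
      obtain ⟨w, hw, rfl⟩ := hP
      exact ⟨⟨w, ball_subset_closedBall hw⟩, hw, h⟩
    choose f hfb hf using hex
    rw [← ncard_coe_finset]
    refine (ncard_congr (fun a ha => f a (Finset.mem_coe.mp ha)) ?_ ?_ ?_).symm
    · intro a ha
      change u.map _ = _
      rw [hmap, hf a ha]
      exact toTorus_eq_iff.mpr ⟨a.1, a.2, rfl⟩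
    · rintro ⟨j, l⟩ ⟨j', l'⟩ ha hb hab
      have h := hf _ ha
      have h' := hf _ hb
      rw [hab, h'] at h
      have c1 := congrArg re h
      have c2 := congrArg im h
      simp at c1 c2
      rw [c1, c2]
    · intro w hw
      have hwb := hball w hw
      have hw' : u.map w = toTorus ⟨d₁, d₂⟩ := hw
      rw [hmap] at hw'
      obtain ⟨j, l, h⟩ := toTorus_eq_iff.mp hw'
      have ha := (hiff j l).mp ⟨_, hF.mapsTo hT hwb, h⟩
      refine ⟨⟨j, l⟩, ha, ?_⟩
      have h' := hf _ ha
      rw [← h] at h'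
      -- the scale is not zero, since a constant triangle does not pass through `D`
      have hL0 : (L : ℂ) ≠ 0 := by
        intro hL0
        have := congrArg im h
        simp [hL0] at this
        have hd₂' : d₂ < 1 := by nlinarith
        have h1 := (int_add_pos_iff (n := l) hd₂ hd₂').not
        have h2 := (int_add_neg_iff (n := l) hd₂ hd₂').not
        rw [add_comm (l : ℝ), ← this] at h1 h2
        simp at h1 h2
        omega
      have h'' := mul_left_cancel₀ hL0 (add_left_cancel h')
      exact Subtype.ext (hF.injOn hT (hfb _ ha) hwb h'')
  refine Filter.Tendsto.limUnder_eq (tendsto_const_nhds.congr' ?_)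
  have hmem : Ioo (0 : ℝ) (1 / (2 * (q + p))) ×ˢ Ioo (0 : ℝ) (1 / 2) ∈
      (𝓝[>] (0 : ℝ)) ×ˢ (𝓝[>] (0 : ℝ)) :=
    Filter.prod_mem_prod (Ioo_mem_nhdsGT (by positivity)) (Ioo_mem_nhdsGT (by norm_num))
  filter_upwards [hmem] with d hd
  obtain ⟨⟨a1, a2⟩, b1, b2⟩ := hd
  refine (key d a1 b1 ?_).symm
  rw [lt_div_iff₀ (by positivity)] at a2
  linarith

end HolTriangle

end

noncomputable section

/-! ### Rings with an adic filtration -/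

section Filtration

variable {R Λ : Type*} [CommRing R] [CommRing Λ] [Algebra R Λ] [TopologicalSpace Λ]

/-- The topology of `Λ` is defined by a complete, separated and exhaustive multiplicative filtration
with real indices, which is preserved by the automorphism `s`. Completeness is expressed by the
summability of all families that tend to zero; index types in `Type` suffice, as sets of triangles
live there. -/
structure IsAdicFiltration (V : ℝ → AddSubgroup Λ) (s : Λ ≃ₐ[R] Λ) : Prop where
  anti : Antitone V
  basis : ∀ x : Λ, (𝓝 x).HasBasis (fun _ : ℝ => True) fun N => {y | y - x ∈ V N}
  eq_zero : ∀ x, (∀ N, x ∈ V N) → x = 0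
  exhaust : ∀ x, ∃ N, x ∈ V N
  mul_mem : ∀ {M N x y}, x ∈ V M → y ∈ V N → x * y ∈ V (M + N)
  aut_mem : ∀ {N x}, s x ∈ V N ↔ x ∈ V N
  summable : ∀ {ι : Type} (f : ι → Λ), (∀ N, {i | f i ∉ V N}.Finite) → Summable f

namespace IsAdicFiltration

variable {V : ℝ → AddSubgroup Λ} {s : Λ ≃ₐ[R] Λ}

theorem mem_nhds (h : IsAdicFiltration V s) (x : Λ) (N : ℝ) : {y | y - x ∈ V N} ∈ 𝓝 x :=
  (h.basis x).mem_of_mem trivial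

theorem continuous_of_addMonoidHom (h : IsAdicFiltration V s) (f : Λ →+ Λ)
    (hf : ∀ N, ∃ M, ∀ x ∈ V M, f x ∈ V N) : Continuous f := by
  refine continuous_iff_continuousAt.mpr fun x => ?_
  refine ((h.basis x).tendsto_iff (h.basis (f x))).mpr fun N _ => ?_
  obtain ⟨M, hM⟩ := hf N
  exact ⟨M, trivial, fun y hy => by
    have := hM _ hy
    rwa [map_sub] at this⟩

theorem isTopologicalAddGroup (h : IsAdicFiltration V s) : IsTopologicalAddGroup Λ where
  continuous_add := by
    refine continuous_iff_continuousAt.mpr fun ⟨x, y⟩ => ?_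
    rw [ContinuousAt, nhds_prod_eq]
    refine (((h.basis x).prod (h.basis y)).tendsto_iff (h.basis (x + y))).mpr fun N _ => ?_
    refine ⟨(N, N), ⟨trivial, trivial⟩, fun z hz => ?_⟩
    have := (V N).add_mem hz.1 hz.2
    change z.1 + z.2 - (x + y) ∈ V N
    rwa [show z.1 + z.2 - (x + y) = z.1 - x + (z.2 - y) by ring]
  continuous_neg := h.continuous_of_addMonoidHom negAddMonoidHom fun N =>
    ⟨N, fun _ hx => (V N).neg_mem hx⟩

theorem t2Space (h : IsAdicFiltration V s) : T2Space Λ := by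
  have := h.isTopologicalAddGroup
  have : T1Space Λ := by
    refine ⟨fun x => ?_⟩
    rw [← isOpen_compl_iff, isOpen_iff_mem_nhds]
    intro y hy
    have : ∃ N, y - x ∉ V N := by
      by_contra hc
      push Not at hc
      exact hy (sub_eq_zero.mp (h.eq_zero _ hc))
    obtain ⟨N, hN⟩ := this
    refine Filter.mem_of_superset (h.mem_nhds y N) fun z hz => ?_
    rintro rfl
    exact hN (by rw [← neg_sub]; exact (V N).neg_mem hz)
  infer_instance

theorem continuous_mul_left (h : IsAdicFiltration V s) (a : Λ) : Continuous fun x => a * x := by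
  obtain ⟨M, hM⟩ := h.exhaust a
  refine h.continuous_of_addMonoidHom (AddMonoidHom.mulLeft a) fun N => ⟨N - M, fun x hx => ?_⟩
  have := h.mul_mem hM hx
  rwa [add_sub_cancel] at this

theorem continuousConstSMul (h : IsAdicFiltration V s) : ContinuousConstSMul R Λ :=
  ⟨fun r => by
    simp only [Algebra.smul_def]
    exact h.continuous_mul_left _⟩

theorem symm_mem (h : IsAdicFiltration V s) {N : ℝ} {x : Λ} : s.symm x ∈ V N ↔ x ∈ V N := by
  rw [← h.aut_mem, s.apply_symm_apply]

theorem zpow_mem (h : IsAdicFiltration V s) (i : ℤ) {N : ℝ} {x : Λ} :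
    (s ^ i) x ∈ V N ↔ x ∈ V N := by
  induction i using Int.induction_on generalizing x with
  | zero => simp
  | succ n ih =>
    rw [zpow_add_one, AlgEquiv.mul_apply, ih, h.aut_mem]
  | pred n ih =>
    rw [zpow_sub_one, AlgEquiv.mul_apply, ih]
    exact h.symm_mem

theorem continuous_zpow (h : IsAdicFiltration V s) (i : ℤ) : Continuous (s ^ i : Λ ≃ₐ[R] Λ) :=
  h.continuous_of_addMonoidHom ((s ^ i : Λ ≃ₐ[R] Λ) : Λ →+ Λ) fun N =>
    ⟨N, fun _ hx => (h.zpow_mem i).mpr hx⟩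

end IsAdicFiltration

/-! ### Formal products of rapidly decreasing series -/

/-- The coefficients of the series `f` tend to zero at least as fast as `t ^ (δ e²)`, for some
`δ > 0`. -/
def RapidDecay (V : ℝ → AddSubgroup Λ) (f : ℤ → Λ) : Prop :=
  ∃ δ > 0, ∃ B : ℝ, ∀ e : ℤ, f e ∈ V (δ * (e : ℝ) ^ 2 - B)

theorem finite_setOf_sq_lt {δ : ℝ} (hδ : 0 < δ) (B : ℝ) : {e : ℤ | δ * (e : ℝ) ^ 2 < B}.Finite := by
  refine (Set.finite_Icc (-⌈B / δ⌉) ⌈B / δ⌉).subset fun e he => ?_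
  have h1 : (e : ℝ) ^ 2 < B / δ := by
    rw [lt_div_iff₀ hδ]
    have he : δ * (e : ℝ) ^ 2 < B := he
    linarith
  have h2 : ((e ^ 2 : ℤ) : ℝ) < ⌈B / δ⌉ := by
    push_cast
    exact h1.trans_le (Int.le_ceil _)
  have h3 : e ^ 2 < ⌈B / δ⌉ := by exact_mod_cast h2
  constructor <;> nlinarith [sq_nonneg (e - 1), sq_nonneg (e + 1)]

namespace RapidDecay

variable {V : ℝ → AddSubgroup Λ} {s : Λ ≃ₐ[R] Λ} {f g k : ℤ → Λ}

omit [TopologicalSpace Λ] in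
theorem zero : RapidDecay V (0 : ℤ → Λ) := ⟨1, one_pos, 0, fun _ => (V _).zero_mem⟩

theorem add (h : IsAdicFiltration V s) (hf : RapidDecay V f) (hg : RapidDecay V g) :
    RapidDecay V (f + g) := by
  obtain ⟨δ, hδ, B, hB⟩ := hf
  obtain ⟨δ', hδ', B', hB'⟩ := hg
  refine ⟨min δ δ', lt_min hδ hδ', max B B', fun e => (V _).add_mem (h.anti ?_ (hB e))
    (h.anti ?_ (hB' e))⟩
  · have := mul_le_mul_of_nonneg_right (min_le_left δ δ') (sq_nonneg (e : ℝ))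
    linarith [le_max_left B B']
  · have := mul_le_mul_of_nonneg_right (min_le_right δ δ') (sq_nonneg (e : ℝ))
    linarith [le_max_right B B']

theorem sum (h : IsAdicFiltration V s) {ι : Type*} (S : Finset ι) {F : ι → ℤ → Λ}
    (hF : ∀ i ∈ S, RapidDecay V (F i)) : RapidDecay V (∑ i ∈ S, F i) := by
  classical
  induction S using Finset.induction_on with
  | empty => exact zero
  | insert a S ha ih =>
    rw [Finset.sum_insert ha]
    exact (hF a (Finset.mem_insert_self a S)).add h
      (ih fun i hi => hF i (Finset.mem_insert_of_mem hi))

theorem finite_mul (h : IsAdicFiltration V s) (hf : RapidDecay V f) (hg : RapidDecay V g) (e : ℤ)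
    (N : ℝ) : {i : ℤ | f i * g (e - i) ∉ V N}.Finite := by
  obtain ⟨δ, hδ, B, hB⟩ := hf
  obtain ⟨δ', hδ', B', hB'⟩ := hg
  refine (finite_setOf_sq_lt hδ (N + B + B')).subset fun i hi => ?_
  by_contra hn
  refine hi (h.anti ?_ (h.mul_mem (hB i) (hB' (e - i))))
  have : N + B + B' ≤ δ * (i : ℝ) ^ 2 := not_lt.mp hn
  have : 0 ≤ δ' * ((e - i : ℤ) : ℝ) ^ 2 := by positivity
  linarith

theorem converges (h : IsAdicFiltration V s) (hf : RapidDecay V f) (hg : RapidDecay V g) :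
    SeriesMulConverges f g := fun e => h.summable _ (hf.finite_mul h hg e)

theorem mul_comm (f g : ℤ → Λ) : seriesMul f g = seriesMul g f := by
  funext e
  rw [seriesMul, seriesMul, ← (Equiv.subLeft e).tsum_eq]
  refine tsum_congr fun i => ?_
  simp only [Equiv.subLeft_apply]
  rw [sub_sub_cancel, _root_.mul_comm]

theorem add_mul (h : IsAdicFiltration V s) (hf : RapidDecay V f) (hg : RapidDecay V g)
    (hk : RapidDecay V k) : seriesMul (f + g) k = seriesMul f k + seriesMul g k := by
  have := h.isTopologicalAddGroup
  have := h.t2Space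
  funext e
  rw [Pi.add_apply, seriesMul, seriesMul, seriesMul,
    ← (hf.converges h hk e).tsum_add (hg.converges h hk e)]
  refine tsum_congr fun i => ?_
  rw [Pi.add_apply, _root_.add_mul]

theorem mul_add (h : IsAdicFiltration V s) (hf : RapidDecay V f) (hg : RapidDecay V g)
    (hk : RapidDecay V k) : seriesMul f (g + k) = seriesMul f g + seriesMul f k := by
  rw [mul_comm, add_mul h hg hk hf, mul_comm g, mul_comm k]

theorem sum_mul (h : IsAdicFiltration V s) {ι : Type*} (S : Finset ι) {F : ι → ℤ → Λ}
    (hF : ∀ i ∈ S, RapidDecay V (F i)) (hg : RapidDecay V g) :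
    seriesMul (∑ i ∈ S, F i) g = ∑ i ∈ S, seriesMul (F i) g := by
  classical
  induction S using Finset.induction_on with
  | empty =>
    funext e
    simp [seriesMul]
  | insert a S ha ih =>
    have h1 := fun i hi => hF i (Finset.mem_insert_of_mem hi)
    rw [Finset.sum_insert ha, Finset.sum_insert ha,
      add_mul h (hF a (Finset.mem_insert_self a S)) (RapidDecay.sum h S h1) hg, ih h1]

theorem mul_sum (h : IsAdicFiltration V s) {ι : Type*} (S : Finset ι) {F : ι → ℤ → Λ}
    (hF : ∀ i ∈ S, RapidDecay V (F i)) (hg : RapidDecay V g) :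
    seriesMul g (∑ i ∈ S, F i) = ∑ i ∈ S, seriesMul g (F i) := by
  rw [mul_comm, sum_mul h S hF hg]
  exact Finset.sum_congr rfl fun i _ => mul_comm _ _

/-- Formal multiplication of rapidly decreasing series is associative: both iterated sums are the
sum over all decompositions of the exponent into three parts. -/
theorem mul_assoc (h : IsAdicFiltration V s) (hf : RapidDecay V f) (hg : RapidDecay V g)
    (hk : RapidDecay V k) : seriesMul (seriesMul f g) k = seriesMul f (seriesMul g k) := by
  have := h.isTopologicalAddGroup
  have := h.t2Space
  funext e
  have hsum : Summable fun x : ℤ × ℤ => f x.1 * (g x.2 * k (e - x.1 - x.2)) := by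
    refine h.summable _ fun N => ?_
    obtain ⟨δ, hδ, B, hB⟩ := hf
    obtain ⟨δ', hδ', B', hB'⟩ := hg
    obtain ⟨δ'', hδ'', B'', hB''⟩ := hk
    refine ((finite_setOf_sq_lt hδ (N + B + B' + B'')).prod
      (finite_setOf_sq_lt hδ' (N + B + B' + B''))).subset fun x hx => ?_
    have hmem := h.mul_mem (hB x.1) (h.mul_mem (hB' x.2) (hB'' (e - x.1 - x.2)))
    have p1 : 0 ≤ δ * (x.1 : ℝ) ^ 2 := by positivity
    have p2 : 0 ≤ δ' * (x.2 : ℝ) ^ 2 := by positivity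
    have p3 : 0 ≤ δ'' * ((e - x.1 - x.2 : ℤ) : ℝ) ^ 2 := by positivity
    refine ⟨?_, ?_⟩
    · by_contra hn
      have hn : N + B + B' + B'' ≤ δ * (x.1 : ℝ) ^ 2 := not_lt.mp hn
      exact hx (h.anti (by linarith) hmem)
    · by_contra hn
      have hn : N + B + B' + B'' ≤ δ' * (x.2 : ℝ) ^ 2 := not_lt.mp hn
      exact hx (h.anti (by linarith) hmem)
  have hinner : ∀ i, Summable fun j => f i * (g j * k (e - i - j)) := fun i =>
    (hg.converges h hk (e - i)).map (AddMonoidHom.mulLeft (f i)) (h.continuous_mul_left (f i))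
  have e1 : seriesMul f (seriesMul g k) e =
      ∑' x : ℤ × ℤ, f x.1 * (g x.2 * k (e - x.1 - x.2)) := by
    rw [hsum.tsum_prod' hinner, seriesMul]
    refine tsum_congr fun i => ?_
    rw [seriesMul]
    exact ((hg.converges h hk (e - i)).map_tsum (AddMonoidHom.mulLeft (f i))
      (h.continuous_mul_left (f i)))
  rw [e1]
  -- the shear `(l, i) ↦ (i, l - i)` of the index set
  let E : ℤ × ℤ ≃ ℤ × ℤ :=
    { toFun := fun x => (x.2, x.1 - x.2)
      invFun := fun x => (x.1 + x.2, x.1)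
      left_inv := fun x => by simp
      right_inv := fun x => by simp }
  have hsum' : Summable fun x : ℤ × ℤ => f x.2 * g (x.1 - x.2) * k (e - x.1) := by
    refine (E.summable_iff.mpr hsum).congr fun x => ?_
    simp only [E, Function.comp, Equiv.coe_fn_mk]
    rw [sub_sub, add_sub_cancel, _root_.mul_assoc]
  rw [← E.tsum_eq]
  have e2 : ∀ x, f (E x).1 * (g (E x).2 * k (e - (E x).1 - (E x).2)) =
      f x.2 * g (x.1 - x.2) * k (e - x.1) := fun x => by
    simp only [E, Equiv.coe_fn_mk]
    rw [sub_sub, add_sub_cancel, _root_.mul_assoc]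
  have hconv : ∀ a : Λ, Continuous (AddMonoidHom.mulRight a) := fun a => by
    have := h.continuous_mul_left a
    simpa only [AddMonoidHom.coe_mulRight, _root_.mul_comm a] using this
  rw [tsum_congr e2, hsum'.tsum_prod' (fun l =>
    (hf.converges h hg l).map (AddMonoidHom.mulRight (k (e - l))) (hconv _)), seriesMul]
  refine tsum_congr fun l => ?_
  rw [seriesMul]
  exact (hf.converges h hg l).map_tsum (AddMonoidHom.mulRight (k (e - l))) (hconv _)

end RapidDecay

end Filtration

/-! ### Values of sections of the locally constant sheaf -/

section Stalk

variable {R Λ : Type*} [CommRing R] [CommRing Λ] [Algebra R Λ] {s : Λ ≃ₐ[R] Λ} {p : UnitAddCircle}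

theorem stalk_apply_add_int (c : Stalk s p) (i : ℤ) {r r' : {r : ℝ // (r : UnitAddCircle) = p}}
    (h : (r' : ℝ) = r + i) : c.1 r' = (s ^ i) (c.1 r) := by
  have up : ∀ (t : ℝ) (ht : (t : UnitAddCircle) = p), ((t + 1 : ℝ) : UnitAddCircle) = p :=
    fun t ht => by rw [← ht, coe_eq_coe_iff_exists_int]; exact ⟨1, by simp⟩
  induction i using Int.induction_on generalizing r' with
  | zero =>
    have : r' = r := Subtype.ext (by simpa using h)
    simp [this]
  | succ n ih =>
    have hp : (((r : ℝ) + ((n : ℤ) : ℝ) : ℝ) : UnitAddCircle) = p := by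
      exact (coe_eq_coe_iff_exists_int.mpr ⟨n, rfl⟩).trans r.2
    rw [c.2 ⟨_, hp⟩ r' (by rw [h]; push_cast; ring), ih rfl, add_comm, zpow_one_add,
      AlgEquiv.mul_apply]
  | pred n ih =>
    have hr : ((r' + 1 : ℝ) : UnitAddCircle) = p := up r' r'.2
    have h1 := c.2 r' ⟨_, hr⟩ rfl
    rw [ih (r' := ⟨_, hr⟩) (by simp only [h]; push_cast; ring)] at h1
    apply s.injective
    rw [← h1, ← AlgEquiv.mul_apply, ← zpow_one_add]
    congr 2
    ring

/-- The trivialization of a stalk by a lift `r` of its base point. The floor in the inverse is that of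
an integer, the difference of two lifts. -/
def stalkEval (s : Λ ≃ₐ[R] Λ) (r : ℝ) (hr : (r : UnitAddCircle) = p) : Stalk s p ≃ₗ[R] Λ where
  toFun c := c.1 ⟨r, hr⟩
  map_add' _ _ := rfl
  map_smul' _ _ := rfl
  invFun a := ⟨fun t => (s ^ ⌊(t : ℝ) - r⌋) a, fun t t' h => by
    change (s ^ ⌊(t' : ℝ) - r⌋) a = s ((s ^ ⌊(t : ℝ) - r⌋) a)
    rw [show (t' : ℝ) - r = t - r + 1 by rw [h]; ring, Int.floor_add_one, add_comm, zpow_one_add,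
      AlgEquiv.mul_apply]⟩
  left_inv c := by
    apply Subtype.ext
    funext t
    obtain ⟨i, hi⟩ := coe_eq_coe_iff_exists_int.mp (t.2.trans hr.symm)
    rw [stalk_apply_add_int c i (r := ⟨r, hr⟩) hi]
    simp [hi]
  right_inv a := by simp

theorem stalkEval_apply (r : ℝ) (hr : (r : UnitAddCircle) = p) (c : Stalk s p) :
    stalkEval s r hr c = c.1 ⟨r, hr⟩ := rfl

theorem stalkEval_add_int (r : ℝ) (hr : (r : UnitAddCircle) = p) (r' : ℝ)
    (hr' : (r' : UnitAddCircle) = p) (i : ℤ) (h : r' = r + i) (c : Stalk s p) :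
    stalkEval s r' hr' c = (s ^ i) (stalkEval s r hr c) :=
  stalk_apply_add_int c i h

theorem stalkEval_germ (r : ℝ) (a : Λ) : stalkEval s r rfl (germ s r a) = a := by
  simp [stalkEval_apply, germ]

variable [TopologicalSpace Λ] {V : ℝ → AddSubgroup Λ}

theorem continuous_stalkEval (r : ℝ) (hr : (r : UnitAddCircle) = p) :
    Continuous (stalkEval s r hr) :=
  (continuous_apply _).comp continuous_subtype_val

theorem IsAdicFiltration.continuous_stalkEval_symm (h : IsAdicFiltration V s) (r : ℝ)
    (hr : (r : UnitAddCircle) = p) : Continuous (stalkEval s r hr).symm :=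
  Continuous.subtype_mk (continuous_pi fun _ => h.continuous_zpow _) _

theorem IsAdicFiltration.summable_stalk (h : IsAdicFiltration V s) {r : ℝ}
    (hr : (r : UnitAddCircle) = p) {ι : Type*} {F : ι → Stalk s p} :
    Summable F ↔ Summable fun i => stalkEval s r hr (F i) :=
  (Summable.map_iff_of_equiv (stalkEval s r hr) (continuous_stalkEval r hr)
    (h.continuous_stalkEval_symm r hr)).symm

/-- The filtration step of a section does not depend on the lift at which it is evaluated. -/
theorem IsAdicFiltration.stalkEval_mem (h : IsAdicFiltration V s) {r r' : ℝ}
    (hr : (r : UnitAddCircle) = p) (hr' : (r' : UnitAddCircle) = p) {N : ℝ} {c : Stalk s p} :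
    stalkEval s r hr c ∈ V N ↔ stalkEval s r' hr' c ∈ V N := by
  obtain ⟨i, hi⟩ := coe_eq_coe_iff_exists_int.mp (hr.trans hr'.symm)
  rw [stalkEval_add_int r' hr' r hr i hi, h.zpow_mem]

end Stalk

/-! ### The series of a Floer cochain -/

theorem point_mem {m : ℤ} (hm : m ≠ 0) (e : ℤ) :
    (((e / m : ℝ) : UnitAddCircle), (0 : UnitAddCircle)) ∈ lagr 0 ∩ lagr m := by
  have hm' : (m : ℝ) ≠ 0 := by exact_mod_cast hm
  constructor
  · rw [mem_lagr]
    simp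
  · rw [mem_lagr, ← AddCircle.coe_zsmul, zsmul_eq_mul, mul_div_cancel₀ _ hm', ← AddCircle.coe_neg]
    symm
    exact coe_eq_zero_iff_exists_int.mpr ⟨-e, by simp⟩

/-- The intersection point `(e/m, 0)` of `L_(0)` and `L_(m)`. -/
def point (m : ℕ+) (e : ℤ) : ↥(lagr 0 ∩ lagr m) :=
  ⟨(((e / (m : ℕ) : ℝ) : UnitAddCircle), 0), by
    simpa using point_mem (m := m) (by exact_mod_cast m.ne_zero) e⟩

theorem point_fst (m : ℕ+) (e : ℤ) : ((e / (m : ℕ) : ℝ) : UnitAddCircle) = (point m e).1.1 := rfl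

theorem eq_point_of_coe_eq {m : ℕ+} {e : ℤ} {x : ↥(lagr 0 ∩ lagr m)} {r : ℝ}
    (hr : (r : UnitAddCircle) = x.1.1) (he : (m : ℕ) * r = e) : x = point m e := by
  have hm : ((m : ℕ) : ℝ) ≠ 0 := by exact_mod_cast m.ne_zero
  have h0 := mem_lagr.mp x.2.1
  refine Subtype.ext (Prod.ext ?_ ?_)
  · rw [← hr, ← point_fst, ← he, mul_div_cancel_left₀ _ hm]
  · rw [h0, zero_smul, neg_zero]
    rfl

theorem exists_lift {m : ℤ} {x : Torus} (hx : x ∈ lagr 0 ∩ lagr m) {r : ℝ}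
    (hr : (r : UnitAddCircle) = x.1) : ∃ e : ℤ, m * r = e := by
  have := HolTriangle.zsmul_fst_eq_zero hx
  rw [sub_zero, ← hr, ← AddCircle.coe_zsmul, zsmul_eq_mul, coe_eq_zero_iff_exists_int] at this
  exact this

theorem point_eq_point_iff {m : ℕ+} {e e' : ℤ} :
    point m e = point m e' ↔ ∃ i : ℤ, e = m * i + e' := by
  have hm : ((m : ℕ) : ℝ) ≠ 0 := by exact_mod_cast m.ne_zero
  constructor
  · intro h
    obtain ⟨i, hi⟩ := coe_eq_coe_iff_exists_int.mp
      (((point_fst m e).trans (congrArg (fun x => x.1.1) h)).trans (point_fst m e').symm)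
    refine ⟨i, ?_⟩
    field_simp at hi
    have : (e : ℝ) = m * i + e' := by linarith
    exact_mod_cast this
  · rintro ⟨i, rfl⟩
    refine (eq_point_of_coe_eq (x := point m e') (r := e' / (m : ℕ) + i) ?_ ?_).symm
    · exact (coe_eq_coe_iff_exists_int.mpr ⟨i, rfl⟩).trans (point_fst m e')
    · push_cast
      field_simp
      ring

theorem exists_point_eq (m : ℕ+) (x : ↥(lagr 0 ∩ lagr m)) : ∃ k < (m : ℕ), x = point m k := by
  obtain ⟨r, hr⟩ := QuotientAddGroup.mk_surjective x.1.1
  obtain ⟨e, he⟩ := exists_lift x.2 hr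
  have hm : (0 : ℤ) < (m : ℕ) := by exact_mod_cast m.pos
  refine ⟨(e % (m : ℕ)).toNat, ?_, ?_⟩
  · have := Int.emod_lt_of_pos e hm
    omega
  · rw [eq_point_of_coe_eq hr (by exact_mod_cast he), point_eq_point_iff]
    refine ⟨e / (m : ℕ), ?_⟩
    rw [Int.toNat_of_nonneg (Int.emod_nonneg _ hm.ne')]
    exact (Int.mul_ediv_add_emod e _).symm

section Series

variable {R Λ : Type*} [CommRing R] [CommRing Λ] [Algebra R Λ] {s : Λ ≃ₐ[R] Λ}

/-- The value of the cochain `v` at the lift `e/m` of the intersection point `(e/m, 0)`. -/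
def cochainValue (m : ℕ+) (e : ℤ) : CF s 0 m →ₗ[R] Λ :=
  (stalkEval s (e / (m : ℕ) : ℝ) (point_fst m e)).toLinearMap ∘ₗ LinearMap.proj (point m e)

theorem cochainValue_eq {m : ℕ+} {e : ℤ} {x : ↥(lagr 0 ∩ lagr m)} {r : ℝ}
    (hr : (r : UnitAddCircle) = x.1.1) (he : (m : ℕ) * r = e) (v : CF s 0 m) :
    cochainValue m e v = stalkEval s r hr (v x) := by
  have hm : ((m : ℕ) : ℝ) ≠ 0 := by exact_mod_cast m.ne_zero
  obtain rfl := eq_point_of_coe_eq hr he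
  obtain rfl : r = e / (m : ℕ) := by rw [← he, mul_div_cancel_left₀ _ hm]
  rfl

/-- The quasi-periodicity of the values of a cochain, due to the monodromy of the sheaf. -/
theorem cochainValue_add_mul (m : ℕ+) (i k : ℤ) (v : CF s 0 m) :
    cochainValue m (m * i + k) v = (s ^ i) (cochainValue m k v) := by
  have hm : ((m : ℕ) : ℝ) ≠ 0 := by exact_mod_cast m.ne_zero
  have hr : ((k / (m : ℕ) + i : ℝ) : UnitAddCircle) = (point m k).1.1 :=
    (coe_eq_coe_iff_exists_int.mpr ⟨i, rfl⟩).trans (point_fst m k)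
  rw [cochainValue_eq hr (by push_cast; field_simp; ring), stalkEval_add_int _ (point_fst m k) _ hr i rfl]
  rfl

theorem cochain_ext {m : ℕ+} {v w : CF s 0 m}
    (h : ∀ k < (m : ℕ), cochainValue m k v = cochainValue m k w) : v = w := by
  funext x
  obtain ⟨k, hk, rfl⟩ := exists_point_eq m x
  exact (stalkEval s _ (point_fst m k)).injective (h k hk)

open Classical in
/-- The cochain `x_{m, k/m} · a`. -/
def cochainGen (s : Λ ≃ₐ[R] Λ) (m : ℕ+) (k : ℕ) (a : Λ) : CF s 0 m :=
  Pi.single (M := fun p : ↥(lagr 0 ∩ lagr m) => ↥(Stalk s p.1.1))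
      ⟨_, gen_mem m k⟩ (germ s ((k : ℝ) / (m : ℕ)) a)

theorem cochainValue_gen (m : ℕ+) (k : ℕ) (a : Λ) (i : ℤ) :
    cochainValue m (m * i + k) (cochainGen s m k a) = (s ^ i) a := by
  rw [cochainValue_add_mul, cochainValue_eq (x := ⟨_, gen_mem m k⟩) (r := (k : ℝ) / (m : ℕ)) rfl
    (by have : ((m : ℕ) : ℝ) ≠ 0 := by exact_mod_cast m.ne_zero
        push_cast; field_simp), cochainGen, Pi.single_eq_same, stalkEval_germ]

theorem cochainValue_gen_of_ne {m : ℕ+} {k : ℕ} (a : Λ) {e : ℤ} (h : ∀ i : ℤ, m * i + k ≠ e) :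
    cochainValue m e (cochainGen s m k a) = 0 := by
  have h1 : point m e ≠ ⟨_, gen_mem m k⟩ := by
    intro h2
    have h3 : (⟨_, gen_mem m k⟩ : ↥(lagr 0 ∩ lagr m)) = point m k := by
      simp [point]
    rw [h3, point_eq_point_iff] at h2
    obtain ⟨i, hi⟩ := h2
    exact h i hi.symm
  rw [cochainValue, LinearMap.comp_apply, LinearMap.proj_apply, cochainGen, Pi.single_eq_of_ne h1,
    map_zero]

/-- The values of a cochain are bounded: up to the action of `s` there are finitely many of them. -/
theorem exists_bound [TopologicalSpace Λ] {V : ℝ → AddSubgroup Λ} (h : IsAdicFiltration V s)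
    {m : ℕ+} (v : CF s 0 m) : ∃ N, ∀ e, cochainValue m e v ∈ V N := by
  choose N hN using fun k : ℕ => h.exhaust (cochainValue m k v)
  obtain ⟨M, hM⟩ := ((Finset.range m).image N).bddBelow
  have hm : (0 : ℤ) < (m : ℕ) := by exact_mod_cast m.pos
  refine ⟨M, fun e => ?_⟩
  have h0 := Int.emod_nonneg e hm.ne'
  have h1 : (((e % (m : ℕ)).toNat : ℕ) : ℤ) = e % (m : ℕ) := Int.toNat_of_nonneg h0
  rw [← Int.mul_ediv_add_emod e (m : ℕ), cochainValue_add_mul, h.zpow_mem, ← h1]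
  refine h.anti (hM ?_) (hN _)
  simp only [Finset.coe_image, Set.mem_image, Finset.mem_coe, Finset.mem_range]
  refine ⟨_, ?_, rfl⟩
  have := Int.emod_lt_of_pos e hm
  omega

end Series

/-! ### The enumeration of triangles -/

section Enumeration

variable {q p m : ℤ}

/-- The holomorphic triangles with corner `y` on `L_(0) ∩ L_(m)` and arbitrary other corners. -/
abbrev AllTriangles (q m : ℤ) (y : Torus) : Type :=
  Σ (x : ↥(lagr q ∩ lagr m) × ↥(lagr 0 ∩ lagr q)), HolTriangle 0 q m y x.2 x.1

theorem AllTriangles.coe_lift₁ (hq : 0 < q) (hp : 0 < p) (hm : m = q + p) {y : Torus} {r : ℝ}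
    (hr : (r : UnitAddCircle) = y.1) (T : AllTriangles q m y) :
    ((r + T.2.scale p * p : ℝ) : UnitAddCircle) = T.1.2.1.1 := by
  rw [← (T.2.shift_eq hq hp hm).1, AddCircle.coe_add, hr]
  exact T.2.coe_shift₀

theorem AllTriangles.coe_lift₂ (hq : 0 < q) (hp : 0 < p) (hm : m = q + p) {y : Torus} {r : ℝ}
    (hr : (r : UnitAddCircle) = y.1) (T : AllTriangles q m y) :
    ((r - T.2.scale p * q : ℝ) : UnitAddCircle) = T.1.1.1.1 := by
  rw [← (T.2.shift_eq hq hp hm).2.2, AddCircle.coe_sub, hr, ← T.2.coe_shift₂, add_sub_cancel_right]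

theorem eq_of_fst_eq {k l : ℤ} {x x' : ↥(lagr k ∩ lagr l)} (h : x.1.1 = x'.1.1) : x = x' := by
  refine Subtype.ext (Prod.ext h ?_)
  rw [mem_lagr.mp x.2.1, mem_lagr.mp x'.2.1, h]

/-- Once a lift `r` of the corner `y` is fixed, a triangle is determined by the integer
`q x̃₁`, where `x̃₁` is the lift of the corner `x₁` that is reached from `r` along the first side,
and this integer is arbitrary. -/
theorem AllTriangles.exists_equiv (hq : 0 < q) (hp : 0 < p) (hm : m = q + p) {y : Torus}
    (hy : y ∈ lagr 0 ∩ lagr m) {r : ℝ} (hr : (r : UnitAddCircle) = y.1) :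
    ∃ E : AllTriangles q m y ≃ ℤ, ∀ T, q * (r + T.2.scale p * p) = E T := by
  have hq' : (0 : ℝ) < q := by exact_mod_cast hq
  have hp' : (0 : ℝ) < p := by exact_mod_cast hp
  have hm' : (m : ℝ) = q + p := by exact_mod_cast hm
  have hidx : ∀ T : AllTriangles q m y, ∃ e : ℤ, q * (r + T.2.scale p * p) = e := fun T =>
    exists_lift T.1.2.2 (T.coe_lift₁ hq hp hm hr)
  choose idx hidx using hidx
  refine ⟨Equiv.ofBijective idx ⟨fun T T' h => ?_, fun e₁ => ?_⟩, hidx⟩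
  · have hL : T.2.scale p = T'.2.scale p := by
      have h1 := (hidx T).trans ((congrArg _ h).trans (hidx T').symm)
      have h2 := mul_left_cancel₀ hq'.ne' h1
      exact mul_right_cancel₀ hp'.ne' (add_left_cancel h2)
    obtain ⟨⟨x₂, x₁⟩, u⟩ := T
    obtain ⟨⟨x₂', x₁'⟩, u'⟩ := T'
    simp only at hL
    obtain rfl : x₁ = x₁' := eq_of_fst_eq <| by
      rw [← AllTriangles.coe_lift₁ hq hp hm hr ⟨⟨x₂, x₁⟩, u⟩,
        ← AllTriangles.coe_lift₁ hq hp hm hr ⟨⟨x₂', x₁'⟩, u'⟩, hL]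
    obtain rfl : x₂ = x₂' := eq_of_fst_eq <| by
      rw [← AllTriangles.coe_lift₂ hq hp hm hr ⟨⟨x₂, x₁⟩, u⟩,
        ← AllTriangles.coe_lift₂ hq hp hm hr ⟨⟨x₂', x₁⟩, u'⟩, hL]
    have : u = u' := HolTriangle.eq_of_map_eq <| funext fun w => by
      rw [u.map_eq hq hp hm (fst_eq_of_mem hy.1 hr), u'.map_eq hq hp hm (fst_eq_of_mem hy.1 hr), hL]
    rw [this]
  · obtain ⟨e, he⟩ := exists_lift hy hr
    set L : ℝ := (e₁ / q - r) / p with hL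
    have h1 : q * (r + L * p) = e₁ := by
      rw [hL]
      field_simp
      ring
    have h2 : p * (r - L * q) = (e - e₁ : ℤ) := by
      push_cast
      rw [← he, ← h1, hm']
      ring
    have m₁ : (((r + L * p : ℝ) : UnitAddCircle), (0 : UnitAddCircle)) ∈ lagr 0 ∩ lagr q := by
      refine ⟨by rw [mem_lagr]; simp, ?_⟩
      rw [mem_lagr, ← AddCircle.coe_zsmul, zsmul_eq_mul, h1, ← AddCircle.coe_neg]
      exact (coe_eq_zero_iff_exists_int.mpr ⟨-e₁, by simp⟩).symm
    have m₂ : (((r - L * q : ℝ) : UnitAddCircle), -(q • ((r - L * q : ℝ) : UnitAddCircle))) ∈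
        lagr q ∩ lagr m := by
      refine ⟨by rw [mem_lagr], ?_⟩
      have h3 : p • ((r - L * q : ℝ) : UnitAddCircle) = 0 := by
        rw [← AddCircle.coe_zsmul, zsmul_eq_mul, h2]
        exact coe_eq_zero_iff_exists_int.mpr ⟨_, rfl⟩
      rw [mem_lagr, hm, add_smul, h3, add_zero]
    obtain ⟨u, hu⟩ := HolTriangle.exists_of_scale hq hp hm hy m₁ m₂ hr rfl rfl
    refine ⟨⟨⟨⟨_, m₂⟩, ⟨_, m₁⟩⟩, u⟩, ?_⟩
    have h4 := hidx ⟨⟨⟨_, m₂⟩, ⟨_, m₁⟩⟩, u⟩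
    simp only [hu, h1] at h4
    exact_mod_cast h4.symm

end Enumeration

/-! ### Weighted counts of triangles and products of series -/

section Product

variable {R Λ : Type*} [CommRing R] [CommRing Λ] [Algebra R Λ] [TopologicalSpace Λ]

/-- The monomials `P m e` (with exponents `o m e`) are quadratic in `e` up to bounded terms, and
convert the weights of triangles to products: the weight of a triangle is the quotient of
`P q e₁ * P p e₂` by `P (q + p) (e₁ + e₂)`, where `e₁ / q`, `e₂ / p` and `(e₁ + e₂) / (q + p)` are
compatible lifts of the corners. -/
structure IsThetaSystem (V : ℝ → AddSubgroup Λ) (s : Λ ≃ₐ[R] Λ) (W : TriangleWeight R)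
    (P : ℕ+ → ℤ → R) (o : ℕ+ → ℤ → ℝ) (c : ℝ) : Prop where
  filtration : IsAdicFiltration V s
  smul_mem : ∀ {m e N x}, P m e • x ∈ V (N + o m e) ↔ x ∈ V N
  growth : ∀ m, ∃ B : ℝ, ∀ e : ℤ, |o m e - ((e : ℝ) ^ 2 / (2 * (m : ℕ)) - c * e)| ≤ B
  isUnit : ∀ (m : ℕ+) (k : ℕ), k < m → IsUnit (P m k)
  weight : ∀ (q p : ℕ+) {m : ℤ}, m = q + p → ∀ {y x₁ x₂ : Torus}
    (u : HolTriangle 0 q m y x₁ x₂) {r : ℝ}, toTorus r = y → ∀ {e₁ e₂ : ℤ},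
    (q : ℕ) * (r + u.scale p * (p : ℕ)) = e₁ → (p : ℕ) * (r - u.scale p * (q : ℕ)) = e₂ →
    W u * P (q + p) (e₁ + e₂) = P q e₁ * P p e₂

/-- The series `∑_e P m e · v(e/m) z^e` attached to a cochain `v`. -/
def cochainSeries (s : Λ ≃ₐ[R] Λ) (P : ℕ+ → ℤ → R) (m : ℕ+) : CF s 0 m →ₗ[R] (ℤ → Λ) :=
  LinearMap.pi fun e => P m e • cochainValue m e

omit [TopologicalSpace Λ] in
theorem cochainSeries_apply (s : Λ ≃ₐ[R] Λ) (P : ℕ+ → ℤ → R) (m : ℕ+) (v : CF s 0 m) (e : ℤ) :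
    cochainSeries s P m v e = P m e • cochainValue m e v := rfl

omit [TopologicalSpace Λ] in
/-- Parallel transport along the sides of a triangle evaluates the factors at the lifts of the corners
that are reached from `r`. -/
theorem stalkEval_coupling {s : Λ ≃ₐ[R] Λ} {q p m : ℤ} (hq : 0 < q) (hp : 0 < p) (hm : m = q + p)
    {y x₁ x₂ : Torus} (u : HolTriangle 0 q m y x₁ x₂) (b : Stalk s x₂.1) (a : Stalk s x₁.1)
    {r : ℝ} (hr : (r : UnitAddCircle) = y.1)
    (h₁ : ((r + u.scale p * p : ℝ) : UnitAddCircle) = x₁.1)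
    (h₂ : ((r - u.scale p * q : ℝ) : UnitAddCircle) = x₂.1) :
    stalkEval s r hr (u.coupling s b a) = stalkEval s _ h₂ b * stalkEval s _ h₁ a := by
  have hm' : (m : ℝ) = q + p := by exact_mod_cast hm
  obtain ⟨s0, s1, s2⟩ := u.shift_eq hq hp hm
  have e1 : ∀ (t : ℝ) (ht : (t : UnitAddCircle) = x₁.1), t = r + u.scale p * p →
      a.1 ⟨t, ht⟩ = stalkEval s _ h₁ a := by
    rintro t ht rfl
    rfl
  have e2 : ∀ (t : ℝ) (ht : (t : UnitAddCircle) = x₂.1), t = r - u.scale p * q →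
      b.1 ⟨t, ht⟩ = stalkEval s _ h₂ b := by
    rintro t ht rfl
    rfl
  rw [← e1 (r - u.shift 2 - u.shift 1) (by
      rw [s1, s2, ← h₁]; congr 1; rw [hm']; ring) (by rw [s1, s2, hm']; ring),
    ← e2 (r - u.shift 2) (by rw [s2, ← h₂]) (by rw [s2])]
  change b.1 _ * (a.1 _ * 1) = _
  rw [mul_one]

namespace IsThetaSystem

variable {V : ℝ → AddSubgroup Λ} {s : Λ ≃ₐ[R] Λ} {W : TriangleWeight R} {P : ℕ+ → ℤ → R}
  {o : ℕ+ → ℤ → ℝ} {c : ℝ}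

/-- The contribution of a single triangle to the product of two cochains, read off at the lift `r`
of its corner `y`. -/
theorem smul_stalkEval_coupling (h : IsThetaSystem V s W P o c) (q p : ℕ+) {m : ℤ} (hm : m = q + p)
    {y x₁ x₂ : Torus} (u : HolTriangle 0 q m y x₁ x₂) (b : Stalk s x₂.1) (a : Stalk s x₁.1)
    {r : ℝ} (hr : (r : UnitAddCircle) = y.1) (hy : toTorus r = y)
    (h₁ : ((r + u.scale p * (p : ℕ) : ℝ) : UnitAddCircle) = x₁.1)
    (h₂ : ((r - u.scale p * (q : ℕ) : ℝ) : UnitAddCircle) = x₂.1) {e₁ e₂ : ℤ}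
    (he₁ : (q : ℕ) * (r + u.scale p * (p : ℕ)) = e₁)
    (he₂ : (p : ℕ) * (r - u.scale p * (q : ℕ)) = e₂) :
    P (q + p) (e₁ + e₂) • stalkEval s r hr (W u • u.coupling s b a) =
      (P q e₁ • stalkEval s _ h₁ a) * (P p e₂ • stalkEval s _ h₂ b) := by
  have hq : (0 : ℤ) < (q : ℕ) := by exact_mod_cast q.pos
  have hp : (0 : ℤ) < (p : ℕ) := by exact_mod_cast p.pos
  rw [map_smul, smul_smul, mul_comm (P _ _), h.weight q p hm u hy he₁ he₂,
    stalkEval_coupling hq hp hm u b a hr (by simpa using h₁) (by simpa using h₂)]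
  rw [smul_mul_smul_comm, mul_comm (stalkEval s _ _ b)]
  rfl

theorem exists_order_bound (h : IsThetaSystem V s W P o c) (m : ℕ+) :
    ∃ δ > 0, ∃ B : ℝ, ∀ e : ℤ, δ * (e : ℝ) ^ 2 - B ≤ o m e := by
  obtain ⟨B, hB⟩ := h.growth m
  have hm : (0 : ℝ) < (m : ℕ) := by exact_mod_cast m.pos
  refine ⟨1 / (4 * (m : ℕ)), by positivity, B + c ^ 2 * (m : ℕ), fun e => ?_⟩
  have h1 := (abs_le.mp (hB e)).1
  -- the difference of the two sides is the square of `e / 2 - c m`, up to a positive factor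
  have h2 : (e : ℝ) ^ 2 / (2 * (m : ℕ)) - c * e =
      1 / (4 * (m : ℕ)) * (e : ℝ) ^ 2 - c ^ 2 * (m : ℕ) + (e / 2 - c * (m : ℕ)) ^ 2 / (m : ℕ) := by
    field_simp
    ring
  have h3 : 0 ≤ ((e : ℝ) / 2 - c * (m : ℕ)) ^ 2 / (m : ℕ) := by positivity
  linarith

theorem rapidDecay_cochainSeries (h : IsThetaSystem V s W P o c) {m : ℕ+} (v : CF s 0 m) :
    RapidDecay V (cochainSeries s P m v) := by
  obtain ⟨N, hN⟩ := exists_bound h.filtration v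
  obtain ⟨δ, hδ, B, hB⟩ := h.exists_order_bound m
  refine ⟨δ, hδ, B - N, fun e => h.filtration.anti ?_ (h.smul_mem.mpr (hN e))⟩
  linarith [hB e]

/-- The triangles with three given corners are among those that `AllTriangles.exists_equiv` enumerates
by integers `e₁`, and their contributions decay like `t ^ (δ e₁²)`. -/
theorem summable_triangles (h : IsThetaSystem V s W P o c) (q p : ℕ+) {m : ℤ} (hm : m = q + p)
    {y x₁ x₂ : Torus} (hy : y ∈ lagr 0 ∩ lagr m) (h₁ : x₁ ∈ lagr 0 ∩ lagr q)
    (h₂ : x₂ ∈ lagr q ∩ lagr m) (b : Stalk s x₂.1) (a : Stalk s x₁.1) :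
    Summable fun u : HolTriangle 0 q m y x₁ x₂ => W u • u.coupling s b a := by
  have hq : (0 : ℤ) < (q : ℕ) := by exact_mod_cast q.pos
  have hp : (0 : ℤ) < (p : ℕ) := by exact_mod_cast p.pos
  have hmR : (m : ℝ) = (q : ℕ) + (p : ℕ) := by exact_mod_cast hm
  obtain ⟨r, hr⟩ := QuotientAddGroup.mk_surjective y.1
  have hr : (r : UnitAddCircle) = y.1 := hr
  obtain ⟨e, he⟩ := exists_lift hy hr
  obtain ⟨E, hE⟩ := AllTriangles.exists_equiv hq hp hm hy hr
  rw [h.filtration.summable_stalk hr]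
  let T : HolTriangle 0 q m y x₁ x₂ → AllTriangles q m y := fun u => ⟨(⟨x₂, h₂⟩, ⟨x₁, h₁⟩), u⟩
  have hT : Function.Injective T := fun u u' h => eq_of_heq (Sigma.mk.inj h).2
  obtain ⟨ra, hra⟩ := QuotientAddGroup.mk_surjective x₁.1
  obtain ⟨rb, hrb⟩ := QuotientAddGroup.mk_surjective x₂.1
  obtain ⟨Na, hNa⟩ := h.filtration.exhaust (stalkEval s ra hra a)
  obtain ⟨Nb, hNb⟩ := h.filtration.exhaust (stalkEval s rb hrb b)
  obtain ⟨δ, hδ, B, hB⟩ := h.exists_order_bound q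
  obtain ⟨δ', hδ', B', hB'⟩ := h.exists_order_bound p
  refine h.filtration.summable _ fun N => ?_
  refine ((finite_setOf_sq_lt hδ (B + B' - Na - Nb + N + o (q + p) e)).preimage
    ((E.injective.comp hT).injOn)).subset fun u hu => ?_
  by_contra hn
  refine hu ?_
  have l₁ : ((r + u.scale p * (p : ℕ) : ℝ) : UnitAddCircle) = x₁.1 := by
    simpa only [Int.cast_natCast] using AllTriangles.coe_lift₁ hq hp hm hr (T u)
  have l₂ : ((r - u.scale p * (q : ℕ) : ℝ) : UnitAddCircle) = x₂.1 := by
    simpa only [Int.cast_natCast] using AllTriangles.coe_lift₂ hq hp hm hr (T u)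
  have e₁ : (q : ℕ) * (r + u.scale p * (p : ℕ)) = E (T u) := by
    simpa only [Int.cast_natCast] using hE (T u)
  have e₂ : (p : ℕ) * (r - u.scale p * (q : ℕ)) = (e - E (T u) : ℤ) := by
    push_cast
    linear_combination he - e₁ - r * hmR
  have key := h.smul_stalkEval_coupling q p hm u b a hr (fst_eq_of_mem hy.1 hr)
    l₁ l₂ e₁ e₂
  rw [add_sub_cancel] at key
  rw [← h.smul_mem (m := q + p) (e := e), key]
  refine h.filtration.anti ?_ (h.filtration.mul_mem
    (h.smul_mem.mpr ((h.filtration.stalkEval_mem hra _).mp hNa))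
    (h.smul_mem.mpr ((h.filtration.stalkEval_mem hrb _).mp hNb)))
  have h3 : B + B' - Na - Nb + N + o (q + p) e ≤ δ * (E (T u) : ℝ) ^ 2 := not_lt.mp hn
  have h4 := hB (E (T u))
  have h5 := hB' (e - E (T u))
  have h6 : 0 ≤ δ' * ((e - E (T u) : ℤ) : ℝ) ^ 2 := by positivity
  linarith

theorem triangleSumsConverge (h : IsThetaSystem V s W P o c) : TriangleSumsConverge s W :=
  fun q p y x₁ x₂ b a => h.summable_triangles q p rfl y.2 x₁.2 x₂.2 b a

/-- The triangle product corresponds to the formal product of series: after a lift `r` of the corner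
`y` has been chosen, the triangles correspond to the terms of the product. -/
theorem smul_stalkEval_triangleProduct (h : IsThetaSystem V s W P o c) (q p : ℕ+) {m : ℤ}
    (hm : m = q + p) (hm' : m = p + q) (v : CF s 0 p) (w : CF s 0 q) (y : ↥(lagr 0 ∩ lagr m))
    {r : ℝ} (hr : (r : UnitAddCircle) = y.1.1) {e : ℤ} (he : m * r = e) :
    P (q + p) e • stalkEval s r hr
        (triangleProduct s W (dehnCF s q (zero_add _).symm hm' v) w y) =
      seriesMul (cochainSeries s P q w) (cochainSeries s P p v) e := by
  have := h.filtration.isTopologicalAddGroup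
  have := h.filtration.t2Space
  have := h.filtration.continuousConstSMul
  have hq : (0 : ℤ) < (q : ℕ) := by exact_mod_cast q.pos
  have hp : (0 : ℤ) < (p : ℕ) := by exact_mod_cast p.pos
  have hmR : (m : ℝ) = (q : ℕ) + (p : ℕ) := by exact_mod_cast hm
  set g := dehnCF s q (m := 0) (zero_add _).symm hm' v with hg
  obtain ⟨E, hE⟩ := AllTriangles.exists_equiv hq hp hm y.2 hr
  have hterm : ∀ T : AllTriangles q m y,
      P (q + p) e • stalkEval s r hr (W T.2 • T.2.coupling s (g T.1.1) (w T.1.2)) =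
        cochainSeries s P q w (E T) * cochainSeries s P p v (e - E T) := by
    intro T
    have l₁ : ((r + T.2.scale p * (p : ℕ) : ℝ) : UnitAddCircle) = T.1.2.1.1 := by
      simpa only [Int.cast_natCast] using AllTriangles.coe_lift₁ hq hp hm hr T
    have l₂ : ((r - T.2.scale p * (q : ℕ) : ℝ) : UnitAddCircle) = T.1.1.1.1 := by
      simpa only [Int.cast_natCast] using AllTriangles.coe_lift₂ hq hp hm hr T
    have e₁ : (q : ℕ) * (r + T.2.scale p * (p : ℕ)) = E T := by
      simpa only [Int.cast_natCast] using hE T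
    have e₂ : (p : ℕ) * (r - T.2.scale p * (q : ℕ)) = (e - E T : ℤ) := by
      push_cast
      linear_combination he - e₁ - r * hmR
    have key := h.smul_stalkEval_coupling q p hm T.2 (g T.1.1) (w T.1.2) hr
      (fst_eq_of_mem y.2.1 hr) l₁ l₂ e₁ e₂
    rw [add_sub_cancel] at key
    rw [key, cochainSeries_apply, cochainSeries_apply,
      cochainValue_eq (x := T.1.2) l₁ e₁,
      cochainValue_eq (x := ⟨dehn (-q) T.1.1, dehn_mem (zero_add _).symm T.1.1.2.1,
        dehn_mem hm' T.1.1.2.2⟩) l₂ e₂]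
    rfl
  set G : ℤ → Λ := fun i => cochainSeries s P q w i * cochainSeries s P p v (e - i) with hG
  have hGsum : HasSum G (seriesMul (cochainSeries s P q w) (cochainSeries s P p v) e) :=
    ((h.rapidDecay_cochainSeries w).converges h.filtration (h.rapidDecay_cochainSeries v) e).hasSum
  have hsum : HasSum (fun T : AllTriangles q m y =>
      P (q + p) e • stalkEval s r hr (W T.2 • T.2.coupling s (g T.1.1) (w T.1.2)))
      (seriesMul (cochainSeries s P q w) (cochainSeries s P p v) e) := by
    rw [funext hterm]
    exact (E.hasSum_iff (f := G)).mpr hGsum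
  have : Fintype ↥(lagr q ∩ lagr m) := (finite_lagr_inter (by omega)).fintype
  have : Fintype ↥(lagr 0 ∩ lagr q) := (finite_lagr_inter (by omega)).fintype
  have hsummable := fun (x₂ : ↥(lagr q ∩ lagr m)) (x₁ : ↥(lagr 0 ∩ lagr q)) =>
    h.summable_triangles q p hm y.2 x₁.2 x₂.2 (g x₂) (w x₁)
  have hfib := hsum.sigma (g := fun x => P (q + p) e • stalkEval s r hr
      (∑' u : HolTriangle 0 q m y x.2 x.1, W u • u.coupling s (g x.1) (w x.2))) fun x =>
    ((hsummable x.1 x.2).hasSum.map (stalkEval s r hr)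
      (continuous_stalkEval r hr)).const_smul (P (q + p) e)
  rw [hfib.unique (hasSum_fintype _), triangleProduct, finsum_eq_sum_of_fintype]
  simp only [finsum_eq_sum_of_fintype]
  rw [Fintype.sum_prod_type, map_sum, Finset.smul_sum]
  refine Finset.sum_congr rfl fun x₂ _ => ?_
  rw [map_sum, Finset.smul_sum]

theorem cochainSeries_triangleProduct (h : IsThetaSystem V s W P o c) (q p : ℕ+)
    (hm : (((q + p : ℕ+) : ℕ) : ℤ) = p + q) (v : CF s 0 p) (w : CF s 0 q) :
    cochainSeries s P (q + p) (triangleProduct s W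
        (dehnCF s q (m := 0) (n := p) (m' := q) (n' := ((q + p : ℕ+) : ℕ))
          (zero_add _).symm hm v) w) =
      seriesMul (cochainSeries s P q w) (cochainSeries s P p v) := by
  funext e
  have hne : (((q + p : ℕ+) : ℕ) : ℝ) ≠ 0 := by exact_mod_cast (q + p).ne_zero
  rw [← h.smul_stalkEval_triangleProduct q p (hm.trans (add_comm _ _)) hm v w (point (q + p) e)
    (point_fst (q + p) e) (e := e) (by push_cast at hne ⊢; field_simp)]
  rfl

end IsThetaSystem

end Product

/-! ### The ring of theta series -/

section Main

variable {R Λ : Type*} [CommRing R] [CommRing Λ] [Algebra R Λ]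

/-- The series attached to an element of the Floer ring. -/
def floerSeries (s : Λ ≃ₐ[R] Λ) (P : ℕ+ → ℤ → R) : FloerRing s →ₗ[R] (ℤ → Λ) :=
  DirectSum.toModule R ℕ+ _ fun m => cochainSeries s P m

open Classical in
theorem floerSeries_of (s : Λ ≃ₐ[R] Λ) (P : ℕ+ → ℤ → R) (m : ℕ+) (v : CF s 0 m) :
    floerSeries s P (DirectSum.of (fun m : ℕ+ => CF s 0 m) m v) = cochainSeries s P m v := by
  rw [← DirectSum.lof_eq_of R]
  exact DirectSum.toModule_lof (M := fun m : ℕ+ => CF s 0 m) R m v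

open Classical in
theorem floerSeries_eq_sum (s : Λ ≃ₐ[R] Λ) (P : ℕ+ → ℤ → R) (v : FloerRing s) :
    floerSeries s P v = ∑ m ∈ DFinsupp.support v, cochainSeries s P m (v m) := by
  conv_lhs => rw [← DirectSum.sum_support_of v]
  rw [map_sum]
  exact Finset.sum_congr rfl fun m _ => floerSeries_of s P m (v m)

theorem thetaSeries_mul_add (s : Λ ≃ₐ[R] Λ) (T : ℕ+ → ℕ → ℤ → R) (m : ℕ+) (k : ℕ) (a : Λ) (i : ℤ) :
    thetaSeries s T m k a (m * i + k) = T m k i • (s ^ i) a := by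
  have hm : ((m : ℕ) : ℤ) ≠ 0 := by exact_mod_cast m.ne_zero
  rw [thetaSeries, finsum_eq_single _ i fun j hj => ?_]
  · simp
  · have : ¬ ((m : ℕ) * j + k : ℤ) = (m : ℕ) * i + k := fun hc =>
      hj (mul_left_cancel₀ hm (add_right_cancel hc))
    simp [this]

theorem thetaSeries_of_forall_ne (s : Λ ≃ₐ[R] Λ) (T : ℕ+ → ℕ → ℤ → R) {m : ℕ+} {k : ℕ} (a : Λ)
    {e : ℤ} (he : ∀ i : ℤ, m * i + k ≠ e) : thetaSeries s T m k a e = 0 := by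
  simp [thetaSeries, he]

/-- The series `θ_{m,k}[a]`, as a linear function of `a`. -/
def thetaLinear (s : Λ ≃ₐ[R] Λ) (T : ℕ+ → ℕ → ℤ → R) (m : ℕ+) (k : ℕ) : Λ →ₗ[R] (ℤ → Λ) where
  toFun := thetaSeries s T m k
  map_add' a b := by
    funext e
    by_cases he : ∃ i : ℤ, m * i + k = e
    · obtain ⟨i, rfl⟩ := he
      simp [thetaSeries_mul_add]
    · push Not at he
      simp [thetaSeries_of_forall_ne s T _ he]
  map_smul' r a := by
    funext e
    by_cases he : ∃ i : ℤ, m * i + k = e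
    · obtain ⟨i, rfl⟩ := he
      simp [thetaSeries_mul_add, smul_comm r]
    · push Not at he
      simp [thetaSeries_of_forall_ne s T _ he]

/-- The series `θ_{m,k}[a]` is the series of the cochain `x_{m, k/m} · a`. -/
theorem cochainSeries_gen {s : Λ ≃ₐ[R] Λ} {P : ℕ+ → ℤ → R} {T : ℕ+ → ℕ → ℤ → R} {m : ℕ+} {k : ℕ}
    (hT : ∀ i, T m k i = P m (m * i + k)) (a : Λ) :
    cochainSeries s P m (cochainGen s m k a) = thetaSeries s T m k a := by
  funext e
  rw [cochainSeries_apply]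
  by_cases he : ∃ i : ℤ, m * i + k = e
  · obtain ⟨i, rfl⟩ := he
    rw [cochainValue_gen, thetaSeries_mul_add, hT]
  · push Not at he
    rw [cochainValue_gen_of_ne a he, smul_zero, thetaSeries_of_forall_ne s T a he]

/-- A series whose coefficients satisfy the quasi-periodicity of the series of cochains of degree `m`
is determined by `m` of its coefficients. -/
theorem cochainSeries_sum_gen {s : Λ ≃ₐ[R] Λ} {P : ℕ+ → ℤ → R} (m : ℕ+) {U : ℕ → R} {f : ℤ → Λ}
    (hf : ∀ k < (m : ℕ), ∀ i : ℤ, f (m * i + k) = P m (m * i + k) • (s ^ i) (U k • f k)) :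
    cochainSeries s P m (∑ k ∈ Finset.range m, cochainGen s m k (U k • f k)) = f := by
  funext e
  have hm : (0 : ℤ) < (m : ℕ) := by exact_mod_cast m.pos
  obtain ⟨k, hk⟩ := Int.eq_ofNat_of_zero_le (Int.emod_nonneg e hm.ne')
  have hkm : k < m := by
    have := Int.emod_lt_of_pos e hm
    omega
  have he : (m : ℕ) * (e / (m : ℕ)) + (k : ℤ) = e := by
    rw [← hk]
    exact Int.mul_ediv_add_emod e _
  rw [← he, hf k hkm, cochainSeries_apply, map_sum,
    Finset.sum_eq_single_of_mem k (Finset.mem_range.mpr hkm), cochainValue_gen]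
  intro l hl hlk
  refine cochainValue_gen_of_ne _ fun i hi => hlk ?_
  have h1 := congrArg (· % ((m : ℕ) : ℤ)) hi
  simp only [Int.mul_add_emod_self_left] at h1
  have hl' := Finset.mem_range.mp hl
  rw [Int.emod_eq_of_lt (by omega) (by omega), Int.emod_eq_of_lt (by omega) (by omega)] at h1
  exact_mod_cast h1

/-- The series of cochains are characterized by conditions relating pairs of coefficients, which
shows that they form a closed set. -/
theorem mem_range_cochainSeries {s : Λ ≃ₐ[R] Λ} {P : ℕ+ → ℤ → R} (m : ℕ+) {U : ℕ → R}
    (hU : ∀ k < (m : ℕ), U k * P m k = 1) {f : ℤ → Λ} :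
    f ∈ LinearMap.range (cochainSeries s P m) ↔
      ∀ k < (m : ℕ), ∀ i : ℤ, f (m * i + k) = P m (m * i + k) • (s ^ i) (U k • f k) := by
  constructor
  · rintro ⟨v, rfl⟩ k hk i
    rw [cochainSeries_apply, cochainSeries_apply, smul_smul, hU k hk, one_smul, cochainValue_add_mul]
  · exact fun hf => ⟨_, cochainSeries_sum_gen m hf⟩

variable [TopologicalSpace Λ]

namespace IsThetaSystem

variable {V : ℝ → AddSubgroup Λ} {s : Λ ≃ₐ[R] Λ} {W : TriangleWeight R} {P : ℕ+ → ℤ → R}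
  {o : ℕ+ → ℤ → ℝ} {c : ℝ}

theorem rapidDecay_floerSeries (h : IsThetaSystem V s W P o c) (v : FloerRing s) :
    RapidDecay V (floerSeries s P v) := by
  classical
  rw [floerSeries_eq_sum]
  exact RapidDecay.sum h.filtration _ fun m _ => h.rapidDecay_cochainSeries _

theorem floerSeries_floerMul (h : IsThetaSystem V s W P o c) (v w : FloerRing s) :
    floerSeries s P (floerMul s W v w) = seriesMul (floerSeries s P v) (floerSeries s P w) := by
  classical
  rw [floerSeries_eq_sum s P v, floerSeries_eq_sum s P w,
    RapidDecay.sum_mul h.filtration _ (fun m _ => h.rapidDecay_cochainSeries _)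
      (RapidDecay.sum h.filtration _ fun m _ => h.rapidDecay_cochainSeries _), floerMul, map_sum]
  refine Finset.sum_congr (by congr!) fun p _ => ?_
  rw [RapidDecay.mul_sum h.filtration _ (fun m _ => h.rapidDecay_cochainSeries _)
    (h.rapidDecay_cochainSeries _), map_sum]
  refine Finset.sum_congr (by congr!) fun q _ => ?_
  rw [floerSeries_of, h.cochainSeries_triangleProduct q p, RapidDecay.mul_comm]

theorem tendsto_order_sub (h : IsThetaSystem V s W P o c) {m M : ℕ+} (hmM : m < M) :
    Filter.Tendsto (fun e : ℤ => o m e - o M e) Filter.atTop Filter.atTop := by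
  obtain ⟨B, hB⟩ := h.growth m
  obtain ⟨B', hB'⟩ := h.growth M
  have hm : (0 : ℝ) < (m : ℕ) := by exact_mod_cast m.pos
  have hM : ((m : ℕ) : ℝ) < (M : ℕ) := by exact_mod_cast hmM
  set δ : ℝ := 1 / (2 * (m : ℕ)) - 1 / (2 * (M : ℕ)) with hδ
  have hδ0 : 0 < δ := sub_pos.mpr (one_div_lt_one_div_of_lt (by linarith) (by linarith))
  have h1 : Filter.Tendsto (fun e : ℤ => δ * (e : ℝ) ^ 2 + -(B + B')) Filter.atTop Filter.atTop :=
    Filter.tendsto_atTop_add_const_right _ _ (Filter.Tendsto.const_mul_atTop hδ0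
      ((Filter.tendsto_pow_atTop two_ne_zero).comp tendsto_intCast_atTop_atTop))
  refine Filter.tendsto_atTop_mono (fun e => ?_) h1
  have a1 := (abs_le.mp (hB e)).1
  have a2 := (abs_le.mp (hB' e)).2
  have a3 : δ * (e : ℝ) ^ 2 = (e : ℝ) ^ 2 / (2 * (m : ℕ)) - (e : ℝ) ^ 2 / (2 * (M : ℕ)) := by
    rw [hδ]
    ring
  linarith

/-- The series of cochains of different degrees are linearly independent: the coefficients in
higher degree tend to zero more slowly. -/
theorem floerSeries_injective (h : IsThetaSystem V s W P o c) :
    Function.Injective (floerSeries s P) := by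
  classical
  rw [injective_iff_map_eq_zero]
  intro v hv
  by_contra hne
  have hS : (DFinsupp.support v).Nonempty := by
    rw [Finset.nonempty_iff_ne_empty, Ne, DFinsupp.support_eq_empty]
    exact hne
  set M := (DFinsupp.support v).max' hS with hM
  have hMS : M ∈ DFinsupp.support v := Finset.max'_mem _ hS
  refine DFinsupp.mem_support_iff.mp hMS (cochain_ext fun k hk => ?_)
  rw [map_zero]
  refine h.filtration.eq_zero _ fun N => ?_
  choose K hK using fun m => exists_bound h.filtration (v m)
  -- far out, the orders in all lower degrees exceed the order in degree `M`
  have hev : ∀ᶠ i : ℤ in Filter.atTop, ∀ m ∈ (DFinsupp.support v).erase M,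
      N - K m ≤ o m (M * i + k) - o M (M * i + k) := by
    rw [Filter.eventually_all_finset]
    intro m hm
    have hlt : m < M := lt_of_le_of_ne (Finset.le_max' _ _ (Finset.mem_of_mem_erase hm))
      (Finset.ne_of_mem_erase hm)
    have hMpos : (0 : ℤ) < (M : ℕ) := by exact_mod_cast M.pos
    have ht : Filter.Tendsto (fun i : ℤ => (M : ℕ) * i + (k : ℤ)) Filter.atTop Filter.atTop :=
      Filter.tendsto_atTop_add_const_right _ _ (Filter.tendsto_id.const_mul_atTop' hMpos)
    exact ((h.tendsto_order_sub hlt).comp ht).eventually_ge_atTop _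
  obtain ⟨i, hi⟩ := hev.exists
  have h0 := congrFun hv (M * i + k)
  rw [floerSeries_eq_sum, ← Finset.add_sum_erase _ _ hMS, Pi.add_apply, Finset.sum_apply,
    Pi.zero_apply, cochainSeries_apply, cochainValue_add_mul] at h0
  rw [← h.filtration.zpow_mem i, ← h.smul_mem (m := M) (e := M * i + k), eq_neg_of_add_eq_zero_left h0]
  refine (V _).neg_mem ((V _).sum_mem fun m hm => ?_)
  refine h.filtration.anti ?_ (h.smul_mem.mpr (hK m (M * i + k)))
  linarith [hi m hm]

theorem isCommRng (h : IsThetaSystem V s W P o c) : IsCommRng (floerMul s W) where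
  left_distrib u v w := h.floerSeries_injective <| by
    simp only [map_add, h.floerSeries_floerMul]
    exact RapidDecay.mul_add h.filtration (h.rapidDecay_floerSeries _) (h.rapidDecay_floerSeries _)
      (h.rapidDecay_floerSeries _)
  right_distrib u v w := h.floerSeries_injective <| by
    simp only [map_add, h.floerSeries_floerMul]
    exact RapidDecay.add_mul h.filtration (h.rapidDecay_floerSeries _) (h.rapidDecay_floerSeries _)
      (h.rapidDecay_floerSeries _)
  assoc u v w := h.floerSeries_injective <| by
    simp only [h.floerSeries_floerMul]
    exact RapidDecay.mul_assoc h.filtration (h.rapidDecay_floerSeries _)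
      (h.rapidDecay_floerSeries _) (h.rapidDecay_floerSeries _)
  comm u v := h.floerSeries_injective <| by
    simp only [h.floerSeries_floerMul]
    exact RapidDecay.mul_comm _ _

theorem continuous_thetaLinear (h : IsAdicFiltration V s) (T : ℕ+ → ℕ → ℤ → R) (m : ℕ+) (k : ℕ) :
    Continuous (thetaLinear s T m k) := by
  have := h.continuousConstSMul
  refine continuous_pi fun e => ?_
  change Continuous fun a => thetaSeries s T m k a e
  by_cases he : ∃ i : ℤ, m * i + k = e
  · obtain ⟨i, rfl⟩ := he
    simp only [thetaSeries_mul_add]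
    exact (h.continuous_zpow i).const_smul _
  · push Not at he
    simp only [thetaSeries_of_forall_ne s T _ he]
    exact continuous_const

/-- The series of cochains of degree `m` form the closed span of the theta series: they are
combinations of the theta series `θ_{m,k}[a]` with `a` in `Λ`, which lie in the closed span by
continuity in `a`, and they form a closed set. -/
theorem coe_range_cochainSeries (h : IsThetaSystem V s W P o c) {C : Type*} {const : C → Λ}
    (hconst : ∀ a, a ∈ closure (Submodule.span R (Set.range const) : Set Λ))
    {T : ℕ+ → ℕ → ℤ → R} (hT : ∀ (m : ℕ+) (k : ℕ), k < m → ∀ i, T m k i = P m (m * i + k))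
    (m : ℕ+) : (LinearMap.range (cochainSeries s P m) : Set (ℤ → Λ)) = thetaSpan const s T m := by
  have := h.filtration.isTopologicalAddGroup
  have := h.filtration.t2Space
  have := h.filtration.continuousConstSMul
  have hunit : ∀ k, ∃ U, k < (m : ℕ) → U * P m k = 1 := fun k => by
    by_cases hk : k < m
    · obtain ⟨U, hU⟩ := (h.isUnit m k hk).exists_left_inv
      exact ⟨U, fun _ => hU⟩
    · exact ⟨0, fun hk' => absurd hk' hk⟩
  choose U hU using hunit
  have hgen : ∀ k < (m : ℕ), ∀ a, cochainSeries s P m (cochainGen s m k a) = thetaSeries s T m k a :=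
    fun k hk a => cochainSeries_gen (hT m k hk) a
  apply Set.Subset.antisymm
  · have hθ : ∀ k < (m : ℕ), ∀ a, thetaSeries s T m k a ∈ thetaSpan const s T m := by
      intro k hk
      have hsub : (Submodule.span R (Set.range const)).map (thetaLinear s T m k) ≤
          Submodule.span R {θ | ∃ k < (m : ℕ), ∃ a : C, θ = thetaSeries s T m k (const a)} := by
        rw [Submodule.map_span]
        refine Submodule.span_mono ?_
        rintro _ ⟨_, ⟨a, rfl⟩, rfl⟩
        exact ⟨k, hk, a, rfl⟩
      intro a
      exact closure_mono hsub (image_closure_subset_closure_image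
        (continuous_thetaLinear h.filtration T m k) ⟨a, hconst a, rfl⟩)
    rintro f hf
    have key : f = ∑ k ∈ Finset.range m, thetaSeries s T m k (U k • f k) := by
      rw [SetLike.mem_coe, mem_range_cochainSeries m hU] at hf
      conv_lhs => rw [← cochainSeries_sum_gen m hf, map_sum]
      exact Finset.sum_congr rfl fun k hk => hgen k (Finset.mem_range.mp hk) _
    rw [key]
    exact Submodule.sum_mem (Submodule.topologicalClosure _) fun k hk =>
      hθ k (Finset.mem_range.mp hk) _
  · refine closure_minimal ?_ ?_
    · refine Submodule.span_le.mpr ?_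
      rintro _ ⟨k, hk, a, rfl⟩
      exact ⟨_, hgen k hk _⟩
    · have : (LinearMap.range (cochainSeries s P m) : Set (ℤ → Λ)) =
          ⋂ (k : ℕ) (_ : k < (m : ℕ)) (i : ℤ),
            {f | f (m * i + k) = P m (m * i + k) • (s ^ i) (U k • f k)} := by
        ext f
        rw [SetLike.mem_coe, mem_range_cochainSeries m hU]
        simp
      rw [this]
      refine isClosed_iInter fun k => isClosed_iInter fun _ => isClosed_iInter fun i =>
        isClosed_eq (continuous_apply _) ?_
      exact ((h.filtration.continuous_zpow i).comp ((continuous_apply _).const_smul _)).const_smul _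

theorem range_floerSeries (h : IsThetaSystem V s W P o c) {C : Type*} {const : C → Λ}
    (hconst : ∀ a, a ∈ closure (Submodule.span R (Set.range const) : Set Λ))
    {T : ℕ+ → ℕ → ℤ → R} (hT : ∀ (m : ℕ+) (k : ℕ), k < m → ∀ i, T m k i = P m (m * i + k)) :
    LinearMap.range (floerSeries s P) = thetaRing const s T := by
  classical
  apply le_antisymm
  · rintro _ ⟨v, rfl⟩
    rw [floerSeries_eq_sum]
    refine Submodule.sum_mem _ fun m _ => Submodule.subset_span (Set.mem_iUnion.mpr ⟨m, ?_⟩)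
    rw [← h.coe_range_cochainSeries hconst hT]
    exact ⟨_, rfl⟩
  · refine Submodule.span_le.mpr (Set.iUnion_subset fun m => ?_)
    rw [← h.coe_range_cochainSeries hconst hT]
    rintro _ ⟨v, rfl⟩
    exact ⟨_, floerSeries_of s P m v⟩

open Classical in
/-- All the assertions about one of the two cases, with the map to series as the isomorphism. -/
theorem floerRing_equiv_thetaRing (h : IsThetaSystem V s W P o c) {C : Type*} {const : C → Λ}
    (hconst : ∀ a, a ∈ closure (Submodule.span R (Set.range const) : Set Λ))
    {T : ℕ+ → ℕ → ℤ → R} (hT : ∀ (m : ℕ+) (k : ℕ), k < m → ∀ i, T m k i = P m (m * i + k)) :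
    TriangleSumsConverge s W ∧ IsCommRng (floerMul s W) ∧
      (∀ f ∈ thetaRing const s T, ∀ g ∈ thetaRing const s T,
        SeriesMulConverges f g ∧ seriesMul f g ∈ thetaRing const s T) ∧
      ∃ Φ : FloerRing s ≃ₗ[R] thetaRing const s T,
        (∀ (m : ℕ+) (k : ℕ), k < m → ∀ a : Λ,
          (Φ (floerGen s m k a) : ℤ → Λ) = thetaSeries s T m k a) ∧
        (∀ v w : FloerRing s,
          (Φ (floerMul s W v w) : ℤ → Λ) = seriesMul (Φ v : ℤ → Λ) (Φ w : ℤ → Λ)) ∧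
        (∀ (m : ℕ+) (f : ℤ → Λ), f ∈ thetaSpan const s T m ↔
          ∃ v : CF s 0 m, (Φ (DirectSum.of (fun m : ℕ+ => CF s 0 m) m v) : ℤ → Λ) = f) := by
  have hrange := h.range_floerSeries hconst hT
  refine ⟨h.triangleSumsConverge, h.isCommRng, ?_, ?_⟩
  · rw [← hrange]
    rintro _ ⟨v, rfl⟩ _ ⟨w, rfl⟩
    refine ⟨(h.rapidDecay_floerSeries v).converges h.filtration (h.rapidDecay_floerSeries w), ?_⟩
    exact ⟨_, h.floerSeries_floerMul v w⟩
  · have hΦ : ∀ v, ((LinearEquiv.ofInjective (floerSeries s P) h.floerSeries_injective).trans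
        (LinearEquiv.ofEq _ _ hrange) v : ℤ → Λ) = floerSeries s P v := fun v => rfl
    refine ⟨(LinearEquiv.ofInjective (floerSeries s P) h.floerSeries_injective).trans
        (LinearEquiv.ofEq _ _ hrange), fun m k hk a => ?_, fun v w => ?_, fun m f => ?_⟩
    · rw [hΦ, ← cochainSeries_gen (hT m k hk) a, ← floerSeries_of]
      rfl
    · rw [hΦ, hΦ, hΦ, h.floerSeries_floerMul]
    · simp only [hΦ, floerSeries_of]
      rw [← h.coe_range_cochainSeries hconst hT]
      rfl

end IsThetaSystem

end Main

/-! ### Filtrations by the exponents of `t` -/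

section Coeff

variable {R Λ C I : Type*} [CommRing R] [CommRing Λ] [Algebra R Λ] [CommRing C]

/-- The elements all of whose coefficients of exponent `< N` vanish. -/
def coeffFiltration (deg : I → ℝ) (cf : I → Λ →+ C) (N : ℝ) : AddSubgroup Λ where
  carrier := {x | ∀ i, deg i < N → cf i x = 0}
  zero_mem' := fun i _ => map_zero _
  add_mem' := fun ha hb i hi => by rw [map_add, ha i hi, hb i hi, add_zero]
  neg_mem' := fun ha i hi => by rw [map_neg, ha i hi, neg_zero]

theorem mem_coeffFiltration {deg : I → ℝ} {cf : I → Λ →+ C} {N : ℝ} {x : Λ} :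
    x ∈ coeffFiltration deg cf N ↔ ∀ i, deg i < N → cf i x = 0 := Iff.rfl

theorem sub_mem_coeffFiltration {deg : I → ℝ} {cf : I → Λ →+ C} {N : ℝ} {x y : Λ} :
    x - y ∈ coeffFiltration deg cf N ↔ ∀ i, deg i < N → cf i x = cf i y := by
  simp only [mem_coeffFiltration, map_sub, sub_eq_zero]

/-- The filtration by exponents of `t` is adic if the coefficients determine an element, and if a
family of coefficients belongs to an element whenever its truncations do. -/
theorem isAdicFiltration_coeffFiltration [TopologicalSpace Λ] {s : Λ ≃ₐ[R] Λ} (σ : C ≃+* C)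
    {deg : I → ℝ} {cf : I → Λ →+ C} (ext : ∀ x y, (∀ i, cf i x = cf i y) → x = y)
    (nhds_eq : ∀ x, 𝓝 x = ⨅ N : ℝ, Filter.principal {y | y - x ∈ coeffFiltration deg cf N})
    (exhaust : ∀ x, ∃ N, x ∈ coeffFiltration deg cf N)
    (mul_mem : ∀ {M N x y}, x ∈ coeffFiltration deg cf M → y ∈ coeffFiltration deg cf N →
      x * y ∈ coeffFiltration deg cf (M + N))
    (aut : ∀ i x, cf i (s x) = σ (cf i x))
    (complete : ∀ g : I → C, (∀ N, ∃ x, ∀ i, deg i < N → cf i x = g i) → ∃ x, ∀ i, cf i x = g i) :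
    IsAdicFiltration (coeffFiltration deg cf) s := by
  have anti : Antitone (coeffFiltration deg cf) := fun M N hMN x hx i hi =>
    hx i (hi.trans_le hMN)
  have basis : ∀ x : Λ, (𝓝 x).HasBasis (fun _ : ℝ => True)
      fun N => {y | y - x ∈ coeffFiltration deg cf N} := by
    intro x
    rw [nhds_eq]
    refine Filter.hasBasis_iInf_principal ?_
    intro M N
    exact ⟨max M N, fun y hy => anti (le_max_left M N) hy, fun y hy => anti (le_max_right M N) hy⟩
  refine ⟨anti, basis, fun x hx => ext x 0 fun i => ?_, exhaust, mul_mem, ?_, ?_⟩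
  · rw [map_zero]
    exact hx (deg i + 1) i (lt_add_one _)
  · intro N x
    simp only [mem_coeffFiltration, aut, EmbeddingLike.map_eq_zero_iff]
  · intro ι f hf
    -- the sum of the coefficients, for an exponent below `N`, over a finite set of indices
    have hsum : ∀ (N : ℝ) (S : Finset ι), (hf N).toFinset ⊆ S → ∀ i, deg i < N →
        cf i (∑ j ∈ S, f j) = ∑ᶠ j, cf i (f j) := by
      intro N S hS i hi
      rw [map_sum, finsum_eq_sum_of_support_subset]
      intro j hj
      refine hS ((hf N).mem_toFinset.mpr fun hc => hj (hc i hi))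
    obtain ⟨x, hx⟩ := complete (fun i => ∑ᶠ j, cf i (f j)) fun N => ⟨_, hsum N _ subset_rfl⟩
    refine ⟨x, ?_⟩
    refine ((basis x).tendsto_right_iff).mpr fun N _ => ?_
    filter_upwards [Filter.eventually_ge_atTop (hf N).toFinset] with S hS
    exact sub_mem_coeffFiltration.mpr fun i hi => (hsum N S hS i hi).trans (hx i).symm

end Coeff

/-! ### The relative case -/

section Relative

variable {C : Type*} [CommRing C]

/-- The filtration of `C⟦t⟧` by the powers of `t`. -/
abbrev powerSeriesFiltration (C : Type*) [CommRing C] : ℝ → AddSubgroup C⟦X⟧ :=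
  coeffFiltration (I := ℕ) (fun n => (n : ℝ)) fun n => (PowerSeries.coeff (R := C) n).toAddMonoidHom

theorem mem_powerSeriesFiltration {N : ℝ} {x : C⟦X⟧} :
    x ∈ powerSeriesFiltration C N ↔ ∀ n : ℕ, (n : ℝ) < N → PowerSeries.coeff n x = 0 := Iff.rfl

theorem nhds_powerSeries (x : C⟦X⟧) :
    𝓝 x = ⨅ N : ℝ, Filter.principal {y | y - x ∈ powerSeriesFiltration C N} := by
  let _ : TopologicalSpace C := ⊥
  have : DiscreteTopology C := ⟨rfl⟩
  apply le_antisymm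
  · refine le_iInf fun N => Filter.le_principal_iff.mpr ?_
    have h : ∀ᶠ y in 𝓝 x, ∀ n ∈ Finset.range ⌈N⌉₊, PowerSeries.coeff n y = PowerSeries.coeff n x := by
      rw [Filter.eventually_all_finset]
      intro n _
      have hc : Filter.Tendsto (PowerSeries.coeff (R := C) n) (𝓝 x) (𝓝 (PowerSeries.coeff n x)) :=
        (PowerSeries.WithPiTopology.continuous_coeff C n).continuousAt
      rwa [nhds_discrete C, Filter.tendsto_pure] at hc
    filter_upwards [h] with y hy
    exact sub_mem_coeffFiltration.mpr fun n hn => hy n (Finset.mem_range.mpr (Nat.lt_ceil.mpr hn))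
  · refine (PowerSeries.WithPiTopology.tendsto_iff_coeff_tendsto C id _ x).mpr fun d => ?_
    rw [nhds_discrete, Filter.tendsto_pure]
    refine Filter.mem_iInf_of_mem ((d : ℝ) + 1) fun y hy => ?_
    exact sub_mem_coeffFiltration.mp hy d (lt_add_one _)

theorem isAdicFiltration_powerSeries (σ : C ≃+* C) :
    IsAdicFiltration (powerSeriesFiltration C) (powerSeriesAut σ) := by
  refine isAdicFiltration_coeffFiltration σ (fun x y h => PowerSeries.ext h) nhds_powerSeries
    (fun x => ⟨0, fun n hn => absurd hn (not_lt.mpr n.cast_nonneg)⟩) ?_ ?_ ?_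
  · intro M N x y hx hy n hn
    change PowerSeries.coeff n (x * y) = 0
    rw [PowerSeries.coeff_mul]
    refine Finset.sum_eq_zero fun a ha => ?_
    have ha' : (a.1 : ℝ) + a.2 = n := by
      rw [← Finset.HasAntidiagonal.mem_antidiagonal.mp ha]
      push_cast
      rfl
    rcases lt_or_ge (a.1 : ℝ) M with h | h
    · rw [mem_powerSeriesFiltration.mp hx _ h, zero_mul]
    · rw [mem_powerSeriesFiltration.mp hy _ (by linarith), mul_zero]
  · intro n x
    change PowerSeries.coeff n (PowerSeries.map σ.toRingHom x) = _
    simp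
  · exact fun g _ => ⟨PowerSeries.mk g, fun i => PowerSeries.coeff_mk i g⟩

theorem mem_closure_span_C (a : C⟦X⟧) :
    a ∈ closure (Submodule.span ℤ⟦X⟧ (Set.range (PowerSeries.C (R := C))) : Set C⟦X⟧) := by
  rw [mem_closure_iff_nhds_basis ((isAdicFiltration_powerSeries (RingEquiv.refl C)).basis a)]
  intro N _
  refine ⟨∑ n ∈ Finset.range ⌈N⌉₊,
    (PowerSeries.X : ℤ⟦X⟧) ^ n • PowerSeries.C (PowerSeries.coeff n a), ?_, ?_⟩
  · exact Submodule.sum_mem _ fun n _ =>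
      Submodule.smul_mem _ _ (Submodule.subset_span ⟨_, rfl⟩)
  · refine sub_mem_coeffFiltration.mpr fun i hi => ?_
    simp only [LinearMap.toAddMonoidHom_coe]
    have hi' : i < ⌈N⌉₊ := Nat.lt_ceil.mpr hi
    rw [map_sum, Finset.sum_eq_single_of_mem i (Finset.mem_range.mpr hi')]
    · simp [Algebra.smul_def, RingHom.algebraMap_toAlgebra]
    · intro j _ hj
      simp [Algebra.smul_def, RingHom.algebraMap_toAlgebra]
      omega

/-- The exponent of `t` at `z ^ e` in the relative theta series of degree `m` is `relExp m e`, which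
differs from `e² / 2m - e / 2` by a bounded amount. -/
theorem isThetaSystem_relative (σ : C ≃+* C) {ε : ℝ} (hε : Irrational ε) :
    IsThetaSystem (powerSeriesFiltration C) (powerSeriesAut σ) (relWeight ε)
      (fun m e => PowerSeries.X ^ (relExp (m : ℕ) e).toNat) (fun m e => relExp (m : ℕ) e)
      (1 / 2) where
  filtration := isAdicFiltration_powerSeries σ
  smul_mem := by
    intro m e N x
    have hm : (0 : ℤ) < (m : ℕ) := by exact_mod_cast m.pos
    obtain ⟨n, hn⟩ := Int.eq_ofNat_of_zero_le (relExp_nonneg (m : ℕ) e)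
    rw [hn]
    simp only [mem_powerSeriesFiltration, Algebra.smul_def, RingHom.algebraMap_toAlgebra, map_pow,
      Int.toNat_natCast, Int.cast_natCast, PowerSeries.map_X,
      PowerSeries.coeff_X_pow_mul']
    constructor
    · intro h d hd
      simpa using h (d + n) (by push_cast; linarith)
    · intro h d hd
      split_ifs with hnd
      · exact h _ (by rw [Nat.cast_sub hnd]; linarith)
      · rfl
  growth := by
    intro m
    have hm : (0 : ℤ) < (m : ℕ) := by exact_mod_cast m.pos
    have hmR : (0 : ℝ) < (m : ℕ) := by exact_mod_cast m.pos
    refine ⟨(m : ℕ), fun e => ?_⟩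
    have h0 := Int.emod_nonneg e hm.ne'
    have h1 := Int.emod_lt_of_pos e hm
    have h2 := Int.mul_ediv_add_emod e (m : ℕ)
    have h3 := two_mul_relExp (e % (m : ℕ)) (e / (m : ℕ)) h0 h1
    rw [h2] at h3
    set k := e % (m : ℕ)
    set i := e / (m : ℕ)
    have h3' : (2 : ℝ) * relExp (m : ℕ) e = (m : ℕ) * (i * (i - 1)) + 2 * (k * i) := by
      exact_mod_cast h3
    have h2' : (e : ℝ) = (m : ℕ) * i + k := by exact_mod_cast h2.symm
    have h0' : (0 : ℝ) ≤ k := by exact_mod_cast h0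
    have h1' : (k : ℝ) < (m : ℕ) := by exact_mod_cast h1
    -- the difference only depends on the remainder of `e` modulo `m`
    have h4 : (relExp (m : ℕ) e : ℝ) - ((e : ℝ) ^ 2 / (2 * (m : ℕ)) - 1 / 2 * e) =
        (k / 2) * (1 - k / (m : ℕ)) := by
      rw [show (relExp (m : ℕ) e : ℝ) = ((m : ℕ) * (i * (i - 1)) + 2 * (k * i)) / 2 by linarith, h2']
      field_simp
      ring
    have h5 : (k : ℝ) / (m : ℕ) < 1 := (div_lt_one hmR).mpr h1'
    have h6 : 0 ≤ (k : ℝ) / (m : ℕ) := by positivity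
    rw [h4, abs_of_nonneg (mul_nonneg (by linarith) (by linarith))]
    nlinarith
  isUnit := by
    intro m k hk
    have h := relExp_eq (m := (m : ℕ)) (k : ℤ) 0 (by omega) (by omega)
    simp at h
    simp [h]
  weight := by
    intro q p m hm y x₁ x₂ u r hy e₁ e₂ h₁ h₂
    have hq : (0 : ℤ) < (q : ℕ) := by exact_mod_cast q.pos
    have hp : (0 : ℤ) < (p : ℕ) := by exact_mod_cast p.pos
    have ha := u.areaZ_eq_card hq hp hm hy (by simpa using h₁) (by simpa using h₂)
    have hc := card_trianglePoints hq hp e₁ e₂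
    have n0 := relExp_nonneg ((q : ℕ) + (p : ℕ) : ℤ) (e₁ + e₂)
    have n1 := relExp_nonneg (q : ℕ) e₁
    have n2 := relExp_nonneg (p : ℕ) e₂
    simp only [relWeight, u.sign_eq_one hε hq hp hm, one_smul, ← pow_add, PNat.add_coe, Nat.cast_add]
    congr 1
    omega

theorem relThetaPower_eq (m : ℕ+) (k : ℕ) (hk : k < m) (i : ℤ) :
    relThetaPower m k i = PowerSeries.X ^ (relExp (m : ℕ) (m * i + k)).toNat := by
  rw [relExp_eq (k : ℤ) i (by omega) (by omega), relThetaPower]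

end Relative

/-! ### The absolute case -/

section Absolute

variable {C : Type*} [CommRing C]

/-- The coefficient of `t^l`. -/
def novikovCoeff (l : ℝ) : Novikov C →+ C where
  toFun x := x.1.coeff l
  map_zero' := rfl
  map_add' _ _ := rfl

/-- The filtration of the Novikov ring by the powers of `t`. -/
abbrev novikovFiltration (C : Type*) [CommRing C] : ℝ → AddSubgroup (Novikov C) :=
  coeffFiltration (I := ℝ) id novikovCoeff

theorem mem_novikovFiltration {N : ℝ} {x : Novikov C} :
    x ∈ novikovFiltration C N ↔ ∀ l : ℝ, l < N → x.1.coeff l = 0 := Iff.rfl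

theorem nhds_novikov (x : Novikov C) :
    𝓝 x = ⨅ N : ℝ, Filter.principal {y | y - x ∈ novikovFiltration C N} := by
  rw [novikovTopology, nhds_iInf]
  refine iInf_congr fun N => ?_
  let _ : TopologicalSpace (Set.Iio N → C) := ⊥
  have : DiscreteTopology (Set.Iio N → C) := ⟨rfl⟩
  rw [nhds_induced, nhds_discrete, Filter.comap_pure]
  congr 1
  ext y
  rw [Set.mem_preimage, Set.mem_singleton_iff, Set.mem_ofPred_eq, sub_mem_coeffFiltration,
    funext_iff, Subtype.forall]
  rfl

theorem isPWO_of_finite_inter_Iic {S : Set ℝ} (h : ∀ N : ℝ, (S ∩ Set.Iic N).Finite) : S.IsPWO := by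
  rw [Set.isPWO_iff_isWF, Set.isWF_iff_no_descending_seq]
  intro f hf hmem
  refine Set.infinite_range_of_injective hf.injective ((h (f 0)).subset ?_)
  rintro _ ⟨n, rfl⟩
  exact ⟨hmem n, hf.antitone n.zero_le⟩

theorem isAdicFiltration_novikov (σ : C ≃+* C) :
    IsAdicFiltration (novikovFiltration C) (novikovAut σ) := by
  refine isAdicFiltration_coeffFiltration σ (fun x y h => Subtype.ext (HahnSeries.ext (funext h)))
    nhds_novikov (fun x => ⟨x.1.order, fun l hl => HahnSeries.coeff_eq_zero_of_lt_order hl⟩)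
    ?_ ?_ ?_
  · intro M N x y hx hy l hl
    change (x.1 * y.1).coeff l = 0
    rw [HahnSeries.coeff_mul]
    refine Finset.sum_eq_zero fun a ha => ?_
    have ha' := (Finset.mem_antidiagonal.mp ha).2.2
    simp only [id] at hl
    rcases lt_or_ge a.1 M with h | h
    · rw [mem_novikovFiltration.mp hx _ h, zero_mul]
    · rw [mem_novikovFiltration.mp hy _ (by linarith), mul_zero]
  · intro l x
    rfl
  · intro g hg
    have hfin : ∀ N : ℝ, (Function.support g ∩ Set.Iic N).Finite := by
      intro N
      obtain ⟨x, hx⟩ := hg (N + 1)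
      refine (x.2 N).subset fun l hl => ⟨?_, hl.2⟩
      have h1 : x.1.coeff l = g l := hx l (lt_of_le_of_lt hl.2 (lt_add_one N))
      rw [HahnSeries.mem_support, h1]
      exact hl.1
    exact ⟨⟨⟨g, isPWO_of_finite_inter_Iic hfin⟩, hfin⟩, fun _ => rfl⟩

theorem coeff_novikovMonomial_smul (r l : ℝ) (x : Novikov C) :
    (novikovMonomial ℤ r • x).1.coeff l = x.1.coeff (l - r) := by
  have h : (novikovMonomial ℤ r • x).1 = HahnSeries.single r 1 * x.1 := by
    rw [Algebra.smul_def, RingHom.algebraMap_toAlgebra]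
    change (HahnSeries.map _ _) * _ = _
    congr 1
    ext j
    by_cases hj : j = r <;> simp [novikovMonomial, hj]
  rw [h, HahnSeries.coeff_single_mul, one_mul]

theorem novikovMonomial_mul (r r' : ℝ) :
    novikovMonomial C r * novikovMonomial C r' = novikovMonomial C (r + r') := by
  apply Subtype.ext
  change HahnSeries.single r (1 : C) * HahnSeries.single r' 1 = HahnSeries.single (r + r') 1
  rw [HahnSeries.single_mul_single, one_mul]

theorem mem_closure_span_novikovConst (a : Novikov C) :
    a ∈ closure (Submodule.span (Novikov ℤ) (Set.range (novikovConst (C := C))) :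
      Set (Novikov C)) := by
  rw [mem_closure_iff_nhds_basis ((isAdicFiltration_novikov (RingEquiv.refl C)).basis a)]
  intro N _
  refine ⟨∑ l ∈ (a.2 N).toFinset, novikovMonomial ℤ l • novikovConst (a.1.coeff l), ?_, ?_⟩
  · exact Submodule.sum_mem _ fun n _ =>
      Submodule.smul_mem _ _ (Submodule.subset_span ⟨_, rfl⟩)
  · refine sub_mem_coeffFiltration.mpr fun i hi => ?_
    have hterm : ∀ l, novikovCoeff i (novikovMonomial ℤ l • novikovConst (a.1.coeff l)) =
        if l = i then a.1.coeff i else 0 := by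
      intro l
      change (novikovMonomial ℤ l • novikovConst (a.1.coeff l)).1.coeff i = _
      rw [coeff_novikovMonomial_smul, novikovConst, HahnSeries.coeff_single]
      by_cases hl : l = i
      · simp [hl]
      · simp [hl, sub_eq_zero, Ne.symm hl]
    rw [map_sum]
    simp only [hterm, Finset.sum_ite_eq']
    split_ifs with h
    · rfl
    · by_contra hne
      exact h ((a.2 N).mem_toFinset.mpr ⟨Ne.symm hne, le_of_lt hi⟩)

/-- The exponent of `t` at `z ^ e` in the absolute theta series of degree `m` is `e² / 2m`. -/
theorem isThetaSystem_absolute (σ : C ≃+* C) {ε : ℝ} (hε : Irrational ε) :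
    IsThetaSystem (novikovFiltration C) (novikovAut σ) (absWeight ε)
      (fun m e => novikovMonomial ℤ ((e : ℝ) ^ 2 / (2 * (m : ℕ))))
      (fun m e => (e : ℝ) ^ 2 / (2 * (m : ℕ))) 0 where
  filtration := isAdicFiltration_novikov σ
  smul_mem := by
    intro m e N x
    simp only [mem_novikovFiltration, coeff_novikovMonomial_smul]
    constructor
    · intro h d hd
      have h1 := h (d + (e : ℝ) ^ 2 / (2 * (m : ℕ))) (by linarith)
      rwa [add_sub_cancel_right] at h1
    · exact fun h d hd => h _ (by linarith)
  growth := fun m => ⟨0, fun e => by simp⟩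
  isUnit := by
    intro m k _
    refine IsUnit.of_mul_eq_one (novikovMonomial ℤ (-((k : ℤ) : ℝ) ^ 2 / (2 * (m : ℕ)))) ?_
    rw [novikovMonomial_mul]
    apply Subtype.ext
    simp [novikovMonomial, neg_div]
  weight := by
    intro q p m hm y x₁ x₂ u r hy e₁ e₂ h₁ h₂
    have hq : (0 : ℤ) < (q : ℕ) := by exact_mod_cast q.pos
    have hp : (0 : ℤ) < (p : ℕ) := by exact_mod_cast p.pos
    have hq' : (0 : ℝ) < (q : ℕ) := by exact_mod_cast q.pos
    have hp' : (0 : ℝ) < (p : ℕ) := by exact_mod_cast p.pos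
    have hm' : (m : ℝ) = (q : ℕ) + (p : ℕ) := by exact_mod_cast hm
    simp only [absWeight, u.sign_eq_one hε hq hp hm, one_smul, novikovMonomial_mul]
    congr 1
    rw [u.area_eq hq hp hm]
    push_cast
    rw [← h₁, ← h₂, hm']
    field_simp
    ring

theorem absThetaPower_eq (m : ℕ+) (k : ℕ) (i : ℤ) :
    absThetaPower m k i = novikovMonomial ℤ (((m * i + k : ℤ) : ℝ) ^ 2 / (2 * (m : ℕ))) := by
  rw [absThetaPower]
  push_cast
  rfl

end Absolute

end

/-! ### Both cases -/

theorem mainTheorem1 {C : Type*} [CommRing C] (σ : C ≃+* C) (ε : ℝ) (hε : Irrational ε) :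
    -- the relative case
    (TriangleSumsConverge (powerSeriesAut σ) (relWeight ε) ∧
      IsCommRng (floerMul (powerSeriesAut σ) (relWeight ε)) ∧
      (∀ f ∈ thetaRing (PowerSeries.C (R := C)) (powerSeriesAut σ) relThetaPower,
        ∀ g ∈ thetaRing (PowerSeries.C (R := C)) (powerSeriesAut σ) relThetaPower,
          SeriesMulConverges f g ∧
            seriesMul f g ∈
              thetaRing (PowerSeries.C (R := C)) (powerSeriesAut σ) relThetaPower) ∧
      ∃ Φ : FloerRing (powerSeriesAut σ) ≃ₗ[ℤ⟦X⟧]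
          thetaRing (PowerSeries.C (R := C)) (powerSeriesAut σ) relThetaPower,
        (∀ (m : ℕ+) (k : ℕ), k < m → ∀ a : C⟦X⟧,
          (Φ (floerGen (powerSeriesAut σ) m k a) : ℤ → C⟦X⟧) =
            thetaSeries (powerSeriesAut σ) relThetaPower m k a) ∧
        (∀ v w : FloerRing (powerSeriesAut σ),
          (Φ (floerMul (powerSeriesAut σ) (relWeight ε) v w) : ℤ → C⟦X⟧) =
            seriesMul (Φ v : ℤ → C⟦X⟧) (Φ w : ℤ → C⟦X⟧)) ∧
        (∀ (m : ℕ+) (f : ℤ → C⟦X⟧),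
          f ∈ thetaSpan (PowerSeries.C (R := C)) (powerSeriesAut σ) relThetaPower m ↔
            ∃ v : CF (powerSeriesAut σ) 0 m,
              (Φ (DirectSum.of (fun m : ℕ+ => CF (powerSeriesAut σ) 0 m) m v) : ℤ → C⟦X⟧) = f)) ∧
    -- the absolute case
    (TriangleSumsConverge (novikovAut σ) (absWeight ε) ∧
      IsCommRng (floerMul (novikovAut σ) (absWeight ε)) ∧
      (∀ f ∈ thetaRing (novikovConst (C := C)) (novikovAut σ) absThetaPower,
        ∀ g ∈ thetaRing (novikovConst (C := C)) (novikovAut σ) absThetaPower,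
          SeriesMulConverges f g ∧
            seriesMul f g ∈ thetaRing (novikovConst (C := C)) (novikovAut σ) absThetaPower) ∧
      ∃ Φ : FloerRing (novikovAut σ) ≃ₗ[Novikov ℤ]
          thetaRing (novikovConst (C := C)) (novikovAut σ) absThetaPower,
        (∀ (m : ℕ+) (k : ℕ), k < m → ∀ a : Novikov C,
          (Φ (floerGen (novikovAut σ) m k a) : ℤ → Novikov C) =
            thetaSeries (novikovAut σ) absThetaPower m k a) ∧
        (∀ v w : FloerRing (novikovAut σ),
          (Φ (floerMul (novikovAut σ) (absWeight ε) v w) : ℤ → Novikov C) =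
            seriesMul (Φ v : ℤ → Novikov C) (Φ w : ℤ → Novikov C)) ∧
        (∀ (m : ℕ+) (f : ℤ → Novikov C),
          f ∈ thetaSpan (novikovConst (C := C)) (novikovAut σ) absThetaPower m ↔
            ∃ v : CF (novikovAut σ) 0 m,
              (Φ (DirectSum.of (fun m : ℕ+ => CF (novikovAut σ) 0 m) m v) : ℤ → Novikov C)
                = f)) := by
  exact ⟨(isThetaSystem_relative σ hε).floerRing_equiv_thetaRing mem_closure_span_C relThetaPower_eq,
    (isThetaSystem_absolute σ hε).floerRing_equiv_thetaRing mem_closure_span_novikovConst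
      fun m k _ i => absThetaPower_eq m k i⟩
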